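/- **Theorem.** Let $\{V_j\}_{j\in\mathbb Z}$ be i.i.d. real random variables on a probability space $(\Omega,\mathcal F,\mathbf P)$ with $|V_j|\le\overline V<\infty$, and let $H$ be the random Schrödinger operator $$(Hu)_j=-u_{j+1}-u_{j-1}+V_ju_j,\qquad j\in\mathbb Z,$$ on $\ell^2(\mathbb Z)$. Let $\sigma(H)$ be its (non-random) spectrum, i.e. the set of reals that belong almost surely to the spectrum of $H$, and let $N_H$ be its integrated density of states, the measure on $\mathbb R$ given by $\int f\,dN_H=\mathbf E\{f_{00}(H)\}$, where $f_{jk}(H)$ denote the matrix entries of $f(H)$. Let $a$, $\varphi$, $\gamma$ be real functions on $\sigma(H)$, $a(\sigma(H))$, $\sigma(H)$ respectively, with $\gamma=\varphi\circ a$ on $\sigma(H)$. Assume that they have extensions to $\mathbb R$, denoted by the same letters, each of the form $f(x)=\int_{\mathbb R}\widehat f(t)e^{itx}\,dt$, $x\in\mathbb R$, where $$\int_{-\infty}^{\infty}(1+|t|^{\theta})|\widehat f(t)|\,dt<\infty,\qquad f=a,\varphi,\gamma,$$ for some $\theta>1$. For $M\in\mathbb N$ put $\Lambda=[-M,M]\subset\mathbb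 Z$, $|\Lambda|=2M+1$, let $a_\Lambda(H)=\{a_{jk}(H)\}_{j,k\in\Lambda}$ be the restriction of $a(H)$ to $\Lambda$, and set $$\Sigma_\Lambda=|\Lambda|^{-1/2}\Big(\mathrm{Tr}\,\varphi(a_\Lambda(H))-|\Lambda|\int_{\sigma(H)}\gamma(\lambda)\,N_H(d\lambda)\Big),\qquad \sigma_\Lambda^2=\mathbf E\{\Sigma_\Lambda^2\}.$$ Then: (i) The limit $\sigma^2=\lim_{M\to\infty}\sigma_\Lambda^2$ exists, and $$\sigma^2=\sum_{l\in\mathbb Z}C_l,\qquad C_l=\mathbf E\{\overset{\circ}{\gamma}_{00}(H)\,\overset{\circ}{\gamma}_{ll}(H)\},\qquad \overset{\circ}{\gamma}_{jj}(H)=\gamma_{jj}(H)-\mathbf E\{\gamma_{jj}(H)\},$$ the series being convergent. Moreover $$\sigma^2=\mathbf E\big\{\big(\mathbf E\{A_0|\mathcal F_0^\infty\}-\mathbf E\{A_0|\mathcal F_1^\infty\}\big)^2\big\}=\mathbf E\big\{\mathbf{Var}\{\mathbf E\{A_0|\mathcal F_0^\infty\}\,|\,\mathcal F_1^\infty\}\big\},$$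 where $A_0=V_0\int_0^1\gamma'_{00}(H|_{V_0\to uV_0})\,du$, $H|_{V_0\to uV_0}$ is $H$ with $V_0$ replaced by $uV_0$, and $\mathcal F_m^\infty$ is the $\sigma$-algebra generated by $\{V_j\}_{j\ge m}$. (ii) If $V_0$ is not almost surely constant and $\gamma$ is monotone (non-decreasing or non-increasing) and non-constant on $\sigma(H)$, then $\sigma^2>0$, and for every interval $\Delta\subset\mathbb R$ $$\lim_{M\to\infty}\mathbf P\{\sigma^{-1}\Sigma_{[-M,M]}\in\Delta\}=\Phi(\Delta),$$ where $\Phi$ is the standard Gaussian law. -/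

import Mathlib

open MeasureTheory ProbabilityTheory Filter Topology
open scoped ENNReal CompactlySupported

noncomputable section

namespace AndersonCLT

/-- The Hilbert space `ℓ²(ℤ)` of complex square-summable sequences. -/
def L2Z : Type := lp (fun _ : ℤ => ℂ) 2

instance : NormedAddCommGroup L2Z := inferInstanceAs (NormedAddCommGroup (lp (fun _ : ℤ => ℂ) 2))

instance : InnerProductSpace ℂ L2Z := inferInstanceAs (InnerProductSpace ℂ (lp (fun _ : ℤ => ℂ) 2))

instance : CompleteSpace L2Z := inferInstanceAs (CompleteSpace (lp (fun _ : ℤ => ℂ) 2))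

/-- The coordinate `u_j` of `u ∈ ℓ²(ℤ)`. -/
def coord (u : L2Z) (j : ℤ) : ℂ := u.1 j

theorem ext_coord {u w : L2Z} (h : ∀ j, coord u j = coord w j) : u = w :=
  Subtype.ext (funext h)

theorem summable_norm_sq (u : L2Z) : Summable fun j => ‖coord u j‖ ^ 2 := by
  simpa [coord] using (memℓp_gen_iff (p := 2) (by norm_num)).1 u.2

theorem norm_sq_eq (u : L2Z) : ‖u‖ ^ 2 = ∑' j, ‖coord u j‖ ^ 2 := by
  have h := lp.norm_rpow_eq_tsum (p := 2) (by norm_num) (u : lp (fun _ : ℤ => ℂ) 2)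
  simp only [ENNReal.toReal_ofNat, Real.rpow_ofNat] at h
  exact h

/-- A square-summable sequence as a vector of `ℓ²(ℤ)`. -/
def ofSummable (u : ℤ → ℂ) (h : Summable fun j => ‖u j‖ ^ 2) : L2Z :=
  ⟨u, (memℓp_gen_iff (p := 2) (by norm_num)).2 (by simpa using h)⟩

/-- The vectors `δ_k` of the standard basis of `ℓ²(ℤ)`. -/
def basisVec (k : ℤ) : L2Z := (lp.single 2 k (1 : ℂ) : lp (fun _ : ℤ => ℂ) 2)

/-- The matrix entry `A_{jk}` of a bounded operator `A` on `ℓ²(ℤ)`. -/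
def entry (A : L2Z →L[ℂ] L2Z) (j k : ℤ) : ℂ := coord (A (basisVec k)) j

/-- The translation `(S_n u)_j = u_{j+n}` of `ℓ²(ℤ)`. -/
def shiftOp (n : ℤ) : L2Z →L[ℂ] L2Z :=
  LinearMap.mkContinuous
    { toFun := fun u => ofSummable (fun j => coord u (j + n))
        ((Equiv.addRight n).summable_iff.2 (summable_norm_sq u))
      map_add' := fun _ _ => rfl
      map_smul' := fun _ _ => rfl } 1 <| by
    intro u
    rw [one_mul]
    refine le_of_sq_le_sq ?_ (norm_nonneg u)
    rw [norm_sq_eq, norm_sq_eq]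
    exact ((Equiv.addRight n).tsum_eq fun j => ‖coord u j‖ ^ 2).le

theorem norm_mul_sq_le {v : ℤ → ℝ} {C : ℝ} (hv : ∀ j, |v j| ≤ C) (u : L2Z) (j : ℤ) :
    ‖(v j : ℂ) * coord u j‖ ^ 2 ≤ C ^ 2 * ‖coord u j‖ ^ 2 := by
  rw [norm_mul, mul_pow, Complex.norm_real, Real.norm_eq_abs]
  have := hv j
  gcongr

theorem summable_mul {v : ℤ → ℝ} {C : ℝ} (hv : ∀ j, |v j| ≤ C) (u : L2Z) :
    Summable fun j => ‖(v j : ℂ) * coord u j‖ ^ 2 :=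
  Summable.of_nonneg_of_le (fun _ => sq_nonneg _) (norm_mul_sq_le hv u)
    ((summable_norm_sq u).mul_left _)

/-- The multiplication `(V u)_j = v_j u_j` by a bounded sequence `v`. -/
def mulOp (v : ℤ → ℝ) (hv : ∃ C : ℝ, ∀ j, |v j| ≤ C) : L2Z →L[ℂ] L2Z :=
  LinearMap.mkContinuous
    { toFun := fun u => ofSummable (fun j => (v j : ℂ) * coord u j) (summable_mul hv.choose_spec u)
      map_add' := fun u w => ext_coord fun j => mul_add (v j : ℂ) (coord u j) (coord w j)
      map_smul' := fun c u => ext_coord fun j => mul_left_comm (v j : ℂ) c (coord u j) }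
    hv.choose <| by
    intro u
    have hC : 0 ≤ hv.choose := (abs_nonneg _).trans (hv.choose_spec 0)
    refine le_of_sq_le_sq ?_ (mul_nonneg hC (norm_nonneg u))
    rw [mul_pow, norm_sq_eq, norm_sq_eq, ← tsum_mul_left]
    exact Summable.tsum_le_tsum (norm_mul_sq_le hv.choose_spec u) (summable_mul hv.choose_spec u)
      ((summable_norm_sq u).mul_left _)

open Classical in
/-- The discrete Schrödinger operator `(H u)_j = -u_{j+1} - u_{j-1} + v_j u_j` on `ℓ²(ℤ)` with a
bounded real potential `v` (and `0` by convention if `v` is unbounded). -/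
def schrodinger (v : ℤ → ℝ) : L2Z →L[ℂ] L2Z :=
  if hv : ∃ C : ℝ, ∀ j, |v j| ≤ C then -shiftOp 1 - shiftOp (-1) + mulOp v hv else 0

/-- The diagonal entry `f_{jj}(H)` of `f(H)`, `H` the Schrödinger operator with potential `v`. -/
def diagEntry (f : ℝ → ℝ) (v : ℤ → ℝ) (j : ℤ) : ℝ := (entry (cfc f (schrodinger v)) j j).re

/-- The restriction `A_Λ = {A_{jk}}_{j,k ∈ Λ}` to `Λ = [-M, M]`. -/
def restriction (A : L2Z →L[ℂ] L2Z) (M : ℕ) :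
    Matrix (Finset.Icc (-(M : ℤ)) M) (Finset.Icc (-(M : ℤ)) M) ℂ :=
  Matrix.of fun j k => entry A j k

/-- `Tr_Λ φ(a_Λ(H))` with `Λ = [-M, M]`, `a_Λ(H) = (a(H))_Λ`, and `H` the Schrödinger operator
with potential `v`. -/
def traceRestr (φ a : ℝ → ℝ) (v : ℤ → ℝ) (M : ℕ) : ℝ :=
  (Matrix.trace (cfc φ (restriction (cfc a (schrodinger v)) M))).re

/-- The positive functional `f ↦ ⟨x, f(A) x⟩` on `C_c(ℝ)`. -/
def spectralFunctional (A : L2Z →L[ℂ] L2Z) (x : L2Z) : C_c(ℝ, ℝ) →ₚ[ℝ] ℝ :=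
  PositiveLinearMap.mk₀
    { toFun := fun f => (inner ℂ x (cfc (f : ℝ → ℝ) A x)).re
      map_add' := fun f g => by
        have h : cfc (⇑(f + g)) A = cfc (⇑f) A + cfc (⇑g) A :=
          cfc_add (R := ℝ) (a := A) (⇑f) (⇑g) f.continuous.continuousOn g.continuous.continuousOn
        rw [h, add_apply, inner_add_right, Complex.add_re]
      map_smul' := fun c f => by
        have h : cfc (⇑(c • f)) A = c • cfc (⇑f) A :=
          cfc_smul (R := ℝ) (a := A) c (⇑f) f.continuous.continuousOn
        rw [h, smul_apply, inner_smul_right_eq_smul, Complex.smul_re]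
        rfl }
    (fun f hf => by
      have h : 0 ≤ cfc (⇑f) A := cfc_nonneg fun t _ => hf t
      exact ((ContinuousLinearMap.nonneg_iff_isPositive _).1 h).re_inner_nonneg_right x)

/-- The spectral measure of the self-adjoint operator `A` at the vector `x`: the Borel measure `ν`
on `ℝ` with `∫ f dν = ⟨x, f(A) x⟩`. -/
def spectralMeasure (A : L2Z →L[ℂ] L2Z) (x : L2Z) : Measure ℝ :=
  RealRMK.rieszMeasure (spectralFunctional A x)

section Random

variable {Ω : Type*} [MeasurableSpace Ω]

/-- The realization `j ↦ V_j(ω)` of the random potential. -/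
def pot (V : ℤ → Ω → ℝ) (ω : Ω) : ℤ → ℝ := fun j => V j ω

/-- The non-random spectrum `σ(H)` of the random operator `H`, i.e. the set of the reals that almost
surely belong to the spectrum of the realization of `H`. -/
def detSpectrum (P : Measure Ω) (V : ℤ → Ω → ℝ) : Set ℝ :=
  {x | ∀ᵐ ω ∂P, x ∈ spectrum ℝ (schrodinger (pot V ω))}

/-- The integrated density of states measure `N_H(B) = E{(1_B(H))_{00}}`: the expectation of the
spectral measure of `H` at `δ_0`. -/
def idsMeasure (P : Measure Ω) (V : ℤ → Ω → ℝ) : Measure ℝ :=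
  P.bind fun ω => spectralMeasure (schrodinger (pot V ω)) (basisVec 0)

/-- The normalized fluctuation `Σ_Λ`, `Λ = [-M, M]`. -/
def fluct (P : Measure Ω) (V : ℤ → Ω → ℝ) (φ a γ : ℝ → ℝ) (M : ℕ) (ω : Ω) : ℝ :=
  (√(2 * M + 1 : ℝ))⁻¹ *
    (traceRestr φ a (pot V ω) M
      - (2 * M + 1 : ℝ) * ∫ x in detSpectrum P V, γ x ∂(idsMeasure P V))

/-- The centered diagonal entry `γ_{jj}(H) - E{γ_{jj}(H)}`. -/
def centeredEntry (P : Measure Ω) (V : ℤ → Ω → ℝ) (γ : ℝ → ℝ) (j : ℤ) (ω : Ω) : ℝ :=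
  diagEntry γ (pot V ω) j - ∫ ω', diagEntry γ (pot V ω') j ∂P

/-- The covariance `C_l` of the diagonal entries of `γ(H)` at the sites `0` and `l`. -/
def covEntry (P : Measure Ω) (V : ℤ → Ω → ℝ) (γ : ℝ → ℝ) (l : ℤ) : ℝ :=
  ∫ ω, centeredEntry P V γ 0 ω * centeredEntry P V γ l ω ∂P

/-- `A_0 = V_0 ∫_0^1 γ'_{00}(H|_{V_0 → u V_0}) du`. -/
def siteVar (V : ℤ → Ω → ℝ) (γ : ℝ → ℝ) (ω : Ω) : ℝ :=
  V 0 ω * ∫ u in (0 : ℝ)..1, diagEntry (deriv γ) (Function.update (pot V ω) 0 (u * V 0 ω)) 0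

/-- The `σ`-algebra `F_m^∞` generated by `V_j`, `j ≥ m`. -/
@[reducible]
def sigmaFrom (V : ℤ → Ω → ℝ) (m : ℤ) : MeasurableSpace Ω :=
  ⨆ j : Set.Ici m, MeasurableSpace.comap (V j) inferInstance

end Random

/-- `f` is given on the whole axis as `f(x) = ∫ g(t) e^{itx} dt`, where (up to normalization) `g` is
the Fourier transform of `f` and `∫ (1 + |t|^θ) |g(t)| dt < ∞`. -/
def HasFourierMoment (θ : ℝ) (f : ℝ → ℝ) : Prop :=
  ∃ g : ℝ → ℂ, AEStronglyMeasurable g ∧ Integrable (fun t : ℝ => (1 + |t| ^ θ) * ‖g t‖) ∧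
    ∀ x : ℝ, (f x : ℂ) = ∫ t : ℝ, g t * Complex.exp (Complex.I * t * x)

end AndersonCLT

end

open MeasureTheory ProbabilityTheory Filter Topology
open scoped ENNReal CompactlySupported

noncomputable section

namespace AndersonCLT


/-! The potential is an i.i.d. sequence, and the whole theorem is read off from one function of it,
`originEntry`: the entry `γ_00(H)` as a function of the potential. All other diagonal entries
`γ_jj(H)` are its values at translated configurations. A Fourier moment of order `θ > 1` gives
polynomials of degree `m` that approximate `γ` on the range of the spectra within `O(m^{-θ})`
(`HasFourierMoment.exists_polynomial`). A polynomial of degree `m` in `H`, applied to `δ_0`, sees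
the potential only at distance at most `m`. Hence `γ_00(H)` depends on far sites only up to a
summable error (`QuasiLocal`, `exists_quasiLocal_originEntry`), and the problem becomes one on sums
of translates of a quasi-local function.

The trace of `φ(a_Λ(H))` may be replaced by the sum of `γ_jj(H)` over `Λ`
(`exists_abs_traceRestr_sub_le`). Tested on the eigenvectors of `a_Λ(H)`, the first order term of
`φ` cancels and the quadratic deviations add up to the squared matrix elements of `a(H)` that leave
`Λ`, a boundary quantity of order one. As `φ` is only `C^1`, the remainder is split with a free
parameter of order `|Λ|^{-1/2}`, which leaves `o(|Λ|^{1/2})`, uniformly in the potential.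

For the variance, the formal sum of all translates is renormalized by subtracting its value with the
site `0` erased (`totalChange`); the difference of the conditional expectations given the sites `≥
0` and the sites `≥ 1` does not notice the subtraction. The square of this martingale difference
expands into a double series whose diagonals telescope to the covariances
(`QuasiLocal.hasSum_covariance`). That the total change is `A_0` follows from the derivative of the
trace per period of a periodized potential, followed by an infinite period
(`tsum_originEntry_update_sub`).

The central limit theorem (`QuasiLocal.tendsto_charFun_birkhoff`) cuts the sum into adjacent blocks
and erases the potential outside each of them. The block sums are exactly independent, and the
variance of what is lost is negligible against the length once the blocks are long; the classical
theorem for i.i.d. summands does the rest.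

For positivity, suppose the variance vanishes. Then the total change is uncorrelated with every
bounded function of `V_0`. For increasing `γ` it is also increasing in `V_0`, so by symmetrization
and continuity it does not depend on `V_0` for any configuration with values in the support of the
law. Apply this to a domain wall, equal to `b` to the left of the origin and `c` from the origin on:
changing its value at the origin to `b` translates it by one site, so the total change telescopes to
the difference of `γ_00` at the constant potentials `c` and `b` (`diagEntry_const_eq`). Equality
there forces `γ` to be constant on the spectrum (`eqOn_const_of_diagEntry_const_eq`). -/

/-! ### Fourier moments: differentiability and polynomial approximation. -/

theorem abs_le_one_add_rpow {θ : ℝ} (hθ : 1 ≤ θ) (t : ℝ) : |t| ≤ 1 + |t| ^ θ := by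
  rcases le_total |t| 1 with h | h
  · have := Real.rpow_nonneg (abs_nonneg t) θ
    linarith
  · have := Real.rpow_le_rpow_of_exponent_le h hθ
    rw [Real.rpow_one] at this
    linarith

theorem integrable_of_moment {θ : ℝ} {g : ℝ → ℂ} (hg : AEStronglyMeasurable g)
    (hi : Integrable (fun t : ℝ => (1 + |t| ^ θ) * ‖g t‖)) : Integrable g := by
  refine hi.mono' hg (ae_of_all _ fun t => ?_)
  have := Real.rpow_nonneg (abs_nonneg t) θ
  nlinarith [norm_nonneg (g t)]

theorem integrable_rpow_mul_of_moment {θ : ℝ} {g : ℝ → ℂ} (hg : AEStronglyMeasurable g)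
    (hi : Integrable (fun t : ℝ => (1 + |t| ^ θ) * ‖g t‖)) :
    Integrable (fun t : ℝ => |t| ^ θ * ‖g t‖) := by
  refine hi.mono' ?_ (ae_of_all _ fun t => ?_)
  · have : Measurable fun t : ℝ => |t| ^ θ := by fun_prop
    exact this.aestronglyMeasurable.mul hg.norm
  · have := Real.rpow_nonneg (abs_nonneg t) θ
    rw [Real.norm_of_nonneg (by positivity)]
    nlinarith [norm_nonneg (g t)]

theorem integrable_abs_mul_of_moment {θ : ℝ} (hθ : 1 ≤ θ) {g : ℝ → ℂ} (hg : AEStronglyMeasurable g)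
    (hi : Integrable (fun t : ℝ => (1 + |t| ^ θ) * ‖g t‖)) :
    Integrable (fun t : ℝ => |t| * ‖g t‖) := by
  refine hi.mono' ?_ (ae_of_all _ fun t => ?_)
  · have : Measurable fun t : ℝ => |t| := by fun_prop
    exact this.aestronglyMeasurable.mul hg.norm
  · rw [Real.norm_of_nonneg (by positivity)]
    exact mul_le_mul_of_nonneg_right (abs_le_one_add_rpow hθ t) (norm_nonneg _)

theorem norm_exp_I_mul (t x : ℝ) : ‖Complex.exp (Complex.I * t * x)‖ = 1 := by
  rw [show Complex.I * t * x = ((t * x : ℝ) : ℂ) * Complex.I by push_cast; ring]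
  exact Complex.norm_exp_ofReal_mul_I _

/-- Differentiation under the Fourier integral, with the dominating function `|t| ‖g t‖`, integrable
because `θ ≥ 1`. The bound on the derivative later serves as a Lipschitz constant of `γ`. -/
theorem HasFourierMoment.exists_hasDerivAt {θ : ℝ} (hθ : 1 ≤ θ) {f : ℝ → ℝ}
    (hf : HasFourierMoment θ f) :
    ∃ f' : ℝ → ℝ, Continuous f' ∧ (∃ C, ∀ x, |f' x| ≤ C) ∧ ∀ x, HasDerivAt f (f' x) x := by
  obtain ⟨g, hg, hi, hfg⟩ := hf
  have h0 := integrable_of_moment hg hi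
  have h1 := integrable_abs_mul_of_moment hθ hg hi
  set F' : ℝ → ℝ → ℂ := fun x t =>
    g t * (Complex.exp (Complex.I * t * x) * (Complex.I * t)) with hF'
  have hnorm : ∀ x t, ‖F' x t‖ = |t| * ‖g t‖ := fun x t => by
    simp only [hF', norm_mul, norm_exp_I_mul, Complex.norm_I, Complex.norm_real, Real.norm_eq_abs]
    ring
  have hmeas : ∀ x, AEStronglyMeasurable (F' x) := fun x =>
    hg.mul (by fun_prop : Continuous fun t : ℝ =>
      Complex.exp (Complex.I * t * x) * (Complex.I * t)).aestronglyMeasurable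
  have hd : ∀ x, HasDerivAt (fun x : ℝ => (f x : ℂ)) (∫ t, F' x t) x := fun x => by
    have := (hasDerivAt_integral_of_dominated_loc_of_deriv_le (μ := volume)
      (F := fun (x t : ℝ) => g t * Complex.exp (Complex.I * t * x)) (F' := F') (x₀ := x)
      (s := Set.univ) (bound := fun t => |t| * ‖g t‖) Filter.univ_mem
      (Eventually.of_forall fun y => hg.mul (by fun_prop : Continuous fun t : ℝ =>
        Complex.exp (Complex.I * t * y)).aestronglyMeasurable)
      (h0.mono (hg.mul (by fun_prop : Continuous fun t : ℝ =>
        Complex.exp (Complex.I * t * x)).aestronglyMeasurable)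
        (ae_of_all _ fun t => by rw [norm_mul, norm_exp_I_mul, mul_one]))
      (hmeas x) (ae_of_all _ fun t y _ => (hnorm y t).le) h1
      (ae_of_all _ fun t y _ => by
        have h2 : HasDerivAt (fun y : ℝ => Complex.I * t * (y : ℂ)) (Complex.I * t) y := by
          simpa using (Complex.ofRealCLM.hasDerivAt (x := y)).const_mul (Complex.I * (t : ℂ))
        exact h2.cexp.const_mul (g t))).2
    refine this.congr_of_eventuallyEq (Eventually.of_forall fun y => hfg y)
  refine ⟨fun x => (∫ t, F' x t).re, ?_, ⟨∫ t, |t| * ‖g t‖, fun x => ?_⟩, fun x => ?_⟩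
  · refine Complex.continuous_re.comp (continuous_of_dominated (bound := fun t => |t| * ‖g t‖)
      hmeas (fun x => ae_of_all _ fun t => (hnorm x t).le) h1 (ae_of_all _ fun t => ?_))
    simp only [hF']
    fun_prop
  · refine (Complex.abs_re_le_norm _).trans ((norm_integral_le_integral_norm _).trans ?_)
    simp_rw [hnorm]
    exact le_rfl
  · exact Complex.reCLM.hasFDerivAt.comp_hasDerivAt x (hd x)

/-- Taylor polynomials approximate the exponential on an interval at the rate `(|t|/n)^θ`,
uniformly in the cut-off frequency. -/
theorem norm_exp_sub_truncated_sum_le {θ R : ℝ} (hθ : 0 ≤ θ) (hR : 0 < R) {n : ℕ} (hn : 0 < n)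
    (hnθ : θ ≤ n) {x t : ℝ} (hx : |x| ≤ R) :
    ‖Complex.exp (Complex.I * t * x) - (if |t| ≤ n / (2 * Real.exp 1 * R) then
      ∑ k ∈ Finset.range n, (Complex.I * t * x) ^ k / (k.factorial : ℂ) else 0)‖ ≤
      2 * (2 * Real.exp 1 * R / n) ^ θ * |t| ^ θ := by
  have he := Real.exp_pos 1
  have hn' : (0 : ℝ) < n := by exact_mod_cast hn
  -- The ratio of `|t|` to the cut-off. For `q ≤ 1` the Taylor remainder is at most `2 q^n ≤ 2 q^θ`;
  -- for `q > 1` the truncated sum is `0` and the exponential has modulus `1 ≤ q^θ`.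
  set q : ℝ := 2 * Real.exp 1 * R / n * |t| with hq
  have hq0 : 0 ≤ q := by positivity
  have hqθ : 2 * (2 * Real.exp 1 * R / n) ^ θ * |t| ^ θ = 2 * q ^ θ := by
    rw [hq, Real.mul_rpow (by positivity) (abs_nonneg t), mul_assoc]
  rw [hqθ]
  have hxn : ‖Complex.I * t * x‖ = |t| * |x| := by
    simp
  split_ifs with h
  · have hq1 : q ≤ 1 := by
      rw [le_div_iff₀ (by positivity)] at h
      rw [hq, div_mul_eq_mul_div, div_le_one hn']
      linarith
    have htx : |t| * |x| ≤ n * q / (2 * Real.exp 1) := by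
      rw [hq]
      have : n * (2 * Real.exp 1 * R / n * |t|) / (2 * Real.exp 1) = |t| * R := by
        field_simp
      rw [this]
      exact mul_le_mul_of_nonneg_left hx (abs_nonneg t)
    have h2 : 2 ≤ Real.exp 1 := by linarith [Real.add_one_le_exp 1]
    have hb := Complex.exp_bound' (x := Complex.I * t * x) (n := n) (by
      rw [hxn, div_le_iff₀ (by positivity)]
      refine htx.trans ?_
      rw [div_le_iff₀ (by positivity)]
      push_cast
      nlinarith)
    refine hb.trans ?_
    rw [hxn]
    -- The inequality `n^n / n! ≤ e^n` removes the factorial; this is what the factor `e` in the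
    -- cut-off is for.
    have h3 : (|t| * |x|) ^ n / n.factorial ≤ q ^ n := by
      have h4 := Real.pow_div_factorial_le_exp (n : ℝ) hn'.le n
      have h5 : Real.exp n = Real.exp 1 ^ n := by rw [← Real.exp_nat_mul, mul_one]
      calc (|t| * |x|) ^ n / n.factorial ≤ (n * q / (2 * Real.exp 1)) ^ n / n.factorial := by
            gcongr
        _ = (q / (2 * Real.exp 1)) ^ n * ((n : ℝ) ^ n / n.factorial) := by
            rw [mul_div_assoc, mul_pow]; ring
        _ ≤ (q / (2 * Real.exp 1)) ^ n * Real.exp 1 ^ n := by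
            rw [← h5]; gcongr
        _ = (q / 2) ^ n := by
            rw [← mul_pow]; congr 1; field_simp
        _ ≤ q ^ n := by gcongr; linarith
    have h6 : q ^ n ≤ q ^ θ := by
      rw [← Real.rpow_natCast]
      rcases hq0.eq_or_lt with h0 | h0
      · rw [← h0, Real.zero_rpow hn'.ne']
        exact Real.rpow_nonneg le_rfl θ
      · exact Real.rpow_le_rpow_of_exponent_ge h0 hq1 hnθ
    linarith
  · have hq1 : 1 ≤ q := by
      push Not at h
      rw [div_lt_iff₀ (by positivity)] at h
      rw [hq, div_mul_eq_mul_div, le_div_iff₀ hn']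
      linarith
    rw [sub_zero, norm_exp_I_mul]
    have := Real.one_le_rpow hq1 hθ
    linarith

/-- **Jackson-type bound**: a function with a finite Fourier moment of order `θ` is approximated on
a bounded interval by polynomials of degree `m` with an error `O(m^{-θ})`. -/
theorem HasFourierMoment.exists_polynomial {θ : ℝ} (hθ : 0 ≤ θ) {f : ℝ → ℝ}
    (hf : HasFourierMoment θ f) {R : ℝ} (hR : 0 < R) :
    ∃ C, 0 ≤ C ∧ ∀ m : ℕ, ∃ p : Polynomial ℝ, p.natDegree ≤ m ∧
      ∀ x, |x| ≤ R → |f x - p.eval x| ≤ C * ((m : ℝ) + 1) ^ (-θ) := by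
  obtain ⟨g, hg, hi, hfg⟩ := hf
  have h0 := integrable_of_moment hg hi
  have h1 := integrable_rpow_mul_of_moment hg hi
  set J0 := ∫ t, ‖g t‖ with hJ0
  set J1 := ∫ t, |t| ^ θ * ‖g t‖ with hJ1
  have hJ0' : 0 ≤ J0 := integral_nonneg fun t => norm_nonneg _
  have hJ1' : 0 ≤ J1 := integral_nonneg fun t => by positivity
  have he := Real.exp_pos 1
  refine ⟨J0 * (θ + 1) ^ θ + 2 * (2 * Real.exp 1 * R) ^ θ * J1, by positivity, fun m => ?_⟩
  have hm : (0 : ℝ) < (m : ℝ) + 1 := by positivity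
  have hmθ : (0 : ℝ) < ((m : ℝ) + 1) ^ (-θ) := Real.rpow_pos_of_pos hm _
  -- The Taylor estimate needs `θ ≤ m + 1`. For smaller degrees the zero polynomial is good enough,
  -- since `|f| ≤ J0` and `(θ + 1)^θ (m + 1)^{-θ} ≥ 1`.
  rcases lt_or_ge ((m : ℝ) + 1) θ with h | h
  · refine ⟨0, by simp, fun x _ => ?_⟩
    have hfx : |f x| ≤ J0 := by
      have : ‖(f x : ℂ)‖ ≤ J0 := by
        rw [hfg x]
        refine (norm_integral_le_integral_norm _).trans (le_of_eq ?_)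
        simp_rw [norm_mul, norm_exp_I_mul, mul_one]
        rfl
      simpa using this
    have h2 : 1 ≤ (θ + 1) ^ θ * ((m : ℝ) + 1) ^ (-θ) := by
      rw [Real.rpow_neg hm.le, ← div_eq_mul_inv, one_le_div (by positivity)]
      exact Real.rpow_le_rpow hm.le (by linarith) hθ
    have h3 : 0 ≤ 2 * (2 * Real.exp 1 * R) ^ θ * J1 * ((m : ℝ) + 1) ^ (-θ) := by positivity
    simp only [Polynomial.eval_zero, sub_zero]
    nlinarith
  · set n : ℕ := m + 1 with hn
    have hnc : (n : ℝ) = (m : ℝ) + 1 := by rw [hn]; push_cast; ring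
    set T : ℝ := n / (2 * Real.exp 1 * R) with hT
    -- The Taylor coefficients of the part of `f` with frequencies at most `T`. As `f` is real,
    -- their real parts may be used.
    set c : ℕ → ℂ := fun k => ∫ t, if |t| ≤ T then g t * ((Complex.I * t) ^ k / k.factorial) else 0
      with hc
    have hmeasT : MeasurableSet {t : ℝ | |t| ≤ T} := by measurability
    have hint : ∀ k, Integrable (fun t : ℝ =>
        if |t| ≤ T then g t * ((Complex.I * t) ^ k / k.factorial) else 0) := fun k => by
      refine (h0.norm.mul_const (T ^ k)).mono' ?_ (ae_of_all _ fun t => ?_)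
      · refine AEStronglyMeasurable.congr (f := Set.indicator {t : ℝ | |t| ≤ T}
          (fun t : ℝ => g t * ((Complex.I * t) ^ k / k.factorial))) ?_
          (ae_of_all _ fun t => by simp [Set.indicator_apply])
        exact (hg.mul (by fun_prop : Continuous fun t : ℝ =>
          ((Complex.I * t) ^ k / (k.factorial : ℂ))).aestronglyMeasurable).indicator hmeasT
      · split_ifs with ht
        · rw [norm_mul]
          refine mul_le_mul_of_nonneg_left ?_ (norm_nonneg _)
          rw [norm_div, norm_pow, norm_mul, Complex.norm_I, one_mul, Complex.norm_real,
            Complex.norm_natCast, Real.norm_eq_abs]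
          refine (div_le_self (by positivity) ?_).trans (pow_le_pow_left₀ (abs_nonneg t) ht k)
          exact_mod_cast Nat.one_le_iff_ne_zero.2 k.factorial_ne_zero
        · rw [norm_zero]
          have : 0 ≤ T := by positivity
          positivity
    refine ⟨∑ k ∈ Finset.range n, Polynomial.monomial k (c k).re, ?_, fun x hx => ?_⟩
    · refine Polynomial.natDegree_sum_le_of_forall_le _ _ fun k hk => ?_
      exact (Polynomial.natDegree_monomial_le _).trans (by
        have := Finset.mem_range.1 hk; omega)
    · have hp : ((∑ k ∈ Finset.range n, Polynomial.monomial k (c k).re).eval x) =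
          (∑ k ∈ Finset.range n, c k * (x : ℂ) ^ k).re := by
        rw [Polynomial.eval_finsetSum, Complex.re_sum]
        refine Finset.sum_congr rfl fun k _ => ?_
        rw [Polynomial.eval_monomial, ← Complex.ofReal_pow, Complex.re_mul_ofReal]
      have hs : (∑ k ∈ Finset.range n, c k * (x : ℂ) ^ k) = ∫ t, g t * (if |t| ≤ T then
          ∑ k ∈ Finset.range n, (Complex.I * t * x) ^ k / (k.factorial : ℂ) else 0) := by
        simp_rw [hc, ← integral_mul_const]
        rw [← integral_finsetSum _ fun k _ => (hint k).mul_const _]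
        refine integral_congr_ae (ae_of_all _ fun t => ?_)
        dsimp only
        split_ifs with ht
        · rw [Finset.mul_sum]
          refine Finset.sum_congr rfl fun k _ => ?_
          rw [mul_pow]; ring
        · simp
      have hint2 : Integrable (fun t : ℝ => g t * (if |t| ≤ T then
          ∑ k ∈ Finset.range n, (Complex.I * t * x) ^ k / (k.factorial : ℂ) else 0)) := by
        refine (integrable_finsetSum (Finset.range n) fun k _ =>
          (hint k).mul_const ((x : ℂ) ^ k)).congr (ae_of_all _ fun t => ?_)
        dsimp only
        split_ifs with ht
        · rw [Finset.mul_sum]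
          refine Finset.sum_congr rfl fun k _ => ?_
          rw [mul_pow]; ring
        · simp
      have hint1 : Integrable (fun t : ℝ => g t * Complex.exp (Complex.I * t * x)) :=
        h0.mono (hg.mul (by fun_prop : Continuous fun t : ℝ =>
          Complex.exp (Complex.I * t * x)).aestronglyMeasurable)
          (ae_of_all _ fun t => by rw [norm_mul, norm_exp_I_mul, mul_one])
      have hdiff : f x - (∑ k ∈ Finset.range n, Polynomial.monomial k (c k).re).eval x =
          (∫ t, g t * (Complex.exp (Complex.I * t * x) - (if |t| ≤ T then
          ∑ k ∈ Finset.range n, (Complex.I * t * x) ^ k / (k.factorial : ℂ) else 0))).re := by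
        simp_rw [mul_sub]
        rw [integral_sub hint1 hint2, ← hfg x, ← hs, hp, Complex.sub_re, Complex.ofReal_re]
      rw [hdiff]
      refine (Complex.abs_re_le_norm _).trans ((norm_integral_le_integral_norm _).trans ?_)
      have hle : ∫ t, ‖g t * (Complex.exp (Complex.I * t * x) - (if |t| ≤ T then
          ∑ k ∈ Finset.range n, (Complex.I * t * x) ^ k / (k.factorial : ℂ) else 0))‖ ≤
          ∫ t, 2 * (2 * Real.exp 1 * R / n) ^ θ * (|t| ^ θ * ‖g t‖) := by
        refine integral_mono_of_nonneg (ae_of_all _ fun t => norm_nonneg _)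
          (h1.const_mul _) (ae_of_all _ fun t => ?_)
        dsimp only
        rw [norm_mul]
        have := norm_exp_sub_truncated_sum_le hθ hR (n := n) (Nat.succ_pos m)
          (hnc ▸ h) (t := t) hx
        calc _ ≤ ‖g t‖ * (2 * (2 * Real.exp 1 * R / n) ^ θ * |t| ^ θ) :=
              mul_le_mul_of_nonneg_left this (norm_nonneg _)
          _ = _ := by ring
      refine hle.trans ?_
      rw [integral_const_mul, Real.div_rpow (by positivity) (by positivity), hnc,
        Real.rpow_neg hm.le, div_eq_mul_inv]
      have : 0 ≤ J0 * (θ + 1) ^ θ * ((((m : ℝ) + 1) ^ θ)⁻¹) := by positivity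
      rw [← hJ1]
      nlinarith


/-! ### Coordinates and matrix entries -/

@[simp] theorem coord_add (u w : L2Z) (j : ℤ) : coord (u + w) j = coord u j + coord w j := rfl

@[simp] theorem coord_sub (u w : L2Z) (j : ℤ) : coord (u - w) j = coord u j - coord w j := rfl

@[simp] theorem coord_neg (u : L2Z) (j : ℤ) : coord (-u) j = -coord u j := rfl

@[simp] theorem coord_zero (j : ℤ) : coord 0 j = 0 := rfl

@[simp] theorem coord_smul (c : ℂ) (u : L2Z) (j : ℤ) : coord (c • u) j = c * coord u j := rfl

theorem coord_real_smul (c : ℝ) (u : L2Z) (j : ℤ) : coord (c • u) j = c * coord u j := by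
  rw [← Complex.coe_smul, coord_smul]

theorem coord_sum {ι : Type*} (s : Finset ι) (u : ι → L2Z) (j : ℤ) :
    coord (∑ i ∈ s, u i) j = ∑ i ∈ s, coord (u i) j := by
  classical
  induction s using Finset.induction_on with
  | empty => simp
  | insert i s hi ih => rw [Finset.sum_insert hi, Finset.sum_insert hi, coord_add, ih]

theorem coord_basisVec (k j : ℤ) : coord (basisVec k) j = if j = k then 1 else 0 := by
  by_cases h : j = k
  · subst h
    rw [if_pos rfl]
    exact lp.single_apply_self (p := 2) (E := fun _ : ℤ => ℂ) j 1
  · rw [if_neg h]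
    exact lp.single_apply_ne (p := 2) (E := fun _ : ℤ => ℂ) k 1 h

theorem inner_eq_tsum (u w : L2Z) :
    inner ℂ u w = ∑' j, (starRingEnd ℂ) (coord u j) * coord w j := by
  have h := lp.inner_eq_tsum (𝕜 := ℂ) (G := fun _ : ℤ => ℂ) u w
  refine h.trans (tsum_congr fun j => ?_)
  rw [RCLike.inner_apply, mul_comm]
  rfl

theorem inner_basisVec_left (j : ℤ) (u : L2Z) : inner ℂ (basisVec j) u = coord u j := by
  rw [inner_eq_tsum, tsum_eq_single j]
  · simp [coord_basisVec]
  · intro i hi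
    simp [coord_basisVec, hi]

theorem norm_basisVec (k : ℤ) : ‖basisVec k‖ = 1 := by
  have h : ‖basisVec k‖ ^ 2 = 1 := by
    rw [norm_sq_eq, tsum_eq_single k]
    · simp [coord_basisVec]
    · intro i hi
      simp [coord_basisVec, hi]
  exact (pow_eq_one_iff_of_nonneg (norm_nonneg _) two_ne_zero).1 h

instance : Nontrivial L2Z :=
  ⟨⟨basisVec 0, 0, fun h => by simpa [h] using norm_basisVec 0⟩⟩

theorem norm_coord_le (u : L2Z) (j : ℤ) : ‖coord u j‖ ≤ ‖u‖ := by
  rw [← inner_basisVec_left]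
  simpa [norm_basisVec] using norm_inner_le_norm (𝕜 := ℂ) (basisVec j) u

theorem norm_entry_le (A : L2Z →L[ℂ] L2Z) (j k : ℤ) : ‖entry A j k‖ ≤ ‖A‖ := by
  refine (norm_coord_le _ _).trans ?_
  simpa [norm_basisVec] using A.le_opNorm (basisVec k)

theorem entry_eq_inner (A : L2Z →L[ℂ] L2Z) (j k : ℤ) :
    entry A j k = inner ℂ (basisVec j) (A (basisVec k)) := (inner_basisVec_left _ _).symm

theorem entry_sub (A A' : L2Z →L[ℂ] L2Z) (j k : ℤ) :
    entry (A - A') j k = entry A j k - entry A' j k := rfl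

theorem entry_add (A A' : L2Z →L[ℂ] L2Z) (j k : ℤ) :
    entry (A + A') j k = entry A j k + entry A' j k := rfl

theorem continuous_coord (j : ℤ) : Continuous fun u : L2Z => coord u j := by
  simp_rw [← inner_basisVec_left]
  fun_prop

theorem summable_conj_mul (u w : L2Z) :
    Summable fun j => (starRingEnd ℂ) (coord u j) * coord w j := by
  refine (lp.summable_inner (𝕜 := ℂ) (G := fun _ : ℤ => ℂ) u w).congr fun j => ?_
  rw [RCLike.inner_apply, mul_comm]
  rfl

theorem entry_conj {A : L2Z →L[ℂ] L2Z} (hA : IsSelfAdjoint A) (j k : ℤ) :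
    (starRingEnd ℂ) (entry A j k) = entry A k j := by
  rw [entry_eq_inner, entry_eq_inner, inner_conj_symm]
  exact (ContinuousLinearMap.isSelfAdjoint_iff_isSymmetric.1 hA) _ _

/-- Parseval's identity for `⟨A* δ_j, A' δ_k⟩`; no decay of the entries is needed for the infinite
matrix product. -/
theorem hasSum_entry_mul (A A' : L2Z →L[ℂ] L2Z) (j k : ℤ) :
    HasSum (fun i => entry A j i * entry A' i k) (entry (A * A') j k) := by
  have h : entry (A * A') j k =
      inner ℂ (ContinuousLinearMap.adjoint A (basisVec j)) (A' (basisVec k)) := by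
    rw [entry_eq_inner, ContinuousLinearMap.adjoint_inner_left]
    rfl
  rw [h, inner_eq_tsum]
  convert (summable_conj_mul (ContinuousLinearMap.adjoint A (basisVec j))
    (A' (basisVec k))).hasSum using 2 with i
  congr 1
  rw [← inner_basisVec_left, inner_conj_symm, ContinuousLinearMap.adjoint_inner_left,
    entry_eq_inner]

/-! ### The Schrödinger operator -/

@[simp] theorem coord_shiftOp (n : ℤ) (u : L2Z) (j : ℤ) : coord (shiftOp n u) j = coord u (j + n) :=
  rfl

@[simp] theorem coord_mulOp (v : ℤ → ℝ) (hv : ∃ C : ℝ, ∀ j, |v j| ≤ C) (u : L2Z) (j : ℤ) :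
    coord (mulOp v hv u) j = v j * coord u j := rfl

theorem coord_schrodinger {w : ℤ → ℝ} {B : ℝ} (hw : ∀ j, |w j| ≤ B) (u : L2Z) (j : ℤ) :
    coord (schrodinger w u) j = -coord u (j + 1) - coord u (j - 1) + w j * coord u j := by
  rw [schrodinger, dif_pos ⟨B, hw⟩]
  rfl

theorem norm_shiftOp_le (n : ℤ) : ‖shiftOp n‖ ≤ 1 :=
  LinearMap.mkContinuous_norm_le _ zero_le_one _

theorem norm_mulOp_le {w : ℤ → ℝ} {B : ℝ} (hw : ∀ j, |w j| ≤ B) : ‖mulOp w ⟨B, hw⟩‖ ≤ B := by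
  have hB : 0 ≤ B := (abs_nonneg _).trans (hw 0)
  refine ContinuousLinearMap.opNorm_le_bound _ hB fun u => ?_
  refine le_of_sq_le_sq ?_ (mul_nonneg hB (norm_nonneg u))
  rw [mul_pow, norm_sq_eq, norm_sq_eq, ← tsum_mul_left]
  exact Summable.tsum_le_tsum (norm_mul_sq_le hw u) (summable_mul hw u)
    ((summable_norm_sq u).mul_left _)

theorem norm_schrodinger_le {w : ℤ → ℝ} {B : ℝ} (hw : ∀ j, |w j| ≤ B) :
    ‖schrodinger w‖ ≤ 2 + B := by
  rw [schrodinger, dif_pos ⟨B, hw⟩]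
  refine (norm_add_le _ _).trans (add_le_add ?_ (norm_mulOp_le hw))
  refine (norm_sub_le _ _).trans ?_
  rw [norm_neg]
  linarith [norm_shiftOp_le 1, norm_shiftOp_le (-1)]

theorem inner_shiftOp (n : ℤ) (u w : L2Z) :
    inner ℂ (shiftOp n u) w = inner ℂ u (shiftOp (-n) w) := by
  rw [inner_eq_tsum, inner_eq_tsum, ← (Equiv.addRight n).tsum_eq
    fun j => (starRingEnd ℂ) (coord u j) * coord (shiftOp (-n) w) j]
  refine tsum_congr fun j => ?_
  simp

theorem inner_mulOp (v : ℤ → ℝ) (hv : ∃ C : ℝ, ∀ j, |v j| ≤ C) (u w : L2Z) :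
    inner ℂ (mulOp v hv u) w = inner ℂ u (mulOp v hv w) := by
  rw [inner_eq_tsum, inner_eq_tsum]
  refine tsum_congr fun j => ?_
  simp only [coord_mulOp, map_mul, Complex.conj_ofReal]
  ring

theorem isSelfAdjoint_schrodinger (w : ℤ → ℝ) : IsSelfAdjoint (schrodinger w) := by
  rw [schrodinger]
  split_ifs with hv
  · rw [ContinuousLinearMap.isSelfAdjoint_iff_isSymmetric]
    intro u x
    change inner ℂ (-shiftOp 1 u - shiftOp (-1) u + mulOp w hv u) x =
      inner ℂ u (-shiftOp 1 x - shiftOp (-1) x + mulOp w hv x)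
    simp only [inner_add_left, inner_add_right, inner_sub_left, inner_sub_right, inner_neg_left,
      inner_neg_right, inner_mulOp, inner_shiftOp, neg_neg]
    ring
  · exact IsSelfAdjoint.zero _

theorem spectrum_schrodinger_subset {w : ℤ → ℝ} {B : ℝ} (hw : ∀ j, |w j| ≤ B) {x : ℝ}
    (hx : x ∈ spectrum ℝ (schrodinger w)) : |x| ≤ 2 + B := by
  have := spectrum.norm_le_norm_of_mem hx
  rw [Real.norm_eq_abs] at this
  exact this.trans (norm_schrodinger_le hw)

theorem norm_cfc_schrodinger_le {w : ℤ → ℝ} {B : ℝ} (hw : ∀ j, |w j| ≤ B) {f : ℝ → ℝ} {c : ℝ}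
    (hc : 0 ≤ c) (hf : ∀ x, |x| ≤ 2 + B → |f x| ≤ c) : ‖cfc f (schrodinger w)‖ ≤ c :=
  norm_cfc_le hc fun _ hx => hf _ (spectrum_schrodinger_subset hw hx)

/-- The spectrum lies in `[-(2 + B), 2 + B]`, so a uniform error on this interval becomes an
operator norm error, the same for all potentials bounded by `B`. -/
theorem norm_cfc_sub_aeval_le {w : ℤ → ℝ} {B : ℝ} (hw : ∀ j, |w j| ≤ B) {f : ℝ → ℝ}
    (hf : Continuous f) {c : ℝ} (p : Polynomial ℝ)
    (hp : ∀ x, |x| ≤ 2 + B → |f x - p.eval x| ≤ c) :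
    ‖cfc f (schrodinger w) - Polynomial.aeval (schrodinger w) p‖ ≤ c := by
  have hB : 0 ≤ B := (abs_nonneg _).trans (hw 0)
  have hc : 0 ≤ c := (abs_nonneg _).trans (hp 0 (by simpa using by linarith))
  rw [← cfc_polynomial p (schrodinger w) (isSelfAdjoint_schrodinger w),
    ← cfc_sub f p.eval (schrodinger w) hf.continuousOn p.continuous.continuousOn]
  exact norm_cfc_schrodinger_le hw hc hp

theorem exists_polynomial_near {f : ℝ → ℝ} (hf : Continuous f) (R : ℝ) {ε : ℝ} (hε : 0 < ε) :
    ∃ p : Polynomial ℝ, ∀ x, |x| ≤ R → |f x - p.eval x| ≤ ε := by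
  obtain ⟨p, hp⟩ := exists_polynomial_near_of_continuousOn (-R) R f hf.continuousOn ε hε
  exact ⟨p, fun x hx => by rw [abs_sub_comm]; exact (hp x (abs_le.1 hx)).le⟩

/-! ### Finite range and locality of polynomials of the Schrödinger operator -/

/-- Each factor `H` spreads the support of a vector by one site. -/
theorem coord_pow_schrodinger_eq_zero {w : ℤ → ℝ} {B : ℝ} (hw : ∀ j, |w j| ≤ B) (a : ℤ) (k : ℕ) :
    ∀ i, (k : ℤ) < |i - a| → coord ((schrodinger w ^ k) (basisVec a)) i = 0 := by
  induction k with
  | zero =>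
    intro i hi
    have : i ≠ a := fun h => by simp [h] at hi
    simp [coord_basisVec, this]
  | succ k ih =>
    intro i hi
    push_cast at hi
    rw [pow_succ', mul_apply_eq_comp, coord_schrodinger hw, ih (i + 1) (by grind),
      ih (i - 1) (by grind), ih i (by grind)]
    simp

/-- By finite range, `H^k δ_a` vanishes outside `[a - k, a + k]`, so at the next step the potential
there multiplies zero. -/
theorem pow_schrodinger_congr {w w' : ℤ → ℝ} {B : ℝ} (hw : ∀ j, |w j| ≤ B) (hw' : ∀ j, |w' j| ≤ B)
    (a : ℤ) (k : ℕ) : (∀ i, |i - a| ≤ k → w i = w' i) →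
      (schrodinger w ^ k) (basisVec a) = (schrodinger w' ^ k) (basisVec a) := by
  induction k with
  | zero => intro _; simp
  | succ k ih =>
    intro h
    rw [pow_succ', pow_succ', mul_apply_eq_comp, mul_apply_eq_comp,
      ← ih fun i hi => h i (by push_cast; omega)]
    refine ext_coord fun i => ?_
    rw [coord_schrodinger hw, coord_schrodinger hw']
    by_cases hi : |i - a| ≤ k
    · rw [h i (by push_cast; omega)]
    · rw [coord_pow_schrodinger_eq_zero hw a k i (by omega)]
      simp

theorem aeval_apply_eq_sum (A : L2Z →L[ℂ] L2Z) (p : Polynomial ℝ) (u : L2Z) :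
    Polynomial.aeval A p u = ∑ k ∈ Finset.range (p.natDegree + 1), p.coeff k • (A ^ k) u := by
  rw [Polynomial.aeval_eq_sum_range]
  simp

theorem entry_aeval_eq_zero {w : ℤ → ℝ} {B : ℝ} (hw : ∀ j, |w j| ≤ B) {p : Polynomial ℝ} {m : ℕ}
    (hp : p.natDegree ≤ m) {i a : ℤ} (h : (m : ℤ) < |i - a|) :
    entry (Polynomial.aeval (schrodinger w) p) i a = 0 := by
  rw [entry, aeval_apply_eq_sum, coord_sum]
  refine Finset.sum_eq_zero fun k hk => ?_
  have := Finset.mem_range.1 hk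
  rw [coord_real_smul, coord_pow_schrodinger_eq_zero hw a k i (by omega), mul_zero]

theorem aeval_schrodinger_congr {w w' : ℤ → ℝ} {B : ℝ} (hw : ∀ j, |w j| ≤ B)
    (hw' : ∀ j, |w' j| ≤ B) {p : Polynomial ℝ} {m : ℕ} (hp : p.natDegree ≤ m) {a : ℤ}
    (h : ∀ i, |i - a| ≤ m → w i = w' i) :
    Polynomial.aeval (schrodinger w) p (basisVec a) =
      Polynomial.aeval (schrodinger w') p (basisVec a) := by
  rw [aeval_apply_eq_sum, aeval_apply_eq_sum]
  refine Finset.sum_congr rfl fun k hk => ?_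
  have := Finset.mem_range.1 hk
  rw [pow_schrodinger_congr hw hw' a k fun i hi => h i (by omega)]

/-- `f` is approximated on `[-R, R]` by polynomials of degree `m` with an error at most `β m`. -/
def PolyRate (R : ℝ) (f : ℝ → ℝ) (β : ℕ → ℝ) : Prop :=
  ∀ m : ℕ, ∃ p : Polynomial ℝ, p.natDegree ≤ m ∧ ∀ x, |x| ≤ R → |f x - p.eval x| ≤ β m

/-- The approximating polynomial of degree `m` has no entries at distance greater than `m`, so only
the approximation error is left. -/
theorem PolyRate.norm_entry_le {w : ℤ → ℝ} {B : ℝ} (hw : ∀ j, |w j| ≤ B) {f : ℝ → ℝ}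
    (hf : Continuous f) {β : ℕ → ℝ} (hβ : PolyRate (2 + B) f β) {m : ℕ} {i a : ℤ}
    (h : (m : ℤ) < |i - a|) : ‖entry (cfc f (schrodinger w)) i a‖ ≤ β m := by
  obtain ⟨p, hp, hpf⟩ := hβ m
  have h1 := (AndersonCLT.norm_entry_le _ i a).trans (norm_cfc_sub_aeval_le hw hf p hpf)
  rwa [entry_sub, entry_aeval_eq_zero hw hp h, sub_zero] at h1

/-- A polynomial of degree `m` in `H` cannot tell the two potentials apart at `δ_a`; the
approximation error enters once for each potential. -/
theorem PolyRate.norm_entry_sub_le {w w' : ℤ → ℝ} {B : ℝ} (hw : ∀ j, |w j| ≤ B)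
    (hw' : ∀ j, |w' j| ≤ B) {f : ℝ → ℝ}
    (hf : Continuous f) {β : ℕ → ℝ} (hβ : PolyRate (2 + B) f β) {m : ℕ} {a : ℤ} (i : ℤ)
    (h : ∀ i, |i - a| ≤ m → w i = w' i) :
    ‖entry (cfc f (schrodinger w)) i a - entry (cfc f (schrodinger w')) i a‖ ≤ 2 * β m := by
  obtain ⟨p, hp, hpf⟩ := hβ m
  have h1 := (AndersonCLT.norm_entry_le _ i a).trans (norm_cfc_sub_aeval_le hw hf p hpf)
  have h2 := (AndersonCLT.norm_entry_le _ i a).trans (norm_cfc_sub_aeval_le hw' hf p hpf)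
  rw [entry_sub] at h1 h2
  have h3 : entry (Polynomial.aeval (schrodinger w) p) i a =
      entry (Polynomial.aeval (schrodinger w') p) i a := by
    rw [entry, entry, aeval_schrodinger_congr hw hw' hp h]
  rw [h3] at h1
  calc _ = ‖(entry (cfc f (schrodinger w)) i a - entry (Polynomial.aeval (schrodinger w') p) i a) -
      (entry (cfc f (schrodinger w')) i a - entry (Polynomial.aeval (schrodinger w') p) i a)‖ := by
        congr 1; ring
    _ ≤ _ := (norm_sub_le _ _).trans (by linarith)

theorem PolyRate.abs_diagEntry_sub_le {w w' : ℤ → ℝ} {B : ℝ} (hw : ∀ j, |w j| ≤ B)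
    (hw' : ∀ j, |w' j| ≤ B) {f : ℝ → ℝ} (hf : Continuous f) {β : ℕ → ℝ}
    (hβ : PolyRate (2 + B) f β) {m : ℕ} {j : ℤ} (h : ∀ i, |i - j| ≤ m → w i = w' i) :
    |diagEntry f w j - diagEntry f w' j| ≤ 2 * β m := by
  rw [diagEntry, diagEntry, ← Complex.sub_re]
  exact (Complex.abs_re_le_norm _).trans (hβ.norm_entry_sub_le hw hw' hf j h)

theorem abs_diagEntry_le {w : ℤ → ℝ} {B : ℝ} (hw : ∀ j, |w j| ≤ B) {f : ℝ → ℝ} {c : ℝ}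
    (hc : 0 ≤ c) (hf : ∀ x, |x| ≤ 2 + B → |f x| ≤ c) (j : ℤ) : |diagEntry f w j| ≤ c :=
  (Complex.abs_re_le_norm _).trans ((norm_entry_le _ _ _).trans (norm_cfc_schrodinger_le hw hc hf))

theorem abs_diagEntry_sub_diagEntry_le {w : ℤ → ℝ} {B : ℝ} (hw : ∀ j, |w j| ≤ B) {f g : ℝ → ℝ}
    (hf : Continuous f) (hg : Continuous g) {c : ℝ} (hc : 0 ≤ c)
    (hfg : ∀ x, |x| ≤ 2 + B → |f x - g x| ≤ c) (j : ℤ) :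
    |diagEntry f w j - diagEntry g w j| ≤ c := by
  rw [diagEntry, diagEntry, ← Complex.sub_re, ← entry_sub,
    ← cfc_sub f g (schrodinger w) hf.continuousOn hg.continuousOn]
  exact abs_diagEntry_le hw hc hfg j

/-! ### Strong continuity in the potential -/

/-- The potential `w` truncated to the values in `[-B, B]`. -/
def clamp (B : ℝ) (w : ℤ → ℝ) : ℤ → ℝ := fun j => max (-B) (min B (w j))

theorem abs_clamp_le {B : ℝ} (hB : 0 ≤ B) (w : ℤ → ℝ) (j : ℤ) : |clamp B w j| ≤ B := by
  rw [abs_le, clamp]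
  exact ⟨le_max_left _ _, max_le (by linarith) (min_le_left _ _)⟩

theorem clamp_of_abs_le {B : ℝ} {w : ℤ → ℝ} (hw : ∀ j, |w j| ≤ B) : clamp B w = w := by
  ext j
  have := abs_le.1 (hw j)
  rw [clamp, min_eq_right this.2, max_eq_right this.1]

theorem continuous_clamp (B : ℝ) : Continuous (clamp B) := by
  unfold clamp
  fun_prop

/-- Dominated convergence for the series `∑ |w_j - w⁰_j|² |u_j|²`. Pointwise convergence of
potentials gives strong convergence only. Clamping supplies the domination and lets the statement
hold on all configurations, so that continuity also yields measurability. -/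
theorem continuous_schrodinger_clamp_apply {B : ℝ} (hB : 0 ≤ B) (u : L2Z) :
    Continuous fun w => schrodinger (clamp B w) u := by
  refine continuous_iff_continuousAt.2 fun w₀ => ?_
  rw [ContinuousAt, tendsto_iff_norm_sub_tendsto_zero]
  have hs : ∀ w, ‖schrodinger (clamp B w) u - schrodinger (clamp B w₀) u‖ ^ 2 =
      ∑' j, ‖(((clamp B w j - clamp B w₀ j : ℝ) : ℂ)) * coord u j‖ ^ 2 := fun w => by
    rw [norm_sq_eq]
    refine tsum_congr fun j => ?_
    rw [coord_sub, coord_schrodinger (abs_clamp_le hB w), coord_schrodinger (abs_clamp_le hB w₀)]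
    congr 2
    push_cast
    ring
  have hc : Continuous fun w =>
      ∑' j, ‖(((clamp B w j - clamp B w₀ j : ℝ) : ℂ)) * coord u j‖ ^ 2 := by
    refine continuous_tsum (u := fun j => (2 * B) ^ 2 * ‖coord u j‖ ^ 2) (fun j => ?_)
      ((summable_norm_sq u).mul_left _) fun j w => ?_
    · have : Continuous fun w : ℤ → ℝ => clamp B w j :=
        (continuous_apply j).comp (continuous_clamp B)
      fun_prop
    · rw [norm_pow, norm_norm]
      refine norm_mul_sq_le (v := fun j => clamp B w j - clamp B w₀ j) (fun j => ?_) u j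
      refine (abs_sub _ _).trans ?_
      linarith [abs_clamp_le hB w j, abs_clamp_le hB w₀ j]
  have h0 : Tendsto (fun w => ‖schrodinger (clamp B w) u - schrodinger (clamp B w₀) u‖ ^ 2)
      (𝓝 w₀) (𝓝 0) := by
    simp_rw [hs]
    convert hc.tendsto w₀ using 2
    simp
  have h1 := (Real.continuous_sqrt.tendsto 0).comp h0
  rw [Real.sqrt_zero] at h1
  refine h1.congr fun w => ?_
  simp [Real.sqrt_sq (norm_nonneg _)]

/-- Joint continuity follows from strong continuity because the norms are uniformly at most `2 + B`;
it carries the induction over powers. -/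
theorem Continuous.schrodinger_clamp {X : Type*} [TopologicalSpace X] {B : ℝ} (hB : 0 ≤ B)
    {w : X → ℤ → ℝ} {u : X → L2Z} (hw : Continuous w) (hu : Continuous u) :
    Continuous fun x => schrodinger (clamp B (w x)) (u x) := by
  refine continuous_iff_continuousAt.2 fun x₀ => ?_
  rw [ContinuousAt, tendsto_iff_norm_sub_tendsto_zero]
  have h1 : Tendsto (fun x => (2 + B) * ‖u x - u x₀‖ +
      ‖schrodinger (clamp B (w x)) (u x₀) - schrodinger (clamp B (w x₀)) (u x₀)‖) (𝓝 x₀) (𝓝 0) := by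
    have h2 : Continuous fun x => (2 + B) * ‖u x - u x₀‖ +
        ‖schrodinger (clamp B (w x)) (u x₀) - schrodinger (clamp B (w x₀)) (u x₀)‖ := by
      have := (continuous_schrodinger_clamp_apply hB (u x₀)).comp hw
      simp only [Function.comp_def] at this
      fun_prop
    convert h2.tendsto x₀ using 2
    simp
  refine squeeze_zero (fun _ => norm_nonneg _) (fun x => ?_) h1
  have : schrodinger (clamp B (w x)) (u x) - schrodinger (clamp B (w x₀)) (u x₀) =
      schrodinger (clamp B (w x)) (u x - u x₀) +
      (schrodinger (clamp B (w x)) (u x₀) - schrodinger (clamp B (w x₀)) (u x₀)) := by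
    rw [map_sub]; abel
  rw [this]
  refine (norm_add_le _ _).trans (add_le_add ?_ le_rfl)
  exact ((schrodinger _).le_opNorm _).trans (mul_le_mul_of_nonneg_right
    (norm_schrodinger_le (abs_clamp_le hB _)) (norm_nonneg _))

theorem continuous_pow_schrodinger_clamp {B : ℝ} (hB : 0 ≤ B) (k : ℕ) (u : L2Z) :
    Continuous fun w => (schrodinger (clamp B w) ^ k) u := by
  induction k with
  | zero => simpa using continuous_const
  | succ k ih =>
    simp_rw [pow_succ', mul_apply_eq_comp]
    exact Continuous.schrodinger_clamp hB continuous_id ih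

theorem continuous_aeval_schrodinger_clamp {B : ℝ} (hB : 0 ≤ B) (p : Polynomial ℝ) (u : L2Z) :
    Continuous fun w => Polynomial.aeval (schrodinger (clamp B w)) p u := by
  simp_rw [aeval_apply_eq_sum]
  exact continuous_finsetSum _ fun k _ => (continuous_pow_schrodinger_clamp hB k u).const_smul _

/-- Functions of the Schrödinger operator are strongly continuous in the potential, for the
topology of pointwise convergence of potentials with values in `[-B, B]`. -/
theorem continuous_cfc_schrodinger_clamp {B : ℝ} (hB : 0 ≤ B) {f : ℝ → ℝ} (hf : Continuous f)
    (u : L2Z) : Continuous fun w => cfc f (schrodinger (clamp B w)) u := by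
  refine continuous_of_uniform_approx_of_continuous fun s hs => ?_
  obtain ⟨ε, hε, hεs⟩ := Metric.mem_uniformity_dist.1 hs
  have hc : 0 < ε / (2 * (‖u‖ + 1)) := by positivity
  obtain ⟨p, hp⟩ := exists_polynomial_near hf (2 + B) hc
  refine ⟨_, continuous_aeval_schrodinger_clamp hB p u, fun w => hεs ?_⟩
  rw [dist_eq_norm, ← sub_apply]
  refine (ContinuousLinearMap.le_opNorm _ _).trans_lt ?_
  calc _ ≤ ε / (2 * (‖u‖ + 1)) * ‖u‖ := mul_le_mul_of_nonneg_right
        (norm_cfc_sub_aeval_le (abs_clamp_le hB w) hf p hp) (norm_nonneg _)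
    _ < ε := by
      rw [div_mul_eq_mul_div, div_lt_iff₀ (by positivity)]
      nlinarith [norm_nonneg u]

theorem continuous_entry_cfc_clamp {B : ℝ} (hB : 0 ≤ B) {f : ℝ → ℝ} (hf : Continuous f) (j k : ℤ) :
    Continuous fun w => entry (cfc f (schrodinger (clamp B w))) j k :=
  (continuous_coord j).comp (continuous_cfc_schrodinger_clamp hB hf (basisVec k))

theorem continuous_diagEntry_clamp {B : ℝ} (hB : 0 ≤ B) {f : ℝ → ℝ} (hf : Continuous f) (j : ℤ) :
    Continuous fun w => diagEntry f (clamp B w) j :=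
  Complex.continuous_re.comp (continuous_entry_cfc_clamp hB hf j j)

/-! ### Translations -/

/-- The translate of a configuration. -/
def translate (n : ℤ) (w : ℤ → ℝ) : ℤ → ℝ := fun j => w (j + n)

theorem shiftOp_basisVec (n k : ℤ) : shiftOp n (basisVec k) = basisVec (k - n) := by
  refine ext_coord fun j => ?_
  rw [coord_shiftOp, coord_basisVec, coord_basisVec]
  congr 1
  exact propext ⟨fun h => by omega, fun h => by omega⟩

theorem semiconjBy_shiftOp {w : ℤ → ℝ} {B : ℝ} (hw : ∀ j, |w j| ≤ B) (n : ℤ) :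
    SemiconjBy (shiftOp n) (schrodinger w) (schrodinger (translate n w)) := by
  refine ContinuousLinearMap.ext fun u => ext_coord fun j => ?_
  have hw' : ∀ j, |translate n w j| ≤ B := fun j => hw _
  rw [mul_apply_eq_comp, mul_apply_eq_comp, coord_shiftOp,
    coord_schrodinger hw, coord_schrodinger hw', coord_shiftOp, coord_shiftOp, coord_shiftOp,
    translate]
  ring_nf

theorem semiconjBy_aeval {S A A' : L2Z →L[ℂ] L2Z} (h : SemiconjBy S A A') (p : Polynomial ℝ) :
    SemiconjBy S (Polynomial.aeval A p) (Polynomial.aeval A' p) := by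
  refine ContinuousLinearMap.ext fun u => ?_
  rw [mul_apply_eq_comp, mul_apply_eq_comp, aeval_apply_eq_sum,
    aeval_apply_eq_sum, map_sum]
  refine Finset.sum_congr rfl fun k _ => ?_
  rw [← mul_apply_eq_comp, ← (h.pow_right k).eq, mul_apply_eq_comp]
  exact map_real_smul S S.continuous _ _

/-- For polynomials the intertwining relation is algebra; norm approximation carries it to
continuous functions. -/
theorem semiconjBy_shiftOp_cfc {w : ℤ → ℝ} {B : ℝ} (hw : ∀ j, |w j| ≤ B) {f : ℝ → ℝ}
    (hf : Continuous f) (n : ℤ) :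
    SemiconjBy (shiftOp n) (cfc f (schrodinger w)) (cfc f (schrodinger (translate n w))) := by
  have hw' : ∀ j, |translate n w j| ≤ B := fun j => hw _
  rw [SemiconjBy, ← sub_eq_zero, ← norm_le_zero_iff]
  refine le_of_forall_pos_le_add fun ε hε => ?_
  obtain ⟨p, hp⟩ := exists_polynomial_near hf (2 + B) (half_pos hε)
  have h1 := norm_cfc_sub_aeval_le hw hf p hp
  have h2 := norm_cfc_sub_aeval_le hw' hf p hp
  have h3 := (semiconjBy_aeval (semiconjBy_shiftOp hw n) p).eq
  have h4 : shiftOp n * cfc f (schrodinger w) - cfc f (schrodinger (translate n w)) * shiftOp n =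
      shiftOp n * (cfc f (schrodinger w) - Polynomial.aeval (schrodinger w) p) -
      (cfc f (schrodinger (translate n w)) - Polynomial.aeval (schrodinger (translate n w)) p) *
        shiftOp n := by
    rw [mul_sub, sub_mul, h3]; abel
  rw [h4]
  refine (norm_sub_le _ _).trans ?_
  have h5 := norm_mul_le (shiftOp n) (cfc f (schrodinger w) - Polynomial.aeval (schrodinger w) p)
  have h6 := norm_mul_le (cfc f (schrodinger (translate n w)) -
    Polynomial.aeval (schrodinger (translate n w)) p) (shiftOp n)
  have h7 := norm_shiftOp_le n
  nlinarith [norm_nonneg (shiftOp n), norm_nonneg (cfc f (schrodinger w) -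
    Polynomial.aeval (schrodinger w) p), norm_nonneg (cfc f (schrodinger (translate n w)) -
    Polynomial.aeval (schrodinger (translate n w)) p)]

theorem entry_cfc_translate {w : ℤ → ℝ} {B : ℝ} (hw : ∀ j, |w j| ≤ B) {f : ℝ → ℝ}
    (hf : Continuous f) (n j k : ℤ) :
    entry (cfc f (schrodinger (translate n w))) j k =
      entry (cfc f (schrodinger w)) (j + n) (k + n) := by
  have h := congrArg (fun A : L2Z →L[ℂ] L2Z => coord (A (basisVec (k + n))) j)
    (semiconjBy_shiftOp_cfc hw hf n).eq
  simp only [mul_apply_eq_comp, shiftOp_basisVec, coord_shiftOp,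
    add_sub_cancel_right] at h
  exact h.symm

theorem diagEntry_translate {w : ℤ → ℝ} {B : ℝ} (hw : ∀ j, |w j| ≤ B) {f : ℝ → ℝ}
    (hf : Continuous f) (n j : ℤ) :
    diagEntry f (translate n w) j = diagEntry f w (j + n) := by
  rw [diagEntry, diagEntry, entry_cfc_translate hw hf]


/-! ### Bounded measurable functions -/

/-- Bounded measurable real functions. -/
structure BddMeas {X : Type*} [MeasurableSpace X] (f : X → ℝ) : Prop where
  measurable : Measurable f
  bdd : ∃ C, ∀ x, |f x| ≤ C

namespace BddMeas

variable {X Y : Type*} [MeasurableSpace X] [MeasurableSpace Y] {f g : X → ℝ}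

theorem const (c : ℝ) : BddMeas fun _ : X => c := ⟨measurable_const, |c|, fun _ => le_rfl⟩

theorem add (hf : BddMeas f) (hg : BddMeas g) : BddMeas fun x => f x + g x := by
  obtain ⟨C, hC⟩ := hf.bdd
  obtain ⟨D, hD⟩ := hg.bdd
  exact ⟨hf.measurable.add hg.measurable, C + D,
    fun x => (abs_add_le _ _).trans (add_le_add (hC x) (hD x))⟩

theorem sub (hf : BddMeas f) (hg : BddMeas g) : BddMeas fun x => f x - g x := by
  obtain ⟨C, hC⟩ := hf.bdd
  obtain ⟨D, hD⟩ := hg.bdd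
  exact ⟨hf.measurable.sub hg.measurable, C + D,
    fun x => (abs_sub _ _).trans (add_le_add (hC x) (hD x))⟩

theorem mul (hf : BddMeas f) (hg : BddMeas g) : BddMeas fun x => f x * g x := by
  obtain ⟨C, hC⟩ := hf.bdd
  obtain ⟨D, hD⟩ := hg.bdd
  refine ⟨hf.measurable.mul hg.measurable, C * D, fun x => ?_⟩
  rw [abs_mul]
  exact mul_le_mul (hC x) (hD x) (abs_nonneg _) ((abs_nonneg _).trans (hC x))

theorem comp (hf : BddMeas f) {φ : Y → X} (hφ : Measurable φ) : BddMeas fun y => f (φ y) := by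
  obtain ⟨C, hC⟩ := hf.bdd
  exact ⟨hf.measurable.comp hφ, C, fun y => hC _⟩

theorem sum {ι : Type*} (s : Finset ι) {f : ι → X → ℝ} (hf : ∀ i ∈ s, BddMeas (f i)) :
    BddMeas fun x => ∑ i ∈ s, f i x := by
  classical
  induction s using Finset.induction_on with
  | empty => simpa using const (X := X) 0
  | insert i s hi ih =>
    simp_rw [Finset.sum_insert hi]
    exact (hf i (Finset.mem_insert_self i s)).add
      (ih fun j hj => hf j (Finset.mem_insert_of_mem hj))

theorem memLp (hf : BddMeas f) (P : Measure X) [IsFiniteMeasure P] (p : ℝ≥0∞) : MemLp f p P := by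
  obtain ⟨C, hC⟩ := hf.bdd
  exact MemLp.of_bound hf.measurable.aestronglyMeasurable C (ae_of_all _ hC)

theorem integrable (hf : BddMeas f) (P : Measure X) [IsFiniteMeasure P] : Integrable f P :=
  memLp_one_iff_integrable.1 (hf.memLp P 1)

end BddMeas

section Moments

variable {X : Type*} [MeasurableSpace X] {P : Measure X} [IsProbabilityMeasure P] {f g : X → ℝ}

theorem abs_integral_le_of_abs_le {c : ℝ} (h : ∀ x, |f x| ≤ c) : |∫ x, f x ∂P| ≤ c := by
  simpa using norm_integral_le_of_norm_le_const (μ := P) (f := f) (C := c)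
    (ae_of_all _ fun x => by simpa using h x)

theorem integral_abs_sq_le (hf : BddMeas f) : (∫ x, |f x| ∂P) ^ 2 ≤ ∫ x, f x ^ 2 ∂P := by
  have habs : BddMeas fun x => |f x| := by
    obtain ⟨C, hC⟩ := hf.bdd
    exact ⟨hf.measurable.abs, C, fun x => by rw [abs_abs]; exact hC x⟩
  have h := variance_nonneg (fun x => |f x|) P
  rw [variance_eq_sub (habs.memLp P 2)] at h
  simpa using h

theorem integral_abs_le_sqrt (hf : BddMeas f) : ∫ x, |f x| ∂P ≤ √(∫ x, f x ^ 2 ∂P) :=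
  Real.le_sqrt_of_sq_le (integral_abs_sq_le hf)

theorem integral_abs_sub_mean_le (hf : BddMeas f) :
    ∫ x, |f x - ∫ y, f y ∂P| ∂P ≤ √Var[f; P] := by
  rw [variance_eq_integral hf.measurable.aemeasurable]
  exact integral_abs_le_sqrt (hf.sub (BddMeas.const _))

/-- Centering `g` alone is enough, so the bound on `f` is used as it stands and `g` enters through
its standard deviation. -/
theorem abs_covariance_le_of_abs_le {c : ℝ} (hf : BddMeas f) (hg : BddMeas g)
    (h : ∀ x, |f x| ≤ c) : |cov[f, g; P]| ≤ c * √Var[g; P] := by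
  have h1 : cov[f, g; P] = ∫ x, f x * (g x - ∫ y, g y ∂P) ∂P := by
    rw [covariance_eq_sub (hf.memLp P 2) (hg.memLp P 2)]
    simp_rw [mul_sub]
    rw [integral_sub ((hf.mul hg).integrable P) ((hf.mul (BddMeas.const _)).integrable P),
      integral_mul_const]
    rfl
  have hc : 0 ≤ c := by
    obtain ⟨x⟩ : Nonempty X := nonempty_of_isProbabilityMeasure P
    exact (abs_nonneg _).trans (h x)
  rw [h1]
  calc |∫ x, f x * (g x - ∫ y, g y ∂P) ∂P| ≤ ∫ x, |f x * (g x - ∫ y, g y ∂P)| ∂P :=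
        abs_integral_le_integral_abs
    _ ≤ ∫ x, c * |g x - ∫ y, g y ∂P| ∂P := by
        refine integral_mono_of_nonneg (ae_of_all _ fun x => abs_nonneg _) ?_
          (ae_of_all _ fun x => ?_)
        · exact ((hg.sub (BddMeas.const _)).integrable P).abs.const_mul c
        · dsimp only
          rw [abs_mul]
          exact mul_le_mul_of_nonneg_right (h x) (abs_nonneg _)
    _ ≤ c * √Var[g; P] := by
        rw [integral_const_mul]
        exact mul_le_mul_of_nonneg_left (integral_abs_sub_mean_le hg) hc

end Moments

/-! ### The product measure -/

variable (μ : Measure ℝ) [IsProbabilityMeasure μ]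

/-- The law of an i.i.d. sequence with the marginal law `μ`. -/
abbrev iid : Measure (ℤ → ℝ) := Measure.infinitePi fun _ : ℤ => μ

open Classical in
/-- The configuration that equals `w` on `I` and `w'` off `I`. -/
def splice (I : Set ℤ) (w w' : ℤ → ℝ) : ℤ → ℝ := fun j => if j ∈ I then w j else w' j

theorem splice_of_mem {I : Set ℤ} {j : ℤ} (h : j ∈ I) (w w' : ℤ → ℝ) : splice I w w' j = w j :=
  if_pos h

theorem splice_of_notMem {I : Set ℤ} {j : ℤ} (h : j ∉ I) (w w' : ℤ → ℝ) :
    splice I w w' j = w' j := if_neg h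

theorem measurable_splice (I : Set ℤ) :
    Measurable fun p : (ℤ → ℝ) × (ℤ → ℝ) => splice I p.1 p.2 := by
  refine measurable_pi_lambda _ fun j => ?_
  by_cases h : j ∈ I
  · simp only [splice_of_mem h]
    fun_prop
  · simp only [splice_of_notMem h]
    fun_prop

theorem measurable_splice_left (I : Set ℤ) (w' : ℤ → ℝ) : Measurable fun w => splice I w w' :=
  (measurable_splice I).comp (measurable_id.prodMk measurable_const)

/-- On a cylinder the probability factors over the coordinates in `I` and those off `I`. Resampling
a set of coordinates therefore keeps the law, and independence and conditioning below are all
reduced to this. -/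
theorem measurePreserving_splice (I : Set ℤ) :
    MeasurePreserving (fun p : (ℤ → ℝ) × (ℤ → ℝ) => splice I p.1 p.2)
      ((iid μ).prod (iid μ)) (iid μ) := by
  classical
  refine ⟨measurable_splice I, Measure.eq_infinitePi _ fun s t ht => ?_⟩
  rw [Measure.map_apply (measurable_splice I) (.pi s.countable_toSet fun i _ => ht i)]
  have h1 : (fun p : (ℤ → ℝ) × (ℤ → ℝ) => splice I p.1 p.2) ⁻¹' Set.pi s t =
      (Set.pi (s.filter (· ∈ I) : Finset ℤ) t) ×ˢ (Set.pi (s.filter (· ∉ I) : Finset ℤ) t) := by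
    ext p
    simp only [Set.mem_preimage, Set.mem_pi, Set.mem_prod, Finset.coe_filter, Set.mem_ofPred_eq,
      Finset.mem_coe]
    constructor
    · intro h
      exact ⟨fun i hi => by simpa [splice_of_mem hi.2] using h i hi.1,
        fun i hi => by simpa [splice_of_notMem hi.2] using h i hi.1⟩
    · rintro ⟨ha, hb⟩ i hi
      by_cases hI : i ∈ I
      · rw [splice_of_mem hI]; exact ha i ⟨hi, hI⟩
      · rw [splice_of_notMem hI]; exact hb i ⟨hi, hI⟩
  rw [h1, Measure.prod_prod, Measure.infinitePi_pi _ fun i _ => ht i,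
    Measure.infinitePi_pi _ fun i _ => ht i]
  exact Finset.prod_filter_mul_prod_filter_not s (· ∈ I) fun i => μ (t i)

theorem measurable_translate (n : ℤ) : Measurable (translate n) :=
  measurable_pi_lambda _ fun j => measurable_pi_apply (j + n)

theorem continuous_translate (n : ℤ) : Continuous (translate n) :=
  continuous_pi fun j => continuous_apply (j + n)

theorem measurePreserving_translate (n : ℤ) :
    MeasurePreserving (translate n) (iid μ) (iid μ) :=
  ⟨measurable_translate n, Measure.map_infinitePi_infinitePi_of_inj (add_left_injective n)⟩

theorem translate_translate (m n : ℤ) (w : ℤ → ℝ) :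
    translate m (translate n w) = translate (m + n) w := by
  ext j
  simp only [translate]
  congr 1
  ring

theorem translate_splice (I : Set ℤ) (n : ℤ) (w w' : ℤ → ℝ) :
    translate n (splice I w w') = splice ((· + n) ⁻¹' I) (translate n w) (translate n w') := rfl

section Integrals

variable {μ} {𝕜 : Type*} [RCLike 𝕜]

theorem integral_translate {F : (ℤ → ℝ) → 𝕜} (hF : Measurable F) (n : ℤ) :
    ∫ w, F (translate n w) ∂(iid μ) = ∫ w, F w ∂(iid μ) := by
  conv_rhs => rw [← (measurePreserving_translate μ n).map_eq]
  rw [integral_map (measurable_translate n).aemeasurable hF.aestronglyMeasurable]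

theorem integral_splice {F : (ℤ → ℝ) → 𝕜} (hF : Measurable F) (I : Set ℤ) :
    ∫ p, F (splice I p.1 p.2) ∂((iid μ).prod (iid μ)) = ∫ w, F w ∂(iid μ) := by
  conv_rhs => rw [← (measurePreserving_splice μ I).map_eq]
  rw [integral_map (measurable_splice I).aemeasurable hF.aestronglyMeasurable]

/-- Functions of disjoint sets of coordinates are independent. -/
theorem integral_mul_of_dependsOn {F G : (ℤ → ℝ) → 𝕜} (hF : Measurable F) (hG : Measurable G)
    {I : Set ℤ} (hFI : DependsOn F I) (hGI : DependsOn G Iᶜ) :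
    ∫ w, F w * G w ∂(iid μ) = (∫ w, F w ∂(iid μ)) * ∫ w, G w ∂(iid μ) := by
  rw [← integral_splice (F := fun w => F w * G w) (hF.mul hG) I, ← integral_prod_mul]
  refine integral_congr_ae (ae_of_all _ fun p => ?_)
  dsimp only
  rw [hFI fun i hi => splice_of_mem hi p.1 p.2, hGI fun i hi => splice_of_notMem hi p.1 p.2]

theorem covariance_eq_zero_of_dependsOn {F G : (ℤ → ℝ) → ℝ} (hF : BddMeas F) (hG : BddMeas G)
    {I : Set ℤ} (hFI : DependsOn F I) (hGI : DependsOn G Iᶜ) : cov[F, G; iid μ] = 0 := by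
  rw [covariance_eq_sub (hF.memLp _ 2) (hG.memLp _ 2)]
  simp only [Pi.mul_apply]
  rw [integral_mul_of_dependsOn hF.measurable hG.measurable hFI hGI, sub_self]

theorem covariance_translate {F G : (ℤ → ℝ) → ℝ} (hF : BddMeas F) (hG : BddMeas G) (n : ℤ) :
    cov[fun w => F (translate n w), fun w => G (translate n w); iid μ] = cov[F, G; iid μ] := by
  conv_rhs => rw [← (measurePreserving_translate μ n).map_eq]
  rw [covariance_map hF.measurable.aestronglyMeasurable hG.measurable.aestronglyMeasurable
    (measurable_translate n).aemeasurable]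
  rfl

theorem variance_translate {F : (ℤ → ℝ) → ℝ} (hF : BddMeas F) (n : ℤ) :
    Var[fun w => F (translate n w); iid μ] = Var[F; iid μ] := by
  rw [← covariance_self (hF.comp (measurable_translate n)).measurable.aemeasurable,
    ← covariance_self hF.measurable.aemeasurable, covariance_translate hF hF]

end Integrals

/-! ### Conditional expectations as integrals over the past -/

section Past

variable {μ}

/-- The average of `g` over the coordinates with numbers less than `k`. -/
def pastMean (μ : Measure ℝ) [IsProbabilityMeasure μ] (k : ℤ) (g : (ℤ → ℝ) → ℝ) (w : ℤ → ℝ) : ℝ :=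
  ∫ w', g (splice (Set.Ici k) w w') ∂(iid μ)

theorem bddMeas_pastMean {g : (ℤ → ℝ) → ℝ} (hg : BddMeas g) (k : ℤ) :
    BddMeas (pastMean μ k g) := by
  obtain ⟨C, hC⟩ := hg.bdd
  refine ⟨?_, C, fun w => abs_integral_le_of_abs_le fun w' => hC _⟩
  have : StronglyMeasurable fun p : (ℤ → ℝ) × (ℤ → ℝ) => g (splice (Set.Ici k) p.1 p.2) :=
    (hg.measurable.comp (measurable_splice _)).stronglyMeasurable
  exact this.integral_prod_right.measurable

theorem dependsOn_pastMean (g : (ℤ → ℝ) → ℝ) (k : ℤ) :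
    DependsOn (pastMean μ k g) (Set.Ici k) := by
  intro w v h
  unfold pastMean
  congr 1
  ext w'
  congr 1
  ext j
  by_cases hj : j ∈ Set.Ici k
  · rw [splice_of_mem hj, splice_of_mem hj, h j hj]
  · rw [splice_of_notMem hj, splice_of_notMem hj]

/-- Fubini after resampling the coordinates below `k`, which `h` does not see. This identifies
`pastMean` as the conditional expectation given the coordinates `≥ k`. -/
theorem integral_pastMean_mul {g h : (ℤ → ℝ) → ℝ} (hg : BddMeas g) (hh : BddMeas h) {k : ℤ}
    (hhk : DependsOn h (Set.Ici k)) :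
    ∫ w, pastMean μ k g w * h w ∂(iid μ) = ∫ w, g w * h w ∂(iid μ) := by
  rw [← integral_splice (hg.mul hh).measurable (Set.Ici k), integral_prod _
    (((hg.mul hh).comp (measurable_splice _)).integrable _)]
  refine integral_congr_ae (ae_of_all _ fun w => ?_)
  simp only [pastMean]
  rw [← integral_mul_const]
  congr 1
  ext w'
  rw [hhk fun i hi => splice_of_mem hi w w']

theorem integral_pastMean {g : (ℤ → ℝ) → ℝ} (hg : BddMeas g) (k : ℤ) :
    ∫ w, pastMean μ k g w ∂(iid μ) = ∫ w, g w ∂(iid μ) := by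
  simpa using integral_pastMean_mul (μ := μ) hg (BddMeas.const 1) (k := k) (fun _ _ _ => rfl)

theorem pastMean_comp_translate {g : (ℤ → ℝ) → ℝ} (hg : Measurable g) (k n : ℤ) (w : ℤ → ℝ) :
    pastMean μ k (fun w => g (translate n w)) w = pastMean μ (k - n) g (translate n w) := by
  have h : (· + n) ⁻¹' Set.Ici k = Set.Ici (k - n) := by
    ext j
    simp
  simp only [pastMean, translate_splice, h]
  exact integral_translate (F := fun w' => g (splice (Set.Ici (k - n)) (translate n w) w'))
    (hg.comp ((measurable_splice _).comp (measurable_const.prodMk measurable_id))) n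

/-- The splicings at the levels `0` and `1` differ at the site `0` only. -/
theorem abs_pastMean_sub_le {g : (ℤ → ℝ) → ℝ} (hg : BddMeas g) {c : ℝ}
    (h : ∀ w w', (∀ i, i ≠ 0 → w i = w' i) → |g w - g w'| ≤ c) (w : ℤ → ℝ) :
    |pastMean μ 0 g w - pastMean μ 1 g w| ≤ c := by
  have hm : ∀ k, Measurable fun w' => splice (Set.Ici k) w w' := fun k =>
    (measurable_splice _).comp (measurable_const.prodMk measurable_id)
  rw [pastMean, pastMean, ← integral_sub ((hg.comp (hm 0)).integrable _)
    ((hg.comp (hm 1)).integrable _)]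
  refine abs_integral_le_of_abs_le fun w' => h _ _ fun i hi => ?_
  simp only [splice, Set.mem_Ici]
  congr 1
  exact propext ⟨fun _ => by omega, fun _ => by omega⟩

/-- The two averages are nested orthogonal projections, so their difference is again an orthogonal
projection and may be moved to one factor. -/
theorem integral_pastMean_sub_mul {f g : (ℤ → ℝ) → ℝ} (hf : BddMeas f) (hg : BddMeas g) :
    ∫ w, (pastMean μ 0 f w - pastMean μ 1 f w) * (pastMean μ 0 g w - pastMean μ 1 g w) ∂(iid μ) =
      (∫ w, f w * pastMean μ 0 g w ∂(iid μ)) - ∫ w, f w * pastMean μ 1 g w ∂(iid μ) := by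
  have f0 := bddMeas_pastMean (μ := μ) hf 0
  have f1 := bddMeas_pastMean (μ := μ) hf 1
  have g0 := bddMeas_pastMean (μ := μ) hg 0
  have g1 := bddMeas_pastMean (μ := μ) hg 1
  have d0 : ∀ g, DependsOn (pastMean μ 0 g) (Set.Ici 0) := fun g => dependsOn_pastMean g 0
  have d1 : ∀ g, DependsOn (pastMean μ 1 g) (Set.Ici 1) := fun g => dependsOn_pastMean g 1
  have d10 : ∀ g, DependsOn (pastMean μ 1 g) (Set.Ici 0) := fun g =>
    (d1 g).mono (Set.Ici_subset_Ici.2 zero_le_one)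
  have e00 := integral_pastMean_mul (μ := μ) hf g0 (d0 g)
  have e01 := integral_pastMean_mul (μ := μ) hf g1 (d10 g)
  have e11 := integral_pastMean_mul (μ := μ) hf g1 (d1 g)
  have e10 : ∫ w, pastMean μ 1 f w * pastMean μ 0 g w ∂(iid μ) =
      ∫ w, pastMean μ 1 f w * pastMean μ 1 g w ∂(iid μ) := by
    simp_rw [mul_comm (pastMean μ 1 f _)]
    rw [integral_pastMean_mul hg f1 (d10 f), integral_pastMean_mul hg f1 (d1 f)]
  have hexp : ∀ w, (pastMean μ 0 f w - pastMean μ 1 f w) * (pastMean μ 0 g w - pastMean μ 1 g w) =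
      (pastMean μ 0 f w * pastMean μ 0 g w - pastMean μ 0 f w * pastMean μ 1 g w) -
      (pastMean μ 1 f w * pastMean μ 0 g w - pastMean μ 1 f w * pastMean μ 1 g w) := fun w => by ring
  simp_rw [hexp]
  rw [integral_sub (((f0.mul g0).sub (f0.mul g1)).integrable _)
      (((f1.mul g0).sub (f1.mul g1)).integrable _),
    integral_sub ((f0.mul g0).integrable _) ((f0.mul g1).integrable _),
    integral_sub ((f1.mul g0).integrable _) ((f1.mul g1).integrable _), e00, e01, e10]
  ring

end Past

/-! ### Conditional expectations of functions of an i.i.d. sequence -/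

section CondExp

theorem sigmaFrom_eq_comap {Ω : Type*} (V : ℤ → Ω → ℝ) (k : ℤ) :
    sigmaFrom V k = MeasurableSpace.comap (fun ω (j : Set.Ici k) => V j ω) MeasurableSpace.pi := by
  rw [MeasurableSpace.pi, MeasurableSpace.comap_iSup]
  simp_rw [MeasurableSpace.comap_comp]
  rfl

theorem sigmaFrom_anti {Ω : Type*} (V : ℤ → Ω → ℝ) {k l : ℤ} (h : k ≤ l) :
    sigmaFrom V l ≤ sigmaFrom V k :=
  iSup_le fun j => le_iSup (fun j : Set.Ici k => MeasurableSpace.comap (V j) inferInstance)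
    ⟨j, h.trans j.2⟩

theorem map_pot {Ω : Type*} [MeasurableSpace Ω] {P : Measure Ω} {V : ℤ → Ω → ℝ}
    (hV : ∀ j, Measurable (V j)) (hi : iIndepFun V P)
    (hd : ∀ j, IdentDistrib (V j) (V 0) P P) [IsProbabilityMeasure (P.map (V 0))] :
    P.map (pot V) = iid (P.map (V 0)) := by
  have := hi.map_fun_eq_infinitePi_map hV
  simp_rw [fun j => (hd j).map_eq] at this
  exact this

variable {Ω : Type*} [MeasurableSpace Ω] {P : Measure Ω} [IsProbabilityMeasure P] {V : ℤ → Ω → ℝ}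

theorem measurable_pot (hV : ∀ j, Measurable (V j)) : Measurable (pot V) :=
  measurable_pi_lambda _ hV

theorem sigmaFrom_le (hV : ∀ j, Measurable (V j)) (k : ℤ) :
    sigmaFrom V k ≤ ‹MeasurableSpace Ω› :=
  iSup_le fun j => (hV j).comap_le

theorem condExp_sigmaFrom {μ : Measure ℝ} [IsProbabilityMeasure μ] (hV : ∀ j, Measurable (V j))
    (hmap : P.map (pot V) = iid μ) {g : (ℤ → ℝ) → ℝ} (hg : BddMeas g) (k : ℤ) :
    P[fun ω => g (pot V ω) | sigmaFrom V k] =ᵐ[P] fun ω => pastMean μ k g (pot V ω) := by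
  have hpot := measurable_pot hV
  have hgP := hg.comp hpot
  have hΦ := bddMeas_pastMean (μ := μ) hg k
  have hΦP := hΦ.comp hpot
  refine (ae_eq_condExp_of_forall_setIntegral_eq (sigmaFrom_le hV k) (hgP.integrable P)
    (fun s _ _ => (hΦP.integrable P).integrableOn) (fun s hs _ => ?_) ?_).symm
  · rw [sigmaFrom_eq_comap] at hs
    obtain ⟨t, ht, rfl⟩ := hs
    set s' : Set (ℤ → ℝ) := {w | (fun j : Set.Ici k => w j) ∈ t} with hs'
    have hs'm : MeasurableSet s' := (measurable_pi_lambda _ fun j => measurable_pi_apply _) ht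
    have hpre : (fun ω (j : Set.Ici k) => V j ω) ⁻¹' t = pot V ⁻¹' s' := rfl
    have hind : BddMeas (s'.indicator (1 : (ℤ → ℝ) → ℝ)) :=
      ⟨measurable_one.indicator hs'm, 1, fun w => by
        by_cases h : w ∈ s' <;> simp [h]⟩
    have hdep : DependsOn (s'.indicator (1 : (ℤ → ℝ) → ℝ)) (Set.Ici k) := by
      intro w v h
      have : (fun j : Set.Ici k => w j) = fun j : Set.Ici k => v j := funext fun j => h j j.2
      by_cases hw : w ∈ s'
      · have hv : v ∈ s' := by rw [hs', Set.mem_ofPred_eq, ← this]; exact hw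
        simp [hw, hv]
      · have hv : v ∉ s' := by rw [hs', Set.mem_ofPred_eq, ← this]; exact hw
        simp [hw, hv]
    have key : ∀ F : (ℤ → ℝ) → ℝ, BddMeas F → ∫ ω in pot V ⁻¹' s', F (pot V ω) ∂P =
        ∫ w, F w * s'.indicator 1 w ∂(iid μ) := fun F hF => by
      rw [← integral_indicator (hpot hs'm), ← hmap,
        integral_map hpot.aemeasurable (hF.mul hind).measurable.aestronglyMeasurable]
      congr 1
      ext ω
      by_cases h : pot V ω ∈ s' <;> simp [Set.indicator, h]
    rw [hpre, key _ hΦ, key _ hg, integral_pastMean_mul hg hind hdep]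
  · have hmeas : Measurable[sigmaFrom V k] fun ω => pastMean μ k g (pot V ω) := by
      rw [sigmaFrom_eq_comap]
      -- Measurability with respect to the future is a factorization through the coordinates `j ≥
      -- k`; the value `0` put at the others is immaterial.
      have hfac : (fun ω => pastMean μ k g (pot V ω)) = (fun x : Set.Ici k → ℝ =>
          pastMean μ k g (fun j => if h : j ∈ Set.Ici k then x ⟨j, h⟩ else 0)) ∘
          (fun ω (j : Set.Ici k) => V j ω) := by
        ext ω
        refine dependsOn_pastMean g k fun j hj => ?_
        simp only [dif_pos hj]
        rfl
      rw [hfac]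
      refine Measurable.comp (hΦ.measurable.comp (measurable_pi_lambda _ fun j => ?_))
        (comap_measurable _)
      by_cases h : j ∈ Set.Ici k
      · simp only [dif_pos h]
        fun_prop
      · simp only [dif_neg h]
        fun_prop
    exact hmeas.stronglyMeasurable.aestronglyMeasurable

end CondExp


/-! ### Quasi-local functions of an i.i.d. sequence -/

/-- A bounded measurable function of a configuration that depends on the coordinates outside of
`(-m, m)` only up to `β m`, where `∑ β m < ∞`. -/
structure QuasiLocal (f : (ℤ → ℝ) → ℝ) (β : ℕ → ℝ) : Prop where
  bddMeas : BddMeas f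
  summable : Summable β
  abs_sub_le : ∀ (m : ℕ) (w w' : ℤ → ℝ), (∀ i : ℤ, |i| < m → w i = w' i) → |f w - f w'| ≤ β m

/-- The configuration `w` with its value at the site `0` replaced by `0`. -/
def eraseZero (w : ℤ → ℝ) : ℤ → ℝ := Function.update w 0 0

theorem measurable_eraseZero : Measurable eraseZero := by
  refine measurable_pi_lambda _ fun j => ?_
  by_cases h : j = 0
  · simp only [eraseZero, h, Function.update_self]
    fun_prop
  · simp only [eraseZero, Function.update_of_ne h]
    fun_prop

namespace QuasiLocal

variable {f : (ℤ → ℝ) → ℝ} {β : ℕ → ℝ} (hf : QuasiLocal f β)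
include hf

theorem nonneg (m : ℕ) : 0 ≤ β m := (abs_nonneg _).trans (hf.abs_sub_le m 0 0 fun _ _ => rfl)

theorem bddMeas_translate (j : ℤ) : BddMeas fun w => f (translate j w) :=
  hf.bddMeas.comp (measurable_translate j)

theorem abs_sub_translate_le {j : ℤ} {m : ℕ} {w w' : ℤ → ℝ}
    (h : ∀ i : ℤ, |i - j| < m → w i = w' i) :
    |f (translate j w) - f (translate j w')| ≤ β m :=
  hf.abs_sub_le m _ _ fun i hi => h _ (by simpa using hi)

/-- The changed site is at distance `|j|` from the centre `j`. The strict inequality in `QuasiLocal`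
makes the index exactly `|j|`. -/
theorem abs_sub_translate_le_natAbs (j : ℤ) {w w' : ℤ → ℝ} (h : ∀ i, i ≠ 0 → w i = w' i) :
    |f (translate j w) - f (translate j w')| ≤ β j.natAbs :=
  hf.abs_sub_translate_le fun i hi => h i fun h0 => by
    subst h0
    rw [zero_sub, abs_neg, Int.natCast_natAbs] at hi
    exact lt_irrefl _ hi

theorem summable_natAbs : Summable fun j : ℤ => β j.natAbs := by
  refine Summable.of_nat_of_neg ?_ ?_
  · simpa using hf.summable
  · simpa using hf.summable

theorem summable_sub_eraseZero (w : ℤ → ℝ) :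
    Summable fun j : ℤ => f (translate j w) - f (translate j (eraseZero w)) :=
  Summable.of_norm_bounded hf.summable_natAbs fun j => by
    rw [Real.norm_eq_abs]
    exact hf.abs_sub_translate_le_natAbs j fun i hi => by simp [eraseZero, hi]

end QuasiLocal

/-- The total change of `∑ f_j` under the erasure of the coordinate `0`. -/
def totalChange (f : (ℤ → ℝ) → ℝ) (w : ℤ → ℝ) : ℝ :=
  ∑' j : ℤ, (f (translate j w) - f (translate j (eraseZero w)))

namespace QuasiLocal

variable {f : (ℤ → ℝ) → ℝ} {β : ℕ → ℝ} (hf : QuasiLocal f β) {μ : Measure ℝ}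
  [IsProbabilityMeasure μ]
include hf

theorem bddMeas_totalChange : BddMeas (totalChange f) := by
  have hm : ∀ j : ℤ, Measurable fun w => f (translate j w) - f (translate j (eraseZero w)) :=
    fun j => ((hf.bddMeas_translate j).sub
      ((hf.bddMeas_translate j).comp measurable_eraseZero)).measurable
  refine ⟨Measurable.tsum hm, ∑' j : ℤ, β j.natAbs, fun w => ?_⟩
  refine (norm_tsum_le_tsum_norm (hf.summable_sub_eraseZero w).norm).trans ?_
  refine Summable.tsum_le_tsum (fun j => ?_) (hf.summable_sub_eraseZero w).norm hf.summable_natAbs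
  exact hf.abs_sub_translate_le_natAbs j fun i hi => by simp [eraseZero, hi]

theorem abs_pastMean_sub_translate_le (j : ℤ) (w : ℤ → ℝ) :
    |pastMean μ 0 (fun w => f (translate j w)) w - pastMean μ 1 (fun w => f (translate j w)) w| ≤
      β j.natAbs :=
  abs_pastMean_sub_le (hf.bddMeas_translate j)
    (fun _ _ h => hf.abs_sub_translate_le_natAbs j h) w

/-- The subtracted term does not contain the coordinate `0`, so it has the same averages at the
levels `0` and `1`. Thus `totalChange` plays the part of the divergent sum of all translates. -/
theorem pastMean_totalChange_sub (w : ℤ → ℝ) :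
    pastMean μ 0 (totalChange f) w - pastMean μ 1 (totalChange f) w =
      ∑' j : ℤ, (pastMean μ 0 (fun w => f (translate j w)) w -
        pastMean μ 1 (fun w => f (translate j w)) w) := by
  have hm : ∀ k, Measurable fun w' => splice (Set.Ici k) w w' := fun k =>
    (measurable_splice _).comp (measurable_const.prodMk measurable_id)
  set g : ℤ → (ℤ → ℝ) → ℝ := fun j w => f (translate j w) - f (translate j (eraseZero w)) with hg
  have hgb : ∀ j, BddMeas (g j) := fun j => (hf.bddMeas_translate j).sub
    ((hf.bddMeas_translate j).comp measurable_eraseZero)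
  have hgle : ∀ j w, |g j w| ≤ β j.natAbs := fun j w =>
    hf.abs_sub_translate_le_natAbs j fun i hi => by simp [eraseZero, hi]
  have hs : ∀ k, HasSum (fun j => pastMean μ k (g j) w) (pastMean μ k (totalChange f) w) := by
    intro k
    refine hasSum_integral_of_summable_integral_norm (F := fun j w' => g j (splice (Set.Ici k) w w'))
      (fun j => ((hgb j).comp (hm k)).integrable _) ?_
    refine Summable.of_nonneg_of_le (fun j => integral_nonneg fun _ => norm_nonneg _) (fun j => ?_)
      hf.summable_natAbs
    refine (le_abs_self _).trans (abs_integral_le_of_abs_le fun w' => ?_)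
    rw [abs_of_nonneg (norm_nonneg _)]
    exact hgle j _
  have hj : ∀ j, pastMean μ 0 (g j) w - pastMean μ 1 (g j) w =
      pastMean μ 0 (fun w => f (translate j w)) w -
        pastMean μ 1 (fun w => f (translate j w)) w := by
    intro j
    have hk : ∀ k, pastMean μ k (g j) w = pastMean μ k (fun w => f (translate j w)) w -
        pastMean μ k (fun w => f (translate j (eraseZero w))) w := fun k =>
      integral_sub (((hf.bddMeas_translate j).comp (hm k)).integrable _)
        ((((hf.bddMeas_translate j).comp measurable_eraseZero).comp (hm k)).integrable _)
    have h01 : pastMean μ 0 (fun w => f (translate j (eraseZero w))) w =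
        pastMean μ 1 (fun w => f (translate j (eraseZero w))) w := by
      refine integral_congr_ae (ae_of_all _ fun w' => ?_)
      have : eraseZero (splice (Set.Ici 0) w w') = eraseZero (splice (Set.Ici 1) w w') := by
        ext i
        by_cases hi : i = 0
        · simp [eraseZero, hi]
        · simp only [eraseZero, Function.update_of_ne hi, splice, Set.mem_Ici]
          congr 1
          exact propext ⟨fun _ => by omega, fun _ => by omega⟩
      dsimp only
      rw [this]
    rw [hk, hk, h01]
    ring
  rw [← ((hs 0).sub (hs 1)).tsum_eq]
  exact tsum_congr hj

/-- Resampling below `-N` leaves alone everything within distance `N - |n|` of the site `n`. -/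
theorem tendsto_pastMean_atBot (n : ℤ) :
    Tendsto (fun N : ℕ => ∫ w, f w * pastMean μ (-(N : ℤ)) (fun w => f (translate n w)) w ∂(iid μ))
      atTop (𝓝 (∫ w, f w * f (translate n w) ∂(iid μ))) := by
  obtain ⟨K, hK⟩ := hf.bddMeas.bdd
  have hg := hf.bddMeas_translate n
  have hm : ∀ w k, Measurable fun w' => splice (Set.Ici k) w w' := fun w k =>
    (measurable_splice _).comp (measurable_const.prodMk measurable_id)
  have hβ : Tendsto (fun N : ℕ => K * β (N - n.natAbs)) atTop (𝓝 0) := by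
    have := (hf.summable.tendsto_atTop_zero.comp (tendsto_sub_atTop_nat n.natAbs)).const_mul K
    simpa using this
  rw [tendsto_iff_norm_sub_tendsto_zero]
  refine squeeze_zero (fun _ => norm_nonneg _) (fun N => ?_) hβ
  rw [← integral_sub ((hf.bddMeas.mul (bddMeas_pastMean hg _)).integrable _)
    ((hf.bddMeas.mul hg).integrable _), Real.norm_eq_abs]
  refine abs_integral_le_of_abs_le fun w => ?_
  rw [← mul_sub, abs_mul]
  refine mul_le_mul (hK w) ?_ (abs_nonneg _) ((abs_nonneg _).trans (hK w))
  have : f (translate n w) = ∫ _, f (translate n w) ∂(iid μ) := by simp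
  rw [this, pastMean, ← integral_sub ((hg.comp (hm w _)).integrable _) (integrable_const _)]
  refine abs_integral_le_of_abs_le fun w' => hf.abs_sub_translate_le fun i hi => ?_
  refine splice_of_mem ?_ w w'
  rw [Set.mem_Ici]
  grind

/-- At the level `N` all sites within distance `N - |n|` of `n` are resampled, which makes the
second factor independent of the first in the limit. -/
theorem tendsto_pastMean_atTop (n : ℤ) :
    Tendsto (fun N : ℕ => ∫ w, f w * pastMean μ (N : ℤ) (fun w => f (translate n w)) w ∂(iid μ))
      atTop (𝓝 ((∫ w, f w ∂(iid μ)) * ∫ w, f (translate n w) ∂(iid μ))) := by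
  obtain ⟨K, hK⟩ := hf.bddMeas.bdd
  have hg := hf.bddMeas_translate n
  have hm : ∀ w k, Measurable fun w' => splice (Set.Ici k) w w' := fun w k =>
    (measurable_splice _).comp (measurable_const.prodMk measurable_id)
  have hβ : Tendsto (fun N : ℕ => K * β (N - n.natAbs)) atTop (𝓝 0) := by
    have := (hf.summable.tendsto_atTop_zero.comp (tendsto_sub_atTop_nat n.natAbs)).const_mul K
    simpa using this
  rw [tendsto_iff_norm_sub_tendsto_zero]
  refine squeeze_zero (fun _ => norm_nonneg _) (fun N => ?_) hβ
  rw [← integral_mul_const, ← integral_sub ((hf.bddMeas.mul (bddMeas_pastMean hg _)).integrable _)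
    ((hf.bddMeas.integrable _).mul_const _), Real.norm_eq_abs]
  refine abs_integral_le_of_abs_le fun w => ?_
  rw [← mul_sub, abs_mul]
  refine mul_le_mul (hK w) ?_ (abs_nonneg _) ((abs_nonneg _).trans (hK w))
  rw [pastMean, ← integral_sub ((hg.comp (hm w _)).integrable _) (hg.integrable _)]
  refine abs_integral_le_of_abs_le fun w' => hf.abs_sub_translate_le fun i hi => ?_
  refine splice_of_notMem ?_ w w'
  rw [Set.mem_Ici]
  grind

/-- The sum of the covariances of the translates of a quasi-local function is the second moment of
the martingale difference of its total change. -/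
theorem hasSum_covariance :
    HasSum (fun n : ℤ => cov[f, fun w => f (translate n w); iid μ])
      (∫ w, (pastMean μ 0 (totalChange f) w - pastMean μ 1 (totalChange f) w) ^ 2 ∂(iid μ)) := by
  set D : ℤ → (ℤ → ℝ) → ℝ := fun j w => pastMean μ 0 (fun w => f (translate j w)) w -
    pastMean μ 1 (fun w => f (translate j w)) w with hD
  have hDb : ∀ j, BddMeas (D j) := fun j =>
    (bddMeas_pastMean (hf.bddMeas_translate j) 0).sub (bddMeas_pastMean (hf.bddMeas_translate j) 1)
  have hDle : ∀ j w, |D j w| ≤ β j.natAbs := fun j w => hf.abs_pastMean_sub_translate_le j w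
  set q : ℤ × ℤ → ℝ := fun p => ∫ w, D p.1 w * D p.2 w ∂(iid μ) with hq
  have hDs : ∀ w, Summable fun j => D j w := fun w =>
    Summable.of_norm_bounded hf.summable_natAbs fun j => hDle j w
  have hsum2 : Summable fun p : ℤ × ℤ => β p.1.natAbs * β p.2.natAbs :=
    hf.summable_natAbs.mul_of_nonneg hf.summable_natAbs (fun j => hf.nonneg _) fun j => hf.nonneg _
  have hle : ∀ (p : ℤ × ℤ) w, |D p.1 w * D p.2 w| ≤ β p.1.natAbs * β p.2.natAbs := fun p w => by
    rw [abs_mul]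
    exact mul_le_mul (hDle _ w) (hDle _ w) (abs_nonneg _) (hf.nonneg _)
  have htot : HasSum q (∫ w, (pastMean μ 0 (totalChange f) w -
      pastMean μ 1 (totalChange f) w) ^ 2 ∂(iid μ)) := by
    -- The square of the series becomes an absolutely convergent double series with the majorant `β
    -- |i| · β |j|`.
    have h1 : ∀ w, (pastMean μ 0 (totalChange f) w - pastMean μ 1 (totalChange f) w) ^ 2 =
        ∑' p : ℤ × ℤ, D p.1 w * D p.2 w := fun w => by
      rw [hf.pastMean_totalChange_sub w, sq]
      exact tsum_mul_tsum_of_summable_norm (hDs w).norm (hDs w).norm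
    simp_rw [h1]
    refine hasSum_integral_of_summable_integral_norm
      (F := fun (p : ℤ × ℤ) w => D p.1 w * D p.2 w)
      (fun p => ((hDb p.1).mul (hDb p.2)).integrable _) ?_
    refine Summable.of_nonneg_of_le (fun j => integral_nonneg fun _ => norm_nonneg _) (fun p => ?_)
      hsum2
    refine (le_abs_self _).trans (abs_integral_le_of_abs_le fun w' => ?_)
    rw [abs_of_nonneg (norm_nonneg _)]
    exact hle p w'
  -- The pair of sites `(-k, -k + n)` is labelled by its separation `n` and its position `k`, and
  -- the sum over `k` is done first.
  let e : ℤ × ℤ ≃ ℤ × ℤ :=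
    { toFun := fun p => (-p.2, -p.2 + p.1)
      invFun := fun p => (p.2 - p.1, -p.1)
      left_inv := fun p => by ext <;> simp
      right_inv := fun p => by ext <;> simp }
  have hre : HasSum (q ∘ e) _ := e.hasSum_iff.2 htot
  refine hre.prod_fiberwise fun n => ?_
  have hsn : Summable fun k => (q ∘ e) (n, k) := hre.summable.comp_injective
    (Prod.mk_right_injective n)
  set E : ℤ → ℝ := fun k => ∫ w, f w * pastMean μ k (fun w => f (translate n w)) w ∂(iid μ) with hE
  -- Stationarity turns a change of position into a change of the conditioning level, so the sum
  -- along a diagonal telescopes.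
  have hqe : ∀ k, (q ∘ e) (n, k) = E k - E (k + 1) := fun k => by
    have h1 : ∀ l, ∫ w, f (translate (-k) w) *
        pastMean μ l (fun w => f (translate (-k + n) w)) w ∂(iid μ) = E (l + k) := fun l => by
      have h2 : ∀ w, pastMean μ l (fun w => f (translate (-k + n) w)) w =
          pastMean μ (l + k) (fun w => f (translate n w)) (translate (-k) w) := fun w => by
        have h3 := pastMean_comp_translate (μ := μ) (g := fun w => f (translate n w))
          (hf.bddMeas_translate n).measurable l (-k) w
        simp only [translate_translate] at h3
        rw [sub_neg_eq_add] at h3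
        rw [← h3]
        simp_rw [add_comm n (-k)]
      simp_rw [h2]
      exact integral_translate (F := fun w => f w * pastMean μ (l + k) (fun w => f (translate n w)) w)
        (hf.bddMeas.mul (bddMeas_pastMean (hf.bddMeas_translate n) _)).measurable (-k)
    change ∫ w, D (-k) w * D (-k + n) w ∂(iid μ) = _
    rw [hD, integral_pastMean_sub_mul (hf.bddMeas_translate _) (hf.bddMeas_translate _), h1, h1]
    congr 2 <;> ring
  have hpart : Tendsto (fun N : ℕ => ∑ k ∈ Finset.Ico (-(N : ℤ)) N, (q ∘ e) (n, k)) atTop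
      (𝓝 (∑' k, (q ∘ e) (n, k))) :=
    hsn.hasSum.comp Finset.tendsto_Ico_neg
  have htel : ∀ N : ℕ, ∑ k ∈ Finset.Ico (-(N : ℤ)) N, (q ∘ e) (n, k) = E (-(N : ℤ)) - E N := by
    intro N
    simp_rw [hqe]
    have hgen : ∀ m : ℕ, ∑ k ∈ Finset.Ico (-(N : ℤ)) (-(N : ℤ) + m), (E k - E (k + 1)) =
        E (-(N : ℤ)) - E (-(N : ℤ) + m) := by
      intro m
      induction m with
      | zero => simp
      | succ m ih =>
        have : Finset.Ico (-(N : ℤ)) (-(N : ℤ) + (m + 1 : ℕ)) =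
            insert (-(N : ℤ) + m) (Finset.Ico (-(N : ℤ)) (-(N : ℤ) + m)) := by
          ext x
          simp only [Finset.mem_Ico, Finset.mem_insert]
          push_cast
          omega
        rw [this, Finset.sum_insert (by simp), ih]
        push_cast
        rw [← add_assoc]
        ring
    have := hgen (2 * N)
    have h2 : -(N : ℤ) + ((2 * N : ℕ) : ℤ) = N := by push_cast; ring
    rwa [h2] at this
  simp_rw [htel] at hpart
  -- The two ends of the telescope are `E{f f_n}` and `E{f} E{f_n}`, whose difference is the
  -- covariance.
  have hlim := tendsto_nhds_unique hpart
    ((hf.tendsto_pastMean_atBot (μ := μ) n).sub (hf.tendsto_pastMean_atTop (μ := μ) n))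
  rw [covariance_eq_sub (hf.bddMeas.memLp _ 2) ((hf.bddMeas_translate n).memLp _ 2)]
  simp only [Pi.mul_apply]
  rw [← hlim]
  exact hsn.hasSum

end QuasiLocal

/-! ### The asymptotic variance -/

/-- Enlarging the square by one adds a row, a column and a corner, together a symmetric partial sum
of `c`. The normalized double sum is thus a Cesàro mean. -/
theorem sum_range_range_sub_eq (c : ℤ → ℝ) (n : ℕ) :
    ∑ i ∈ Finset.range n, ∑ j ∈ Finset.range n, c ((j : ℤ) - i) =
      ∑ k ∈ Finset.range n, ∑ l ∈ Finset.Icc (-(k : ℤ)) k, c l := by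
  induction n with
  | zero => simp
  | succ n ih =>
    rw [Finset.sum_range_succ (fun k : ℕ => ∑ l ∈ Finset.Icc (-(k : ℤ)) k, c l), ← ih]
    simp_rw [Finset.sum_range_succ _ n, Finset.sum_add_distrib]
    have h : ∀ m : ℕ, ∑ l ∈ Finset.Icc (-(m : ℤ)) m, c l =
        ∑ i ∈ Finset.range m, c ((m : ℤ) - i) + (∑ i ∈ Finset.range m, c ((i : ℤ) - m) + c 0) := by
      intro m
      induction m with
      | zero => simp
      | succ m ihm =>
        have hI : Finset.Icc (-((m + 1 : ℕ) : ℤ)) (m + 1 : ℕ) =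
            insert (-((m : ℤ) + 1)) (insert ((m : ℤ) + 1) (Finset.Icc (-(m : ℤ)) m)) := by
          ext x
          simp only [Finset.mem_Icc, Finset.mem_insert]
          push_cast
          omega
        rw [hI, Finset.sum_insert (by simp; omega), Finset.sum_insert (by simp), ihm,
          Finset.sum_range_succ' _ m, Finset.sum_range_succ' _ m]
        push_cast
        simp only [add_sub_add_right_eq_sub, sub_zero, zero_sub]
        ring
    rw [h n]
    simp only [sub_self]
    ring

theorem tendsto_double_sum_div {c : ℤ → ℝ} {s : ℝ} (hc : HasSum c s) :
    Tendsto (fun n : ℕ => (n : ℝ)⁻¹ *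
      ∑ i ∈ Finset.range n, ∑ j ∈ Finset.range n, c ((j : ℤ) - i)) atTop (𝓝 s) := by
  simp_rw [sum_range_range_sub_eq]
  exact Filter.Tendsto.cesaro (hc.comp Finset.tendsto_Icc_neg)

/-- The sum of the first `n` translates of `f`. -/
def birkhoff (f : (ℤ → ℝ) → ℝ) (n : ℕ) (w : ℤ → ℝ) : ℝ :=
  ∑ j ∈ Finset.range n, f (translate j w)

namespace QuasiLocal

variable {f : (ℤ → ℝ) → ℝ} {β : ℕ → ℝ} (hf : QuasiLocal f β) {μ : Measure ℝ}
  [IsProbabilityMeasure μ]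
include hf

theorem bddMeas_birkhoff (n : ℕ) : BddMeas (birkhoff f n) :=
  BddMeas.sum _ fun j _ => hf.bddMeas_translate j

theorem covariance_translate_translate (i j : ℤ) :
    cov[fun w => f (translate i w), fun w => f (translate j w); iid μ] =
      cov[f, fun w => f (translate (j - i) w); iid μ] := by
  rw [← covariance_translate hf.bddMeas (hf.bddMeas_translate (j - i)) i]
  simp_rw [translate_translate, sub_add_cancel]

theorem variance_birkhoff (n : ℕ) : Var[birkhoff f n; iid μ] =
    ∑ i ∈ Finset.range n, ∑ j ∈ Finset.range n,
      cov[f, fun w => f (translate ((j : ℤ) - i) w); iid μ] := by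
  rw [← covariance_self (hf.bddMeas_birkhoff n).measurable.aemeasurable]
  unfold birkhoff
  rw [covariance_fun_sum_fun_sum' (X := fun (i : ℕ) w => f (translate i w))
    (Y := fun (i : ℕ) w => f (translate i w)) (fun i _ => (hf.bddMeas_translate i).memLp _ 2)
    (fun i _ => (hf.bddMeas_translate i).memLp _ 2)]
  simp_rw [hf.covariance_translate_translate]

theorem tendsto_variance_birkhoff {s : ℝ}
    (hs : HasSum (fun n : ℤ => cov[f, fun w => f (translate n w); iid μ]) s) :
    Tendsto (fun n : ℕ => (n : ℝ)⁻¹ * Var[birkhoff f n; iid μ]) atTop (𝓝 s) := by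
  refine (tendsto_double_sum_div hs).congr fun n => ?_
  rw [hf.variance_birkhoff]

end QuasiLocal


/-! ### Blocks -/

/-- The sum of the first `L` translates of `f`, with the coordinates outside of `[0, L)` erased. -/
def blockSum (f : (ℤ → ℝ) → ℝ) (L : ℕ) (w : ℤ → ℝ) : ℝ :=
  birkhoff f L (splice (Set.Ico 0 (L : ℤ)) w 0)

theorem dependsOn_blockSum (f : (ℤ → ℝ) → ℝ) (L : ℕ) :
    DependsOn (blockSum f L) (Set.Ico 0 (L : ℤ)) := by
  intro w v h
  unfold blockSum
  congr 1
  ext j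
  by_cases hj : j ∈ Set.Ico 0 (L : ℤ)
  · rw [splice_of_mem hj, splice_of_mem hj, h j hj]
  · rw [splice_of_notMem hj, splice_of_notMem hj]

theorem dependsOn_comp_translate {Y : Type*} {F : (ℤ → ℝ) → Y} {a b : ℤ}
    (hF : DependsOn F (Set.Ico a b)) (n : ℤ) :
    DependsOn (fun w => F (translate n w)) (Set.Ico (a + n) (b + n)) := fun w v h =>
  hF fun i hi => h (i + n) ⟨by linarith [hi.1], by linarith [hi.2]⟩

theorem sum_range_le_tsum_succ {β : ℕ → ℝ} (h0 : ∀ m, 0 ≤ β m) (hs : Summable β) (n : ℕ) :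
    ∑ k ∈ Finset.range n, β (k + 1) ≤ ∑' m, β m := by
  have h := hs.sum_le_tsum (Finset.range (n + 1)) fun m _ => h0 m
  rw [Finset.sum_range_succ'] at h
  linarith [h0 0]

theorem sum_range_sub_le_tsum {β : ℕ → ℝ} (h0 : ∀ m, 0 ≤ β m) (hs : Summable β) (n : ℕ) :
    ∑ k ∈ Finset.range n, β (n - k) ≤ ∑' m, β m := by
  refine le_trans (le_of_eq ?_) (sum_range_le_tsum_succ h0 hs n)
  rw [← Finset.sum_range_reflect]
  refine Finset.sum_congr rfl fun k hk => ?_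
  have := Finset.mem_range.1 hk
  congr 1
  omega

namespace QuasiLocal

variable {f : (ℤ → ℝ) → ℝ} {β : ℕ → ℝ} (hf : QuasiLocal f β) {μ : Measure ℝ}
  [IsProbabilityMeasure μ]
include hf

theorem bddMeas_blockSum (L : ℕ) : BddMeas (blockSum f L) :=
  (hf.bddMeas_birkhoff L).comp (measurable_splice_left _ _)

theorem tsum_nonneg : 0 ≤ ∑' m, β m := _root_.tsum_nonneg hf.nonneg

/-- The translate at `j` feels the erasure through its distance to the nearer end of the block, and
each end costs at most `∑ β`. The bound does not grow with `L`. -/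
theorem abs_birkhoff_sub_blockSum_le (L : ℕ) (w : ℤ → ℝ) :
    |birkhoff f L w - blockSum f L w| ≤ 2 * ∑' m, β m := by
  have hle : ∀ j ∈ Finset.range L, |f (translate j w) -
      f (translate j (splice (Set.Ico 0 (L : ℤ)) w 0))| ≤ β (j + 1) + β (L - j) := by
    intro j hj
    have hj' := Finset.mem_range.1 hj
    have h1 : |f (translate j w) - f (translate j (splice (Set.Ico 0 (L : ℤ)) w 0))| ≤
        β (min (j + 1) (L - j)) := by
      refine hf.abs_sub_translate_le fun i hi => (splice_of_mem ?_ _ _).symm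
      rw [Set.mem_Ico]
      rw [abs_lt] at hi
      omega
    refine h1.trans ?_
    rcases min_choice (j + 1) (L - j) with h | h <;> rw [h]
    · linarith [hf.nonneg (L - j)]
    · linarith [hf.nonneg (j + 1)]
  unfold blockSum birkhoff
  rw [← Finset.sum_sub_distrib]
  refine (Finset.abs_sum_le_sum_abs _ _).trans ((Finset.sum_le_sum hle).trans ?_)
  rw [Finset.sum_add_distrib]
  linarith [sum_range_le_tsum_succ hf.nonneg hf.summable L,
    sum_range_sub_le_tsum hf.nonneg hf.summable L]

/-- Erase the potential outside the window of radius `m` around `j`: the truncated function is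
independent of `G`, and the rest is at most `β m`. -/
theorem abs_covariance_translate_le {G : (ℤ → ℝ) → ℝ} (hG : BddMeas G) {J : Set ℤ}
    (hGJ : DependsOn G J) {j : ℤ} {m : ℕ} (hj : ∀ i ∈ J, (m : ℤ) ≤ |i - j|) :
    |cov[fun w => f (translate j w), G; iid μ]| ≤ β m * √Var[G; iid μ] := by
  set I : Set ℤ := {i | |i - j| < m} with hI
  set g : (ℤ → ℝ) → ℝ := fun w => f (translate j (splice I w 0)) with hg
  have hgb : BddMeas g := (hf.bddMeas_translate j).comp (measurable_splice_left _ _)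
  have hgI : DependsOn g I := by
    intro w v h
    simp only [hg]
    congr 2
    ext i
    by_cases hi : i ∈ I
    · rw [splice_of_mem hi, splice_of_mem hi, h i hi]
    · rw [splice_of_notMem hi, splice_of_notMem hi]
  have hGI : DependsOn G Iᶜ := hGJ.mono fun i hi => by
    simp only [hI, Set.mem_compl_iff, Set.mem_ofPred_eq, not_lt]
    exact hj i hi
  have h1 : cov[fun w => f (translate j w), G; iid μ] =
      cov[fun w => f (translate j w) - g w, G; iid μ] := by
    rw [covariance_fun_sub_left ((hf.bddMeas_translate j).memLp _ 2) (hgb.memLp _ 2)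
      (hG.memLp _ 2)]
    have := covariance_eq_zero_of_dependsOn (μ := μ) hgb hG hgI hGI
    linarith
  rw [h1]
  refine abs_covariance_le_of_abs_le ((hf.bddMeas_translate j).sub hgb) hG fun w => ?_
  exact hf.abs_sub_translate_le fun i hi => (splice_of_mem (by exact hi) _ _).symm

theorem covariance_birkhoff_blockSum_ge (L : ℕ) :
    Var[blockSum f L; iid μ] - 2 * (∑' m, β m) * √Var[blockSum f L; iid μ] ≤
      cov[birkhoff f L, blockSum f L; iid μ] := by
  have hb := hf.bddMeas_blockSum L
  have hS := hf.bddMeas_birkhoff L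
  have h1 := abs_covariance_le_of_abs_le (P := iid μ) (hS.sub hb) hb
    (hf.abs_birkhoff_sub_blockSum_le L)
  rw [covariance_fun_sub_left (hS.memLp _ 2) (hb.memLp _ 2) (hb.memLp _ 2)] at h1
  have h2 := covariance_self (μ := iid μ) hb.measurable.aemeasurable
  have h3 := (abs_le.1 h1).1
  change _ ≤ cov[birkhoff f L, blockSum f L; iid μ] - cov[blockSum f L, blockSum f L; iid μ] at h3
  rw [h2] at h3
  linarith

/-- The sum splits into the parts before, inside and after the block. Each outer part costs `∑ β`
times the standard deviation, the inner one twice as much, hence the constant `4`. -/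
theorem covariance_birkhoff_translate_blockSum_ge (L a c : ℕ) :
    Var[blockSum f L; iid μ] - 4 * (∑' m, β m) * √Var[blockSum f L; iid μ] ≤
      cov[birkhoff f (a + L + c), fun w => blockSum f L (translate a w); iid μ] := by
  have hb := hf.bddMeas_blockSum L
  set G : (ℤ → ℝ) → ℝ := fun w => blockSum f L (translate a w) with hG
  have hGb : BddMeas G := hb.comp (measurable_translate _)
  have hGd : DependsOn G (Set.Ico (a : ℤ) (L + a)) := by
    simpa using dependsOn_comp_translate (dependsOn_blockSum f L) a
  have hGv : Var[G; iid μ] = Var[blockSum f L; iid μ] := variance_translate hb a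
  have hsplit : birkhoff f (a + L + c) = fun w => (∑ j ∈ Finset.range a, f (translate j w) +
      birkhoff f L (translate a w)) + ∑ k ∈ Finset.range c, f (translate (a + L + k : ℤ) w) := by
    ext w
    unfold birkhoff
    rw [Finset.sum_range_add, Finset.sum_range_add]
    congr 2
    · refine Finset.sum_congr rfl fun k _ => ?_
      rw [translate_translate]
      push_cast
      rw [add_comm (a : ℤ)]
  have h1b : BddMeas fun w => ∑ j ∈ Finset.range a, f (translate j w) :=
    BddMeas.sum _ fun j _ => hf.bddMeas_translate j
  have h2b : BddMeas fun w => birkhoff f L (translate a w) :=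
    (hf.bddMeas_birkhoff L).comp (measurable_translate _)
  have h3b : BddMeas fun w => ∑ k ∈ Finset.range c, f (translate (a + L + k : ℤ) w) :=
    BddMeas.sum _ fun k _ => hf.bddMeas_translate _
  have e1 : cov[fun w => (∑ j ∈ Finset.range a, f (translate j w) +
      birkhoff f L (translate a w)) + ∑ k ∈ Finset.range c, f (translate (a + L + k : ℤ) w), G; iid μ]
      = cov[fun w => ∑ j ∈ Finset.range a, f (translate j w), G; iid μ] +
        cov[fun w => birkhoff f L (translate a w), G; iid μ] +
        cov[fun w => ∑ k ∈ Finset.range c, f (translate (a + L + k : ℤ) w), G; iid μ] := by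
    refine (covariance_add_left ((h1b.add h2b).memLp _ 2) (h3b.memLp _ 2) (hGb.memLp _ 2)).trans ?_
    congr 1
    exact covariance_add_left (h1b.memLp _ 2) (h2b.memLp _ 2) (hGb.memLp _ 2)
  rw [hsplit, e1]
  have c1 : |cov[fun w => ∑ j ∈ Finset.range a, f (translate j w), G; iid μ]| ≤
      (∑' m, β m) * √Var[G; iid μ] := by
    rw [covariance_fun_sum_left' (X := fun (j : ℕ) w => f (translate j w))
      (fun j _ => (hf.bddMeas_translate j).memLp _ 2) (hGb.memLp _ 2)]
    refine (Finset.abs_sum_le_sum_abs _ _).trans ?_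
    refine (Finset.sum_le_sum (g := fun j => β (a - j) * √Var[G; iid μ]) fun j hj => ?_).trans ?_
    · have := Finset.mem_range.1 hj
      refine hf.abs_covariance_translate_le hGb hGd fun i hi => ?_
      have h3 := hi.1
      refine le_trans ?_ (le_abs_self _)
      omega
    · rw [← Finset.sum_mul]
      exact mul_le_mul_of_nonneg_right (sum_range_sub_le_tsum hf.nonneg hf.summable a)
        (Real.sqrt_nonneg _)
  have c3 : |cov[fun w => ∑ k ∈ Finset.range c, f (translate (a + L + k : ℤ) w), G; iid μ]| ≤
      (∑' m, β m) * √Var[G; iid μ] := by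
    rw [covariance_fun_sum_left' (X := fun (k : ℕ) w => f (translate (a + L + k : ℤ) w))
      (fun j _ => (hf.bddMeas_translate _).memLp _ 2) (hGb.memLp _ 2)]
    refine (Finset.abs_sum_le_sum_abs _ _).trans ?_
    refine (Finset.sum_le_sum (g := fun k => β (k + 1) * √Var[G; iid μ]) fun k hk => ?_).trans ?_
    · refine hf.abs_covariance_translate_le hGb hGd fun i hi => ?_
      have h3 := hi.2
      refine le_trans ?_ (neg_le_abs _)
      push_cast
      linarith
    · rw [← Finset.sum_mul]
      exact mul_le_mul_of_nonneg_right (sum_range_le_tsum_succ hf.nonneg hf.summable c)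
        (Real.sqrt_nonneg _)
  have c2 : cov[fun w => birkhoff f L (translate a w), G; iid μ] =
      cov[birkhoff f L, blockSum f L; iid μ] := covariance_translate (hf.bddMeas_birkhoff L) hb a
  rw [hGv] at c1 c3
  have c2' := hf.covariance_birkhoff_blockSum_ge (μ := μ) L
  rw [← c2] at c2'
  linarith [(abs_le.1 c1).1, (abs_le.1 c3).1]

theorem covariance_blockSum_blockSum_eq_zero {L i j : ℕ} (h : i < j) :
    cov[fun w => blockSum f L (translate (i * L : ℕ) w),
      fun w => blockSum f L (translate (j * L : ℕ) w); iid μ] = 0 := by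
  have hb := hf.bddMeas_blockSum L
  have h1 := dependsOn_comp_translate (dependsOn_blockSum f L) (i * L : ℕ)
  have h2 := dependsOn_comp_translate (dependsOn_blockSum f L) (j * L : ℕ)
  refine covariance_eq_zero_of_dependsOn (hb.comp (measurable_translate _))
    (hb.comp (measurable_translate _)) h1 (h2.mono fun k hk hk' => ?_)
  have h3 : (i + 1) * L ≤ j * L := Nat.mul_le_mul_right L h
  have h4 := hk.1
  have h5 := hk'.2
  rw [add_mul, one_mul] at h3
  omega

/-- Expand the square. The blocks are uncorrelated, so their sum has variance `K Var b`, and its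
covariance with the full sum is almost at least as large; the defect `4` is doubled to `8`. Since
only a defect of order `√Var b` per block appears, no gaps between the blocks are needed. -/
theorem variance_birkhoff_sub_blocks_le (L K : ℕ) :
    Var[fun w => birkhoff f (K * L) w -
        ∑ i ∈ Finset.range K, blockSum f L (translate (i * L : ℕ) w); iid μ] ≤
      Var[birkhoff f (K * L); iid μ] - K * Var[blockSum f L; iid μ] +
        K * (8 * (∑' m, β m) * √Var[blockSum f L; iid μ]) := by
  have hb := hf.bddMeas_blockSum L
  have hS := hf.bddMeas_birkhoff (K * L)
  set b : ℕ → (ℤ → ℝ) → ℝ := fun i w => blockSum f L (translate (i * L : ℕ) w) with hbdef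
  have hbi : ∀ i, BddMeas (b i) := fun i => hb.comp (measurable_translate _)
  have hBs : BddMeas fun w => ∑ i ∈ Finset.range K, b i w := BddMeas.sum _ fun i _ => hbi i
  have hdiff : BddMeas fun w => birkhoff f (K * L) w - ∑ i ∈ Finset.range K, b i w := hS.sub hBs
  have hij : ∀ i j, cov[b i, b j; iid μ] = if i = j then Var[blockSum f L; iid μ] else 0 := by
    intro i j
    split_ifs with h
    · subst h
      rw [covariance_self (hbi i).measurable.aemeasurable]
      exact variance_translate hb _
    · rcases lt_or_gt_of_ne h with h | h
      · exact hf.covariance_blockSum_blockSum_eq_zero h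
      · rw [covariance_comm]
        exact hf.covariance_blockSum_blockSum_eq_zero h
  have hBB : cov[fun w => ∑ i ∈ Finset.range K, b i w, fun w => ∑ i ∈ Finset.range K, b i w; iid μ] =
      K * Var[blockSum f L; iid μ] := by
    rw [covariance_fun_sum_fun_sum' (fun i _ => (hbi i).memLp _ 2) (fun i _ => (hbi i).memLp _ 2)]
    simp_rw [hij]
    rw [Finset.sum_congr rfl fun i hi => Finset.sum_ite_eq (Finset.range K) i _]
    rw [Finset.sum_congr rfl fun i hi => if_pos hi]
    simp
  have hSB : K * (Var[blockSum f L; iid μ] - 4 * (∑' m, β m) * √Var[blockSum f L; iid μ]) ≤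
      cov[birkhoff f (K * L), fun w => ∑ i ∈ Finset.range K, b i w; iid μ] := by
    rw [covariance_fun_sum_right' (fun i _ => (hbi i).memLp _ 2) (hS.memLp _ 2)]
    rw [← nsmul_eq_mul, ← Finset.card_range K, Finset.card_range K]
    rw [show K • (Var[blockSum f L; iid μ] - 4 * (∑' m, β m) * √Var[blockSum f L; iid μ]) =
      (Finset.range K).card • (Var[blockSum f L; iid μ] -
        4 * (∑' m, β m) * √Var[blockSum f L; iid μ]) by rw [Finset.card_range]]
    refine Finset.card_nsmul_le_sum _ _ _ fun i hi => ?_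
    have hi' := Finset.mem_range.1 hi
    obtain ⟨c, hc⟩ := Nat.exists_eq_add_of_le (Nat.mul_le_mul_right L (Nat.succ_le_of_lt hi'))
    rw [Nat.succ_mul] at hc
    rw [hc]
    exact hf.covariance_birkhoff_translate_blockSum_ge L (i * L) c
  rw [← covariance_self hdiff.measurable.aemeasurable,
    covariance_fun_sub_fun_sub (hS.memLp _ 2) (hBs.memLp _ 2) (hS.memLp _ 2) (hBs.memLp _ 2),
    hBB, covariance_comm (fun w => ∑ i ∈ Finset.range K, b i w),
    covariance_self hS.measurable.aemeasurable]
  linarith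

theorem abs_variance_blockSum_sub_le (L : ℕ) :
    |Var[blockSum f L; iid μ] - Var[birkhoff f L; iid μ]| ≤
      4 * (∑' m, β m) * √Var[birkhoff f L; iid μ] + (2 * ∑' m, β m) ^ 2 := by
  have hb := hf.bddMeas_blockSum L
  have hS := hf.bddMeas_birkhoff L
  have hd := hS.sub hb
  have hle := hf.abs_birkhoff_sub_blockSum_le L
  have h1 := abs_covariance_le_of_abs_le (P := iid μ) hd hS hle
  have h2 : Var[fun w => birkhoff f L w - blockSum f L w; iid μ] ≤ (2 * ∑' m, β m) ^ 2 := by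
    refine (variance_le_expectation_sq hd.measurable.aestronglyMeasurable).trans ?_
    refine (le_abs_self _).trans (abs_integral_le_of_abs_le fun w => ?_)
    rw [Pi.pow_apply, abs_of_nonneg (sq_nonneg _), sq_le_sq]
    exact (hle w).trans (le_abs_self _)
  have h3 : blockSum f L = fun w => birkhoff f L w - (birkhoff f L w - blockSum f L w) := by
    ext w; ring
  have h4 : Var[blockSum f L; iid μ] = Var[birkhoff f L; iid μ] -
      2 * cov[fun w => birkhoff f L w - blockSum f L w, birkhoff f L; iid μ] +
      Var[fun w => birkhoff f L w - blockSum f L w; iid μ] := by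
    rw [← covariance_self hb.measurable.aemeasurable]
    conv_lhs => rw [h3]
    rw [covariance_fun_sub_fun_sub (hS.memLp _ 2) (hd.memLp _ 2) (hS.memLp _ 2) (hd.memLp _ 2),
      covariance_self hS.measurable.aemeasurable, covariance_self hd.measurable.aemeasurable,
      covariance_comm (birkhoff f L)]
    ring
  have h5 := variance_nonneg (fun w => birkhoff f L w - blockSum f L w) (iid μ)
  have h6 := abs_le.1 h1
  have h7 : 0 ≤ (∑' m, β m) * √Var[birkhoff f L; iid μ] :=
    mul_nonneg hf.tsum_nonneg (Real.sqrt_nonneg _)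
  rw [h4, abs_le]
  constructor <;> nlinarith

/-- Erasing changes the variance by `O(√L)`, which is negligible after division by `L`. -/
theorem tendsto_variance_blockSum {s : ℝ}
    (hs : HasSum (fun n : ℤ => cov[f, fun w => f (translate n w); iid μ]) s) :
    Tendsto (fun L : ℕ => (L : ℝ)⁻¹ * Var[blockSum f L; iid μ]) atTop (𝓝 s) := by
  have h1 := hf.tendsto_variance_birkhoff hs
  have hinv : Tendsto (fun L : ℕ => (L : ℝ)⁻¹) atTop (𝓝 0) := tendsto_inv_atTop_nhds_zero_nat
  have hsq : Tendsto (fun L : ℕ => √((L : ℝ)⁻¹)) atTop (𝓝 0) := by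
    have := (Real.continuous_sqrt.tendsto 0).comp hinv
    rwa [Real.sqrt_zero] at this
  have hsv : Tendsto (fun L : ℕ => √((L : ℝ)⁻¹ * Var[birkhoff f L; iid μ])) atTop (𝓝 √s) :=
    (Real.continuous_sqrt.tendsto s).comp h1
  have hbd : Tendsto (fun L : ℕ => 4 * (∑' m, β m) * (√((L : ℝ)⁻¹) *
      √((L : ℝ)⁻¹ * Var[birkhoff f L; iid μ])) + (L : ℝ)⁻¹ * (2 * ∑' m, β m) ^ 2) atTop (𝓝 0) := by
    have := ((hsq.mul hsv).const_mul (4 * ∑' m, β m)).add (hinv.mul_const ((2 * ∑' m, β m) ^ 2))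
    simpa using this
  have h2 : Tendsto (fun L : ℕ => (L : ℝ)⁻¹ * Var[blockSum f L; iid μ] -
      (L : ℝ)⁻¹ * Var[birkhoff f L; iid μ]) atTop (𝓝 0) := by
    refine squeeze_zero_norm (fun L => ?_) hbd
    rw [← mul_sub, norm_mul, Real.norm_of_nonneg (by positivity), Real.norm_eq_abs]
    have hL : (0 : ℝ) ≤ (L : ℝ)⁻¹ := by positivity
    refine (mul_le_mul_of_nonneg_left (hf.abs_variance_blockSum_sub_le (μ := μ) L) hL).trans
      (le_of_eq ?_)
    rw [Real.sqrt_mul hL, ← mul_assoc √((L : ℝ)⁻¹), Real.mul_self_sqrt hL]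
    ring
  simpa using h2.add h1

end QuasiLocal


/-! ### Characteristic functions -/

theorem norm_exp_ofReal_mul_I_sub_le (x y : ℝ) :
    ‖Complex.exp (x * Complex.I) - Complex.exp (y * Complex.I)‖ ≤ |x - y| := by
  have h : Complex.exp (x * Complex.I) - Complex.exp (y * Complex.I) =
      Complex.exp (y * Complex.I) * (Complex.exp (Complex.I * ((x - y : ℝ) : ℂ)) - 1) := by
    rw [mul_sub, ← Complex.exp_add, mul_one]
    congr 2
    push_cast
    ring
  rw [h, norm_mul, Complex.norm_exp_ofReal_mul_I, one_mul]
  exact Real.norm_exp_I_mul_ofReal_sub_one_le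

section

variable {X : Type*} [MeasurableSpace X] {P : Measure X} [IsProbabilityMeasure P]

theorem integrable_exp_mul_I {F : X → ℝ} (hF : Measurable F) :
    Integrable (fun x => Complex.exp (F x * Complex.I)) P := by
  refine Integrable.of_bound (C := 1) ?_ (ae_of_all _ fun x => ?_)
  · have : Measurable fun x => Complex.exp (F x * Complex.I) := by fun_prop
    exact this.aestronglyMeasurable
  · rw [Complex.norm_exp_ofReal_mul_I]

theorem norm_integral_exp_sub_le {F G : X → ℝ} (hF : BddMeas F) (hG : BddMeas G) :
    ‖(∫ x, Complex.exp (F x * Complex.I) ∂P) - ∫ x, Complex.exp (G x * Complex.I) ∂P‖ ≤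
      ∫ x, |F x - G x| ∂P := by
  rw [← integral_sub (integrable_exp_mul_I hF.measurable) (integrable_exp_mul_I hG.measurable)]
  refine (norm_integral_le_integral_norm _).trans ?_
  refine integral_mono_of_nonneg (ae_of_all _ fun x => norm_nonneg _)
    ((hF.sub hG).integrable P).abs (ae_of_all _ fun x => norm_exp_ofReal_mul_I_sub_le _ _)

end

theorem integral_exp_sum_blocks {μ : Measure ℝ} [IsProbabilityMeasure μ] {G : (ℤ → ℝ) → ℝ}
    (hG : Measurable G) {L : ℕ} (hGL : DependsOn G (Set.Ico 0 (L : ℤ))) (K : ℕ) :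
    ∫ w, Complex.exp ((∑ i ∈ Finset.range K, G (translate (i * L : ℕ) w) : ℝ) * Complex.I) ∂(iid μ) =
      (∫ w, Complex.exp (G w * Complex.I) ∂(iid μ)) ^ K := by
  induction K with
  | zero => simp
  | succ K ih =>
    have hm : ∀ n : ℤ, Measurable fun w => G (translate n w) := fun n =>
      hG.comp (measurable_translate n)
    have h1 : ∀ w, Complex.exp ((∑ i ∈ Finset.range (K + 1), G (translate (i * L : ℕ) w) : ℝ) *
        Complex.I) = Complex.exp ((∑ i ∈ Finset.range K, G (translate (i * L : ℕ) w) : ℝ) *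
        Complex.I) * Complex.exp (G (translate (K * L : ℕ) w) * Complex.I) := fun w => by
      rw [Finset.sum_range_succ, ← Complex.exp_add]
      congr 1
      push_cast
      ring
    simp_rw [h1]
    rw [integral_mul_of_dependsOn (I := Set.Iio ((K * L : ℕ) : ℤ)), ih, pow_succ]
    · congr 1
      exact integral_translate (F := fun w => Complex.exp (G w * Complex.I)) (by fun_prop) _
    · have : Measurable fun w => ∑ i ∈ Finset.range K, G (translate (i * L : ℕ) w) :=
        Finset.measurable_fun_sum _ fun i _ => hm _
      fun_prop
    · exact Complex.measurable_exp.comp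
        ((Complex.measurable_ofReal.comp (hm (K * L : ℕ))).mul_const _)
    · intro w v h
      dsimp only
      congr 3
      refine Finset.sum_congr rfl fun i hi => ?_
      refine dependsOn_comp_translate hGL (i * L : ℕ) fun j hj => h j ?_
      have h2 := hj.2
      have h3 : (i + 1) * L ≤ K * L := Nat.mul_le_mul_right L (Finset.mem_range.1 hi)
      rw [add_mul, one_mul] at h3
      rw [Set.mem_Iio]
      omega
    · intro w v h
      dsimp only
      congr 3
      refine dependsOn_comp_translate hGL (K * L : ℕ) fun j hj => h j ?_
      have h2 := hj.1
      simp only [Set.mem_compl_iff, Set.mem_Iio, not_lt]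
      omega

/-- The classical central limit theorem for `K` independent blocks of a fixed length, applied to the
standardized block sum. -/
theorem tendsto_integral_exp_pow {μ : Measure ℝ} [IsProbabilityMeasure μ] {G : (ℤ → ℝ) → ℝ}
    (hG : BddMeas G) (hv : 0 < Var[G; iid μ]) (t : ℝ) :
    Tendsto (fun K : ℕ => (∫ w, Complex.exp ((t * (√K)⁻¹ * (G w - ∫ w', G w' ∂(iid μ)) : ℝ) *
      Complex.I) ∂(iid μ)) ^ K) atTop
      (𝓝 (Complex.exp (-(t ^ 2 * Var[G; iid μ] / 2 : ℝ)))) := by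
  set v := Var[G; iid μ] with hvdef
  set m := ∫ w', G w' ∂(iid μ) with hm
  have hsv : 0 < √v := Real.sqrt_pos.2 hv
  set Z : (ℤ → ℝ) → ℝ := fun w => (√v)⁻¹ * (G w - m) with hZ
  have hZb : BddMeas Z := (BddMeas.const _).mul (hG.sub (BddMeas.const _))
  have h0 : (iid μ)[Z] = 0 := by
    rw [hZ, integral_const_mul, integral_sub (hG.integrable _) (integrable_const _)]
    simp [hm]
  have h1 : (iid μ)[Z ^ 2] = 1 := by
    have : ∀ w, (Z ^ 2) w = v⁻¹ * (G w - m) ^ 2 := fun w => by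
      simp only [Pi.pow_apply, hZ]
      rw [mul_pow, inv_pow, Real.sq_sqrt hv.le]
    simp_rw [this]
    rw [integral_const_mul, hm, ← variance_eq_integral hG.measurable.aemeasurable, ← hvdef,
      inv_mul_cancel₀ hv.ne']
  have h2 := tendsto_charFun_inv_sqrt_mul_pow hZb.measurable.aemeasurable h0 h1 (t * √v)
  have h3 : ((-(t ^ 2 * v / 2 : ℝ) : ℝ) : ℂ) = (-((t * √v : ℝ) : ℂ) ^ 2 / 2) := by
    rw [← Complex.ofReal_pow, mul_pow, Real.sq_sqrt hv.le]
    push_cast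
    ring
  rw [← Complex.ofReal_neg, h3]
  refine h2.congr fun K => ?_
  rw [charFun_apply_real, integral_map hZb.measurable.aemeasurable]
  · congr 2
    ext w
    congr 2
    rw [← Complex.ofReal_mul]
    congr 1
    simp only [hZ]
    field_simp
  · have : Measurable fun x : ℝ => Complex.exp (((√K)⁻¹ * (t * √v) : ℝ) * x * Complex.I) := by
      fun_prop
    exact this.aestronglyMeasurable

theorem tendsto_div_mul_div (L : ℕ) (hL : 0 < L) :
    Tendsto (fun n : ℕ => ((n / L * L : ℕ) : ℝ) / n) atTop (𝓝 1) := by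
  have h1 : Tendsto (fun n : ℕ => 1 - (L : ℝ) / n) atTop (𝓝 1) := by
    simpa using tendsto_const_nhds.sub (tendsto_const_div_atTop_nhds_zero_nat (L : ℝ))
  refine tendsto_of_tendsto_of_tendsto_of_le_of_le' h1 tendsto_const_nhds ?_ ?_
  · filter_upwards [eventually_gt_atTop 0] with n hn
    have hn' : (0 : ℝ) < n := by exact_mod_cast hn
    rw [le_div_iff₀ hn', sub_mul, div_mul_cancel₀ _ hn'.ne', one_mul]
    have h2 : n < n / L * L + L := Nat.lt_div_mul_add hL
    have h3 : (n : ℝ) < ((n / L * L : ℕ) : ℝ) + L := by exact_mod_cast h2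
    linarith
  · filter_upwards [eventually_gt_atTop 0] with n hn
    have hn' : (0 : ℝ) < n := by exact_mod_cast hn
    rw [div_le_one hn']
    exact_mod_cast Nat.div_mul_le_self n L

namespace QuasiLocal

variable {f : (ℤ → ℝ) → ℝ} {β : ℕ → ℝ} (hf : QuasiLocal f β) {μ : Measure ℝ}
  [IsProbabilityMeasure μ]
include hf

/-- The remaining terms that do not fill a block number at most `L` and are bounded crudely; the
rest is controlled by its standard deviation. -/
theorem integral_abs_birkhoff_sub_le {C : ℝ} (hC : ∀ w, |f w| ≤ C) (L n : ℕ) (hL : 0 < L) :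
    ∫ w, |(birkhoff f n w - ∫ w', birkhoff f n w' ∂(iid μ)) -
        ∑ i ∈ Finset.range (n / L), (blockSum f L (translate (i * L : ℕ) w) -
          ∫ w', blockSum f L w' ∂(iid μ))| ∂(iid μ) ≤
      2 * (L * C) + √(Var[birkhoff f (n / L * L); iid μ] - (n / L : ℕ) * Var[blockSum f L; iid μ] +
        (n / L : ℕ) * (8 * (∑' m, β m) * √Var[blockSum f L; iid μ])) := by
  set K := n / L with hK
  have hb := hf.bddMeas_blockSum L
  have hC0 : 0 ≤ C := (abs_nonneg _).trans (hC 0)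
  obtain ⟨r, hr⟩ := Nat.exists_eq_add_of_le (Nat.div_mul_le_self n L)
  rw [← hK] at hr
  have hrL : r ≤ L := by
    have := Nat.lt_div_mul_add (a := n) hL
    rw [← hK] at this
    omega
  set R : (ℤ → ℝ) → ℝ := fun w => ∑ k ∈ Finset.range r, f (translate (K * L + k : ℕ) w) with hR
  have hRb : BddMeas R := BddMeas.sum _ fun k _ => hf.bddMeas_translate _
  have hRle : ∀ w, |R w| ≤ L * C := fun w => by
    refine (Finset.abs_sum_le_sum_abs _ _).trans ((Finset.sum_le_sum fun k _ => hC _).trans ?_)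
    rw [Finset.sum_const, Finset.card_range, nsmul_eq_mul]
    have : (r : ℝ) ≤ L := by exact_mod_cast hrL
    exact mul_le_mul_of_nonneg_right this hC0
  have hsplit : ∀ w, birkhoff f n w = birkhoff f (K * L) w + R w := fun w => by
    rw [hr]
    exact Finset.sum_range_add _ _ _
  set U : (ℤ → ℝ) → ℝ := fun w => birkhoff f (K * L) w -
    ∑ i ∈ Finset.range K, blockSum f L (translate (i * L : ℕ) w) with hU
  have hBb : BddMeas fun w => ∑ i ∈ Finset.range K, blockSum f L (translate (i * L : ℕ) w) :=
    BddMeas.sum _ fun i _ => hb.comp (measurable_translate _)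
  have hUb : BddMeas U := (hf.bddMeas_birkhoff _).sub hBb
  have hUm : ∫ w, U w ∂(iid μ) = ∫ w, birkhoff f (K * L) w ∂(iid μ) -
      K * ∫ w', blockSum f L w' ∂(iid μ) := by
    rw [hU, integral_sub ((hf.bddMeas_birkhoff _).integrable _) (hBb.integrable _),
      integral_finsetSum _ fun i _ => (hb.comp (measurable_translate _)).integrable _]
    simp_rw [fun i : ℕ => integral_translate (μ := μ) hb.measurable (i * L : ℕ)]
    simp
  have hpt : ∀ w, (birkhoff f n w - ∫ w', birkhoff f n w' ∂(iid μ)) -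
        ∑ i ∈ Finset.range K, (blockSum f L (translate (i * L : ℕ) w) -
          ∫ w', blockSum f L w' ∂(iid μ)) =
      (R w - ∫ w', R w' ∂(iid μ)) + (U w - ∫ w', U w' ∂(iid μ)) := fun w => by
    rw [hUm]
    simp_rw [hsplit]
    rw [integral_add ((hf.bddMeas_birkhoff _).integrable _) (hRb.integrable _),
      Finset.sum_sub_distrib]
    simp only [hU, Finset.sum_const, Finset.card_range, nsmul_eq_mul]
    ring
  simp_rw [hpt]
  have hRc : BddMeas fun w => R w - ∫ w', R w' ∂(iid μ) := hRb.sub (BddMeas.const _)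
  have hUc : BddMeas fun w => U w - ∫ w', U w' ∂(iid μ) := hUb.sub (BddMeas.const _)
  calc ∫ w, |(R w - ∫ w', R w' ∂(iid μ)) + (U w - ∫ w', U w' ∂(iid μ))| ∂(iid μ)
      ≤ ∫ w, (|R w - ∫ w', R w' ∂(iid μ)| + |U w - ∫ w', U w' ∂(iid μ)|) ∂(iid μ) :=
        integral_mono_of_nonneg (ae_of_all _ fun _ => abs_nonneg _)
          ((hRc.integrable _).abs.add (hUc.integrable _).abs) (ae_of_all _ fun w => abs_add_le _ _)
    _ = ∫ w, |R w - ∫ w', R w' ∂(iid μ)| ∂(iid μ) + ∫ w, |U w - ∫ w', U w' ∂(iid μ)| ∂(iid μ) :=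
        integral_add (hRc.integrable _).abs (hUc.integrable _).abs
    _ ≤ _ := by
        refine add_le_add ?_ ((integral_abs_sub_mean_le hUb).trans
          (Real.sqrt_le_sqrt (hf.variance_birkhoff_sub_blocks_le L K)))
        refine (le_abs_self _).trans (abs_integral_le_of_abs_le fun w => ?_)
        rw [abs_abs]
        refine (abs_sub _ _).trans ?_
        linarith [hRle w, abs_integral_le_of_abs_le (P := iid μ) hRle]

/-- **Central limit theorem** for the sums of the translates of a quasi-local function of an
i.i.d. sequence, in terms of characteristic functions. -/
theorem tendsto_charFun_birkhoff {s : ℝ} (hs0 : 0 < s)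
    (hs : HasSum (fun n : ℤ => cov[f, fun w => f (translate n w); iid μ]) s) (t : ℝ) :
    Tendsto (fun n : ℕ => ∫ w, Complex.exp ((t * ((√n)⁻¹ * (birkhoff f n w -
      ∫ w', birkhoff f n w' ∂(iid μ))) : ℝ) * Complex.I) ∂(iid μ)) atTop
      (𝓝 (Complex.exp (-(t ^ 2 * s / 2 : ℝ)))) := by
  obtain ⟨C, hC⟩ := hf.bddMeas.bdd
  set v : ℕ → ℝ := fun L => Var[blockSum f L; iid μ] with hv
  have hv0 : ∀ L, 0 ≤ v L := fun L => variance_nonneg _ _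
  set X : ℕ → (ℤ → ℝ) → ℝ := fun n w => birkhoff f n w - ∫ w', birkhoff f n w' ∂(iid μ) with hX
  have hXb : ∀ n, BddMeas (X n) := fun n => (hf.bddMeas_birkhoff n).sub (BddMeas.const _)
  have hvS := hf.tendsto_variance_birkhoff hs
  have hvL := hf.tendsto_variance_blockSum hs
  have hinv : Tendsto (fun L : ℕ => (L : ℝ)⁻¹) atTop (𝓝 0) := tendsto_inv_atTop_nhds_zero_nat
  -- The part of the `L¹` error bound that survives `n → ∞` at a fixed block length; it vanishes as
  -- `L → ∞`, because `v L / L` has the same limit `s` as the normalized variance.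
  set ρ : ℕ → ℝ := fun L => √(s - (L : ℝ)⁻¹ * v L + 8 * (∑' m, β m) * ((L : ℝ)⁻¹ * √(v L))) with hρ
  have hsqL : Tendsto (fun L : ℕ => (L : ℝ)⁻¹ * √(v L)) atTop (𝓝 0) := by
    have h1 : Tendsto (fun L : ℕ => √((L : ℝ)⁻¹) * √((L : ℝ)⁻¹ * v L)) atTop (𝓝 (√0 * √s)) :=
      ((Real.continuous_sqrt.tendsto 0).comp hinv).mul ((Real.continuous_sqrt.tendsto s).comp hvL)
    rw [Real.sqrt_zero, zero_mul] at h1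
    refine h1.congr fun L => ?_
    have hL : (0 : ℝ) ≤ (L : ℝ)⁻¹ := by positivity
    rw [Real.sqrt_mul hL, ← mul_assoc, Real.mul_self_sqrt hL]
  have hρ0 : Tendsto ρ atTop (𝓝 0) := by
    have h1 := (tendsto_const_nhds (x := s)).sub hvL |>.add (hsqL.const_mul (8 * ∑' m, β m))
    rw [sub_self, mul_zero, add_zero] at h1
    have := (Real.continuous_sqrt.tendsto 0).comp h1
    rwa [Real.sqrt_zero] at this
  -- First `n → ∞` with the block length fixed; `L` is chosen only at the end.
  have hblock : ∀ L : ℕ, 0 < L → 0 < v L → ∀ ε > 0, ∀ᶠ n : ℕ in atTop,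
      ‖(∫ w, Complex.exp ((t * ((√n)⁻¹ * X n w) : ℝ) * Complex.I) ∂(iid μ)) -
        Complex.exp (-(t ^ 2 * ((L : ℝ)⁻¹ * v L) / 2 : ℝ))‖ < |t| * ρ L + ε := by
    intro L hL hvpos ε hε
    have hLr : (0 : ℝ) < L := by exact_mod_cast hL
    have hb := hf.bddMeas_blockSum L
    set mb := ∫ w', blockSum f L w' ∂(iid μ) with hmb
    set Y : ℕ → (ℤ → ℝ) → ℝ := fun K w => ∑ i ∈ Finset.range K,
      (blockSum f L (translate (i * L : ℕ) w) - mb) with hY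
    have hYb : ∀ K, BddMeas (Y K) := fun K => BddMeas.sum _ fun i _ =>
      (hb.comp (measurable_translate _)).sub (BddMeas.const _)
    have hKtop : Tendsto (fun n : ℕ => n / L) atTop atTop := Nat.tendsto_div_const_atTop hL.ne'
    have hNtop : Tendsto (fun n : ℕ => n / L * L) atTop atTop := by
      refine tendsto_atTop_mono (fun n => ?_) hKtop
      exact Nat.le_mul_of_pos_right _ hL
    have hchar : Tendsto (fun n : ℕ => ∫ w, Complex.exp ((t * ((√(n / L * L : ℕ))⁻¹ *
        Y (n / L) w) : ℝ) * Complex.I) ∂(iid μ)) atTop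
        (𝓝 (Complex.exp (-(t ^ 2 * ((L : ℝ)⁻¹ * v L) / 2 : ℝ)))) := by
      have h1 := (tendsto_integral_exp_pow (μ := μ) hb hvpos (t * (√L)⁻¹)).comp hKtop
      have h2 : (t * (√L)⁻¹) ^ 2 * Var[blockSum f L; iid μ] / 2 =
          t ^ 2 * ((L : ℝ)⁻¹ * v L) / 2 := by
        rw [mul_pow, inv_pow, Real.sq_sqrt hLr.le, hv]
        ring
      rw [h2] at h1
      refine h1.congr fun n => ?_
      simp only [Function.comp_apply]
      rw [← integral_exp_sum_blocks (μ := μ) (L := L)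
        (G := fun w => t * (√L)⁻¹ * (√(n / L : ℕ))⁻¹ * (blockSum f L w - mb))]
      · congr 1
        ext w
        congr 3
        rw [← Finset.mul_sum, hY]
        push_cast
        rw [Real.sqrt_mul (by positivity), mul_inv]
        ring
      · exact ((BddMeas.const _).mul (hb.sub (BddMeas.const _))).measurable
      · intro w w' h
        dsimp only
        rw [dependsOn_blockSum f L h]
    set q : ℕ → ℝ := fun n => (√n)⁻¹ * ∫ w, |X n w| ∂(iid μ) with hq
    -- The cost of the two normalizations: `√n` for the sum, `√(n / L * L)` for the blocks.
    set d : ℕ → ℝ := fun n => |1 - √((n : ℝ) / (n / L * L : ℕ))| with hd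
    set E : ℕ → ℝ := fun n => (√(n / L * L : ℕ))⁻¹ * (2 * (L * C)) +
      √(((n / L * L : ℕ) : ℝ)⁻¹ * Var[birkhoff f (n / L * L); iid μ] - (L : ℝ)⁻¹ * v L +
        8 * (∑' m, β m) * ((L : ℝ)⁻¹ * √(v L))) with hE
    have hElim : Tendsto E atTop (𝓝 (ρ L)) := by
      have hN : Tendsto (fun n : ℕ => (√(n / L * L : ℕ))⁻¹) atTop (𝓝 0) :=
        tendsto_inv_atTop_zero.comp (Real.tendsto_sqrt_atTop.comp
          (tendsto_natCast_atTop_atTop.comp hNtop))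
      have h1 := hN.mul_const (2 * (L * C))
      have h2 := (Real.continuous_sqrt.tendsto _).comp
        (((hvS.comp hNtop).sub_const ((L : ℝ)⁻¹ * v L)).add_const
          (8 * (∑' m, β m) * ((L : ℝ)⁻¹ * √(v L))))
      have h3 := h1.add h2
      rw [zero_mul, zero_add] at h3
      exact h3
    have hdlim : Tendsto d atTop (𝓝 0) := by
      have h1 := ((tendsto_div_mul_div L hL).inv₀ one_ne_zero)
      have h2 := ((Real.continuous_sqrt.tendsto _).comp h1)
      have h3 := ((tendsto_const_nhds (x := (1 : ℝ))).sub h2).abs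
      rw [inv_one, Real.sqrt_one, sub_self, abs_zero] at h3
      refine h3.congr fun n => ?_
      simp only [hd, Function.comp_apply, inv_div]
    have hqle : ∀ n, q n ≤ √((n : ℝ)⁻¹ * Var[birkhoff f n; iid μ]) := fun n => by
      rw [Real.sqrt_mul (by positivity), Real.sqrt_inv]
      exact mul_le_mul_of_nonneg_left (integral_abs_sub_mean_le (hf.bddMeas_birkhoff n))
        (by positivity)
    have hq0 : ∀ n, 0 ≤ q n := fun n =>
      mul_nonneg (by positivity) (integral_nonneg fun w => abs_nonneg _)
    have hqd : Tendsto (fun n => q n * d n) atTop (𝓝 0) := by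
      have h1 := ((Real.continuous_sqrt.tendsto _).comp hvS).mul hdlim
      rw [mul_zero] at h1
      exact squeeze_zero (fun n => mul_nonneg (hq0 n) (abs_nonneg _))
        (fun n => mul_le_mul_of_nonneg_right (hqle n) (abs_nonneg _)) h1
    have htot : Tendsto (fun n => |t| * (E n + q n * d n) + ‖(∫ w, Complex.exp ((t *
        ((√(n / L * L : ℕ))⁻¹ * Y (n / L) w) : ℝ) * Complex.I) ∂(iid μ)) -
        Complex.exp (-(t ^ 2 * ((L : ℝ)⁻¹ * v L) / 2 : ℝ))‖) atTop (𝓝 (|t| * ρ L)) := by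
      have h1 := ((hElim.add hqd).const_mul |t|).add
        (tendsto_iff_norm_sub_tendsto_zero.1 hchar)
      rwa [add_zero, add_zero] at h1
    filter_upwards [htot.eventually (gt_mem_nhds (lt_add_of_pos_right _ hε)),
      eventually_ge_atTop L] with n hn hnL
    refine lt_of_le_of_lt ?_ hn
    have hn0 : 0 < n := lt_of_lt_of_le hL hnL
    have hnr : (0 : ℝ) < n := by exact_mod_cast hn0
    have hK0 : 0 < n / L := Nat.div_pos hnL hL
    have hKr : (0 : ℝ) < (n / L : ℕ) := by exact_mod_cast hK0
    have hN0 : (0 : ℝ) < (n / L * L : ℕ) := by exact_mod_cast Nat.mul_pos hK0 hL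
    set N : ℕ := n / L * L with hN
    have hsN : 0 < √(N : ℝ) := Real.sqrt_pos.2 hN0
    have hsn : 0 < √(n : ℝ) := Real.sqrt_pos.2 hnr
    refine (norm_sub_le_norm_sub_add_norm_sub _ _ _).trans (add_le_add ?_ le_rfl)
    refine (norm_integral_exp_sub_le ((BddMeas.const _).mul ((BddMeas.const _).mul (hXb n)))
      ((BddMeas.const _).mul ((BddMeas.const _).mul (hYb _)))).trans ?_
    have hpt : ∀ w, |t * ((√n)⁻¹ * X n w) - t * ((√N)⁻¹ * Y (n / L) w)| ≤
        |t| * ((√N)⁻¹ * |X n w - Y (n / L) w| + (√n)⁻¹ * d n * |X n w|) := fun w => by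
      have h1 : t * ((√n)⁻¹ * X n w) - t * ((√N)⁻¹ * Y (n / L) w) =
          t * ((√N)⁻¹ * (X n w - Y (n / L) w) + ((√n)⁻¹ - (√N)⁻¹) * X n w) := by ring
      rw [h1, abs_mul]
      refine mul_le_mul_of_nonneg_left ((abs_add_le _ _).trans (add_le_add ?_ ?_)) (abs_nonneg t)
      · rw [abs_mul, abs_of_pos (inv_pos.2 hsN)]
      · rw [abs_mul]
        refine mul_le_mul_of_nonneg_right (le_of_eq ?_) (abs_nonneg _)
        have h2 : (√(n : ℝ))⁻¹ - (√(N : ℝ))⁻¹ = (√n)⁻¹ * (1 - √((n : ℝ) / N)) := by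
          rw [Real.sqrt_div hnr.le]
          field_simp
        rw [h2, abs_mul, abs_of_pos (inv_pos.2 hsn)]
    have hXY : BddMeas fun w => X n w - Y (n / L) w := (hXb n).sub (hYb _)
    calc ∫ w, |t * ((√n)⁻¹ * X n w) - t * ((√N)⁻¹ * Y (n / L) w)| ∂(iid μ)
        ≤ ∫ w, |t| * ((√N)⁻¹ * |X n w - Y (n / L) w| + (√n)⁻¹ * d n * |X n w|) ∂(iid μ) :=
          integral_mono_of_nonneg (ae_of_all _ fun _ => abs_nonneg _)
            ((((hXY.integrable _).abs.const_mul _).add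
              (((hXb n).integrable _).abs.const_mul _)).const_mul _) (ae_of_all _ hpt)
      _ = |t| * ((√N)⁻¹ * ∫ w, |X n w - Y (n / L) w| ∂(iid μ) + q n * d n) := by
          rw [integral_const_mul, integral_add ((hXY.integrable _).abs.const_mul _)
            (((hXb n).integrable _).abs.const_mul _), integral_const_mul, integral_const_mul]
          ring
      _ ≤ |t| * (E n + q n * d n) := by
          refine mul_le_mul_of_nonneg_left (add_le_add ?_ le_rfl) (abs_nonneg t)
          refine (mul_le_mul_of_nonneg_left (hf.integral_abs_birkhoff_sub_le (μ := μ) hC L n hL)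
            (inv_pos.2 hsN).le).trans (le_of_eq ?_)
          rw [mul_add, hE]
          congr 1
          rw [← Real.sqrt_inv, ← Real.sqrt_mul (by positivity)]
          congr 1
          have hNe : (N : ℝ) = (n / L : ℕ) * L := by rw [hN]; push_cast; ring
          rw [← hN, hNe, hv]
          field_simp
  rw [Metric.tendsto_atTop']
  intro ε hε
  have hexp : Tendsto (fun L : ℕ => Complex.exp (-(t ^ 2 * ((L : ℝ)⁻¹ * v L) / 2 : ℝ))) atTop
      (𝓝 (Complex.exp (-(t ^ 2 * s / 2 : ℝ)))) := by
    have hcont : Continuous fun x : ℝ => Complex.exp (-(t ^ 2 * x / 2 : ℝ)) := by fun_prop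
    exact (hcont.tendsto s).comp hvL
  have htρ : Tendsto (fun L => |t| * ρ L) atTop (𝓝 0) := by simpa using hρ0.const_mul |t|
  have hε3 : 0 < ε / 3 := by positivity
  -- Positivity of `s` is used here: long blocks have positive variance, so they can be
  -- standardized.
  obtain ⟨L, hL1, hL2, hL3, hL4⟩ := ((htρ.eventually (gt_mem_nhds hε3)).and
    ((hvL.eventually (lt_mem_nhds hs0)).and ((eventually_gt_atTop 0).and
      (hexp.eventually (Metric.ball_mem_nhds _ hε3))))).exists
  have hvpos : 0 < v L := by
    have hL' : (0 : ℝ) < (L : ℝ)⁻¹ := inv_pos.2 (by exact_mod_cast hL3)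
    exact (pos_iff_pos_of_mul_pos hL2).1 hL'
  obtain ⟨N, hN⟩ := eventually_atTop.1 (hblock L hL3 hvpos (ε / 3) hε3)
  refine ⟨N, fun n hn => ?_⟩
  rw [dist_eq_norm]
  have h1 := hN n hn.le
  rw [dist_eq_norm] at hL4
  refine (norm_sub_le_norm_sub_add_norm_sub _ _ _).trans_lt (add_lt_add h1 hL4) |>.trans_le ?_
  linarith

end QuasiLocal


/-! ### The trace per period -/

theorem tsum_eq_sum_tsum_residue {N : ℕ} (hN : 0 < N) {g : ℤ → ℂ} (hg : Summable g) :
    ∑' i, g i = ∑ r ∈ Finset.range N, ∑' m : ℤ, g (m * N + r) := by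
  have : NeZero N := ⟨hN.ne'⟩
  have hval : ∀ (r : Fin N) (m : ℤ), (Int.divModEquiv N).symm (m, r) = m * N + (r : ℕ) :=
    fun r m => by rw [Int.divModEquiv_symm_apply]
  have hinj : ∀ r : Fin N, Function.Injective fun m : ℤ => (Int.divModEquiv N).symm (m, r) :=
    fun r => (Int.divModEquiv N).symm.injective.comp (Prod.mk_left_injective r)
  set e : Fin N × ℤ ≃ ℤ := (Equiv.prodComm _ _).trans (Int.divModEquiv N).symm with he
  have hev : ∀ r m, e (r, m) = m * N + (r : ℕ) := fun r m => hval r m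
  have hs : HasSum (fun p : Fin N × ℤ => g (e p)) (∑' i, g i) := e.hasSum_iff.2 hg.hasSum
  have hs2 : ∀ r : Fin N, HasSum (fun m : ℤ => g (e (r, m))) (∑' m : ℤ, g (e (r, m))) :=
    fun r => (hg.comp_injective (hinj r)).hasSum
  have h3 := (hs.prod_fiberwise hs2).tsum_eq
  rw [tsum_fintype] at h3
  rw [← h3, ← Fin.sum_univ_eq_sum_range (fun r => ∑' m : ℤ, g (m * N + r))]
  refine Finset.sum_congr rfl fun r _ => tsum_congr fun m => ?_
  rw [hev]

theorem periodic_mul_int {F : ℤ → ℤ → ℂ} {N : ℕ} (hF : ∀ i j, F (i + N) (j + N) = F i j) (m : ℤ)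
    (i j : ℤ) : F (i + m * N) (j + m * N) = F i j := by
  have hnat : ∀ (m : ℕ) (i j : ℤ), F (i + m * N) (j + m * N) = F i j := by
    intro m
    induction m with
    | zero => simp
    | succ m ih =>
      intro i j
      rw [← ih i j, ← hF (i + m * N)]
      congr 1 <;> push_cast <;> ring
  obtain ⟨n, rfl | rfl⟩ := m.eq_nat_or_neg
  · exact hnat n i j
  · rw [← hnat n]
    congr 1 <;> ring

/-- A simultaneous shift by whole periods carries a term with `i` in the cell and `j` anywhere to
one with `j` in the cell and `i` anywhere. -/
theorem sum_tsum_comm_of_periodic {F : ℤ → ℤ → ℂ} {N : ℕ} (hN : 0 < N)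
    (hF : ∀ i j, F (i + N) (j + N) = F i j) (h1 : ∀ i, Summable (F i))
    (h2 : ∀ j, Summable fun i => F i j) :
    ∑ i ∈ Finset.range N, ∑' j, F i j = ∑ j ∈ Finset.range N, ∑' i, F i j := by
  simp_rw [fun i : ℕ => tsum_eq_sum_tsum_residue hN (h1 i),
    fun j : ℕ => tsum_eq_sum_tsum_residue hN (h2 j)]
  rw [Finset.sum_comm]
  refine Finset.sum_congr rfl fun r _ => Finset.sum_congr rfl fun i _ => ?_
  rw [← (Equiv.neg ℤ).tsum_eq]
  refine tsum_congr fun m => ?_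
  rw [← periodic_mul_int hF m i]
  simp only [Equiv.neg_apply]
  congr 1 <;> ring

/-- The trace over the sites `0, …, N - 1`. -/
def cellTrace (N : ℕ) (A : L2Z →L[ℂ] L2Z) : ℂ := ∑ j ∈ Finset.range N, entry A j j

theorem entry_periodic {A : L2Z →L[ℂ] L2Z} {n : ℤ} (h : Commute (shiftOp n) A) (j k : ℤ) :
    entry A (j + n) (k + n) = entry A j k := by
  have h1 := congrArg (fun A : L2Z →L[ℂ] L2Z => coord (A (basisVec (k + n))) j) h.eq
  simp only [mul_apply_eq_comp, shiftOp_basisVec, coord_shiftOp, add_sub_cancel_right] at h1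
  exact h1

/-- Cyclicity of the trace per period, which replaces the trace: operators that commute with a shift
need not be trace class. -/
theorem cellTrace_mul_comm {N : ℕ} (hN : 0 < N) {A A' : L2Z →L[ℂ] L2Z}
    (hA : Commute (shiftOp N) A) (hA' : Commute (shiftOp N) A') :
    cellTrace N (A * A') = cellTrace N (A' * A) := by
  have h1 : ∀ j, entry (A * A') j j = ∑' i, entry A j i * entry A' i j := fun j =>
    (hasSum_entry_mul A A' j j).tsum_eq.symm
  have h2 : ∀ j, entry (A' * A) j j = ∑' i, entry A i j * entry A' j i := fun j => by
    rw [← (hasSum_entry_mul A' A j j).tsum_eq]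
    exact tsum_congr fun i => mul_comm _ _
  simp_rw [cellTrace, h1, h2]
  refine sum_tsum_comm_of_periodic hN (F := fun j i => entry A j i * entry A' i j) (fun i j => ?_)
    (fun j => (hasSum_entry_mul A A' j j).summable) fun j => ?_
  · rw [entry_periodic hA, entry_periodic hA']
  · exact (hasSum_entry_mul A' A j j).summable.congr fun i => mul_comm _ _

theorem cellTrace_add (N : ℕ) (A A' : L2Z →L[ℂ] L2Z) :
    cellTrace N (A + A') = cellTrace N A + cellTrace N A' := by
  simp_rw [cellTrace, entry_add, Finset.sum_add_distrib]

theorem norm_cellTrace_le (N : ℕ) (A : L2Z →L[ℂ] L2Z) : ‖cellTrace N A‖ ≤ N * ‖A‖ := by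
  refine (norm_sum_le _ _).trans ((Finset.sum_le_sum fun (j : ℕ) _ =>
    norm_entry_le A (j : ℤ) j).trans ?_)
  simp

/-- The trace over the sites `0, …, N - 1` as a continuous linear functional. -/
def cellTraceCLM (N : ℕ) : (L2Z →L[ℂ] L2Z) →L[ℂ] ℂ :=
  LinearMap.mkContinuous
    { toFun := cellTrace N
      map_add' := cellTrace_add N
      map_smul' := fun _ _ => (Finset.mul_sum _ _ _).symm } N (norm_cellTrace_le N)

theorem cellTraceCLM_apply (N : ℕ) (A : L2Z →L[ℂ] L2Z) : cellTraceCLM N A = cellTrace N A := rfl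

/-- In the noncommutative product rule, cyclicity brings `D` to the front of each of the `k` terms.
-/
theorem hasDerivAt_cellTrace_pow {N : ℕ} (hN : 0 < N) {A D : L2Z →L[ℂ] L2Z}
    (hA : Commute (shiftOp N) A) (hD : Commute (shiftOp N) D) (k : ℕ) (z : ℂ) :
    HasDerivAt (fun z : ℂ => cellTrace N ((A + z • D) ^ k))
      (k * cellTrace N (D * (A + z • D) ^ (k - 1))) z := by
  have h1 : HasDerivAt (fun z : ℂ => A + z • D) D z := by
    simpa using ((hasDerivAt_id z).smul_const D).const_add A
  have h2 := (cellTraceCLM N).hasFDerivAt.comp_hasDerivAt z (h1.fun_pow' k)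
  refine h2.congr_deriv ?_
  rw [map_sum]
  have hX : Commute (shiftOp (N : ℤ)) (A + z • D) := hA.add_right (hD.smul_right z)
  rw [← nsmul_eq_mul, ← Finset.card_range k, ← Finset.sum_const, Finset.card_range]
  refine Finset.sum_congr rfl fun i hi => ?_
  have hi' := Finset.mem_range.1 hi
  rw [cellTraceCLM_apply, mul_assoc, cellTrace_mul_comm hN (hX.pow_right _)
    (hD.mul_right (hX.pow_right _)), mul_assoc, ← pow_add]
  congr 3
  simp only [Nat.pred_eq_sub_one]
  omega

theorem entry_aeval_eq_sum (A : L2Z →L[ℂ] L2Z) (p : Polynomial ℝ) (j k : ℤ) {n : ℕ}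
    (hn : p.natDegree < n) :
    entry (Polynomial.aeval A p) j k = ∑ i ∈ Finset.range n, p.coeff i * entry (A ^ i) j k := by
  rw [Polynomial.aeval_eq_sum_range' hn]
  simp only [entry, _root_.sum_apply, coord_sum, _root_.smul_apply, coord_real_smul]

theorem commute_mulOp {v : ℤ → ℝ} (hv : ∃ C : ℝ, ∀ j, |v j| ≤ C) {n : ℤ} (h : translate n v = v) :
    Commute (shiftOp n) (mulOp v hv) := by
  refine ContinuousLinearMap.ext fun u => ext_coord fun j => ?_
  have := congrFun h j
  rw [translate] at this
  simp only [mul_apply_eq_comp, coord_shiftOp, coord_mulOp, this]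

theorem commute_schrodinger {w : ℤ → ℝ} {B : ℝ} (hw : ∀ j, |w j| ≤ B) {n : ℤ}
    (h : translate n w = w) : Commute (shiftOp n) (schrodinger w) := by
  have := semiconjBy_shiftOp hw n
  rwa [h] at this

theorem schrodinger_add_smul {w v : ℤ → ℝ} {B C : ℝ} (hw : ∀ j, |w j| ≤ B) (hv : ∀ j, |v j| ≤ C)
    (u : ℝ) : schrodinger (fun j => w j + u * v j) =
      schrodinger w + (u : ℂ) • mulOp v ⟨C, hv⟩ := by
  refine ContinuousLinearMap.ext fun x => ext_coord fun j => ?_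
  have hb : ∀ j, |w j + u * v j| ≤ B + |u| * C := fun j => by
    refine (abs_add_le _ _).trans (add_le_add (hw j) ?_)
    rw [abs_mul]
    exact mul_le_mul_of_nonneg_left (hv j) (abs_nonneg u)
  rw [coord_schrodinger hb]
  simp only [_root_.add_apply, _root_.smul_apply, coord_add, coord_smul, coord_mulOp,
    coord_schrodinger hw]
  push_cast
  ring

theorem hasDerivAt_cellTrace_aeval {N : ℕ} (hN : 0 < N) {w v : ℤ → ℝ} {B C : ℝ}
    (hw : ∀ j, |w j| ≤ B) (hv : ∀ j, |v j| ≤ C) (hpw : translate N w = w) (hpv : translate N v = v)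
    (p : Polynomial ℝ) (u : ℝ) :
    HasDerivAt (fun u : ℝ =>
        cellTrace N (Polynomial.aeval (schrodinger fun j => w j + u * v j) p))
      (∑ j ∈ Finset.range N, v j *
        entry (Polynomial.aeval (schrodinger fun j => w j + u * v j) p.derivative) j j) u := by
  set A := schrodinger w with hA
  set D := mulOp v ⟨C, hv⟩ with hD
  have hcA : Commute (shiftOp (N : ℤ)) A := commute_schrodinger hw hpw
  have hcD : Commute (shiftOp (N : ℤ)) D := commute_mulOp _ hpv
  set n := p.natDegree + 1 with hn
  have hsum : ∀ (q : Polynomial ℝ) (T : L2Z →L[ℂ] L2Z) (m : ℕ), q.natDegree < m →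
      cellTrace N (Polynomial.aeval T q) =
      ∑ i ∈ Finset.range m, (q.coeff i : ℂ) * cellTrace N (T ^ i) := fun q T m hm => by
    simp_rw [cellTrace, entry_aeval_eq_sum T q _ _ hm, Finset.mul_sum]
    exact Finset.sum_comm
  have hd : HasDerivAt (fun u : ℝ => ∑ i ∈ Finset.range n, (p.coeff i : ℂ) *
      cellTrace N ((A + (u : ℂ) • D) ^ i))
      (∑ i ∈ Finset.range n, (p.coeff i : ℂ) *
        (i * cellTrace N (D * (A + (u : ℂ) • D) ^ (i - 1)))) u :=
    HasDerivAt.fun_sum fun i _ =>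
      ((hasDerivAt_cellTrace_pow hN hcA hcD i u).comp_ofReal).const_mul _
  have heq : (fun u : ℝ => cellTrace N (Polynomial.aeval (schrodinger fun j => w j + u * v j) p)) =
      fun u : ℝ => ∑ i ∈ Finset.range n, (p.coeff i : ℂ) *
        cellTrace N ((A + (u : ℂ) • D) ^ i) := by
    ext u
    rw [hsum p _ n (Nat.lt_succ_self _), schrodinger_add_smul hw hv]
  rw [heq]
  refine hd.congr_deriv ?_
  set T := A + (u : ℂ) • D with hT
  have hcT : ∀ i, cellTrace N (D * T ^ i) = ∑ j ∈ Finset.range N, v j * entry (T ^ i) j j :=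
    fun i => rfl
  have hdeg : p.derivative.natDegree < n := by
    have := Polynomial.natDegree_derivative_le p
    omega
  rw [schrodinger_add_smul hw hv, ← hA, ← hD, ← hT]
  simp_rw [fun j : ℕ => entry_aeval_eq_sum T p.derivative j j (n := n) hdeg, Finset.mul_sum]
  rw [Finset.sum_comm, hn, Finset.sum_range_succ', Finset.sum_range_succ]
  have hlast : p.derivative.coeff p.natDegree = 0 := by
    rw [Polynomial.coeff_derivative, Polynomial.coeff_eq_zero_of_natDegree_lt (Nat.lt_succ_self _)]
    simp
  simp only [hlast, Complex.ofReal_zero, zero_mul, mul_zero, Finset.sum_const_zero, add_zero,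
    Nat.cast_zero]
  refine Finset.sum_congr rfl fun i _ => ?_
  rw [Nat.add_sub_cancel, hcT, Finset.mul_sum, Finset.mul_sum]
  refine Finset.sum_congr rfl fun j _ => ?_
  rw [Polynomial.coeff_derivative]
  push_cast
  ring

theorem exists_polynomial_derivative_eq (q : Polynomial ℝ) (c : ℝ) :
    ∃ p : Polynomial ℝ, p.derivative = q ∧ p.eval 0 = c := by
  refine ⟨Polynomial.C c + ∑ k ∈ Finset.range (q.natDegree + 1),
    Polynomial.monomial (k + 1) (q.coeff k / (k + 1)), ?_, ?_⟩
  · rw [Polynomial.derivative_add, Polynomial.derivative_C, zero_add, Polynomial.derivative_sum]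
    conv_rhs => rw [q.as_sum_range]
    refine Finset.sum_congr rfl fun k _ => ?_
    rw [Polynomial.derivative_monomial]
    have : (k : ℝ) + 1 ≠ 0 := by positivity
    push_cast
    rw [div_mul_cancel₀ _ this]
  · simp [Polynomial.eval_finsetSum]

/-- Approximate the derivative and integrate from `0`; a function and its derivative are then
approximated at once. -/
theorem exists_polynomial_near_deriv {f f' : ℝ → ℝ} (hf' : Continuous f')
    (hff : ∀ x, HasDerivAt f (f' x) x) {R : ℝ} (hR : 0 ≤ R) {ε : ℝ} (hε : 0 < ε) :
    ∃ p : Polynomial ℝ, (∀ x, |x| ≤ R → |f x - p.eval x| ≤ ε * R) ∧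
      ∀ x, |x| ≤ R → |f' x - p.derivative.eval x| ≤ ε := by
  obtain ⟨q, hq⟩ := exists_polynomial_near hf' R hε
  obtain ⟨p, rfl, hp0⟩ := exists_polynomial_derivative_eq q (f 0)
  refine ⟨p, fun x hx => ?_, hq⟩
  have h1 := (convex_Icc (-R) R).norm_image_sub_le_of_norm_hasDerivWithin_le
    (f := fun x => f x - p.eval x) (f' := fun x => f' x - p.derivative.eval x) (C := ε)
    (x := 0) (y := x) (fun y _ => ((hff y).sub (p.hasDerivAt y)).hasDerivWithinAt)
    (fun y hy => hq y (abs_le.2 hy)) ⟨by linarith, hR⟩ (abs_le.1 hx)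
  rw [hp0, sub_self, sub_zero, sub_zero, Real.norm_eq_abs, Real.norm_eq_abs] at h1
  exact h1.trans (mul_le_mul_of_nonneg_left hx hε.le)

theorem diagEntry_polynomial (w : ℤ → ℝ) (p : Polynomial ℝ) (j : ℤ) :
    diagEntry p.eval w j = (entry (Polynomial.aeval (schrodinger w) p) j j).re := by
  rw [diagEntry, cfc_polynomial p (schrodinger w) (isSelfAdjoint_schrodinger w)]

theorem abs_lineMap_le {x y B u : ℝ} (hx : |x| ≤ B) (hy : |y| ≤ B) (hu : u ∈ Set.Icc (0 : ℝ) 1) :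
    |x + u * (y - x)| ≤ B := by
  rw [abs_le] at *
  obtain ⟨h0, h1⟩ := hu
  constructor <;> nlinarith

theorem intervalIntegrable_diagEntry {w v : ℤ → ℝ} {B : ℝ} (hw : ∀ j, |w j| ≤ B)
    (hv : ∀ j, |v j| ≤ B) {f : ℝ → ℝ} (hf : Continuous f) (j : ℤ) :
    IntervalIntegrable (fun u : ℝ => diagEntry f (fun i => w i + u * (v i - w i)) j) volume 0 1 := by
  have hB : 0 ≤ B := (abs_nonneg _).trans (hw 0)
  have hc : Continuous fun u : ℝ => diagEntry f (clamp B fun i => w i + u * (v i - w i)) j :=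
    (continuous_diagEntry_clamp hB hf j).comp (by fun_prop)
  refine (hc.intervalIntegrable 0 1).congr fun u hu => ?_
  rw [Set.uIoc_of_le zero_le_one] at hu
  rw [clamp_of_abs_le fun i => abs_lineMap_le (hw i) (hv i) ⟨hu.1.le, hu.2⟩]

theorem intervalIntegrable_sum_mul_diagEntry {w v : ℤ → ℝ} {B : ℝ} (hw : ∀ j, |w j| ≤ B)
    (hv : ∀ j, |v j| ≤ B) {f : ℝ → ℝ} (hf : Continuous f) (N : ℕ) (c : ℤ → ℝ) :
    IntervalIntegrable (fun u : ℝ => ∑ j ∈ Finset.range N,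
      c j * diagEntry f (fun i => w i + u * (v i - w i)) j) volume 0 1 := by
  induction N with
  | zero => simp
  | succ N ih =>
    simp_rw [Finset.sum_range_succ]
    exact ih.add ((intervalIntegrable_diagEntry hw hv hf N).const_mul _)

/-- The change of the trace per period under a periodic change of the potential. -/
theorem sum_diagEntry_sub_eq_integral {N : ℕ} (hN : 0 < N) {w v : ℤ → ℝ} {B : ℝ}
    (hw : ∀ j, |w j| ≤ B) (hv : ∀ j, |v j| ≤ B) (hpw : translate N w = w) (hpv : translate N v = v)
    {f f' : ℝ → ℝ} (hf' : Continuous f') (hff : ∀ x, HasDerivAt f (f' x) x) :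
    ∑ j ∈ Finset.range N, (diagEntry f v j - diagEntry f w j) =
      ∫ u in (0 : ℝ)..1, ∑ j ∈ Finset.range N,
        (v j - w j) * diagEntry f' (fun i => w i + u * (v i - w i)) j := by
  have hB : 0 ≤ B := (abs_nonneg _).trans (hw 0)
  have hf : Continuous f := continuous_iff_continuousAt.2 fun x => (hff x).continuousAt
  have hvw : ∀ j, |v j - w j| ≤ 2 * B := fun j => by
    refine (abs_sub _ _).trans ?_
    linarith [hw j, hv j]
  have hpd : translate N (fun j => v j - w j) = fun j => v j - w j := by
    ext j
    have h1 := congrFun hpw j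
    have h2 := congrFun hpv j
    simp only [translate] at *
    rw [h1, h2]
  -- For polynomials this is the fundamental theorem of calculus along the segment of potentials;
  -- both sides are then continuous under `C^1` approximation.
  have hpoly : ∀ p : Polynomial ℝ, ∑ j ∈ Finset.range N,
      (diagEntry p.eval v j - diagEntry p.eval w j) =
      ∫ u in (0 : ℝ)..1, ∑ j ∈ Finset.range N,
        (v j - w j) * diagEntry p.derivative.eval (fun i => w i + u * (v i - w i)) j := by
    intro p
    have hd : ∀ u : ℝ, HasDerivAt (fun u : ℝ => (cellTrace N (Polynomial.aeval
        (schrodinger fun j => w j + u * (v j - w j)) p)).re)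
        (∑ j ∈ Finset.range N,
          (v j - w j) * diagEntry p.derivative.eval (fun i => w i + u * (v i - w i)) j) u := by
      intro u
      have h := Complex.reCLM.hasFDerivAt.comp_hasDerivAt u
        (hasDerivAt_cellTrace_aeval hN hw hvw hpw hpd p u)
      refine h.congr_deriv ?_
      rw [Complex.reCLM_apply, Complex.re_sum]
      refine Finset.sum_congr rfl fun j _ => ?_
      rw [diagEntry_polynomial, Complex.re_ofReal_mul]
    rw [intervalIntegral.integral_eq_sub_of_hasDerivAt (fun u _ => hd u)]
    · simp only [cellTrace, Complex.re_sum, diagEntry_polynomial, one_mul, zero_mul, add_zero,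
        add_sub_cancel, Finset.sum_sub_distrib]
    · exact intervalIntegrable_sum_mul_diagEntry hw hv p.derivative.continuous N
        fun j => v j - w j
  set X := ∑ j ∈ Finset.range N, (diagEntry f v j - diagEntry f w j) with hX
  set Y := ∫ u in (0 : ℝ)..1, ∑ j ∈ Finset.range N,
        (v j - w j) * diagEntry f' (fun i => w i + u * (v i - w i)) j with hY
  rw [← sub_eq_zero, ← abs_nonpos_iff]
  refine le_of_forall_pos_le_add fun ε hε => ?_
  -- The first term counts the error of `f` at the two ends, the second the error of `f'` times the
  -- size of the perturbation; the `1` keeps `K` positive when `B = 0` too.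
  set K : ℝ := N * (2 * (2 + B)) + N * (2 * B) + 1 with hK
  have hK0 : 0 < K := by positivity
  obtain ⟨p, hp, hp'⟩ := exists_polynomial_near_deriv hf' hff (R := 2 + B) (by linarith)
    (div_pos hε hK0)
  set η := ε / K with hη
  have hη0 : 0 < η := div_pos hε hK0
  have h1 : |X - ∑ j ∈ Finset.range N, (diagEntry p.eval v j - diagEntry p.eval w j)| ≤
      N * (2 * (η * (2 + B))) := by
    rw [hX, ← Finset.sum_sub_distrib]
    refine (Finset.abs_sum_le_sum_abs _ _).trans ?_
    rw [← nsmul_eq_mul, ← Finset.card_range N, ← Finset.sum_const, Finset.card_range]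
    refine Finset.sum_le_sum fun j _ => ?_
    have a1 := abs_diagEntry_sub_diagEntry_le hv hf p.continuous
      (mul_nonneg hη0.le (by linarith)) hp j
    have a2 := abs_diagEntry_sub_diagEntry_le hw hf p.continuous
      (mul_nonneg hη0.le (by linarith)) hp j
    rw [abs_le] at *
    constructor <;> linarith
  have h2 : |(∫ u in (0 : ℝ)..1, ∑ j ∈ Finset.range N,
        (v j - w j) * diagEntry p.derivative.eval (fun i => w i + u * (v i - w i)) j) - Y| ≤
      N * (2 * B) * η := by
    rw [hY, ← intervalIntegral.integral_sub]
    · have hb : ∀ u ∈ Set.uIoc (0 : ℝ) 1, ‖(∑ j ∈ Finset.range N,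
          (v j - w j) * diagEntry p.derivative.eval (fun i => w i + u * (v i - w i)) j) -
          ∑ j ∈ Finset.range N,
            (v j - w j) * diagEntry f' (fun i => w i + u * (v i - w i)) j‖ ≤ N * (2 * B) * η := by
        intro u hu
        rw [Set.uIoc_of_le zero_le_one] at hu
        rw [← Finset.sum_sub_distrib, mul_assoc]
        refine (norm_sum_le _ _).trans ?_
        rw [← nsmul_eq_mul, ← Finset.card_range N, ← Finset.sum_const, Finset.card_range]
        refine Finset.sum_le_sum fun j _ => ?_
        rw [← mul_sub, norm_mul]
        refine mul_le_mul (hvw j) ?_ (norm_nonneg _) (by linarith)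
        rw [Real.norm_eq_abs, abs_sub_comm]
        exact abs_diagEntry_sub_diagEntry_le
          (fun i => abs_lineMap_le (hw i) (hv i) ⟨hu.1.le, hu.2⟩) hf' p.derivative.continuous
          hη0.le hp' j
      simpa using intervalIntegral.norm_integral_le_of_norm_le_const hb
    · exact intervalIntegrable_sum_mul_diagEntry hw hv p.derivative.continuous N
        fun j => v j - w j
    · exact intervalIntegrable_sum_mul_diagEntry hw hv hf' N fun j => v j - w j
  rw [hpoly p] at h1
  have h3 : η * K = ε := div_mul_cancel₀ _ hK0.ne'
  refine (abs_sub_le _ _ _).trans ((add_le_add h1 h2).trans ?_)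
  rw [zero_add, ← h3, hK]
  nlinarith


/-! ### Periodization and the change of one site -/

theorem sum_range_sub_eq_sum_Icc {M : Type*} [AddCommMonoid M] (G : ℤ → M) (n : ℕ) :
    ∑ j ∈ Finset.range (2 * n + 1), G ((j : ℤ) - n) = ∑ j ∈ Finset.Icc (-(n : ℤ)) n, G j := by
  refine Finset.sum_bij (fun j _ => (j : ℤ) - n) (fun j hj => ?_) (fun i _ j _ h => ?_)
    (fun j hj => ?_) fun j _ => rfl
  · rw [Finset.mem_range] at hj
    rw [Finset.mem_Icc]
    omega
  · omega
  · rw [Finset.mem_Icc] at hj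
    exact ⟨(j + n).toNat, by rw [Finset.mem_range]; omega, by omega⟩

/-- The configuration with period `2 n + 1` that agrees with `w` on `[-n, n]`. -/
def periodize (n : ℕ) (w : ℤ → ℝ) : ℤ → ℝ := fun i => w ((i + n) % (2 * n + 1 : ℕ) - n)

theorem periodize_of_abs_le {n : ℕ} {i : ℤ} (h : |i| ≤ n) (w : ℤ → ℝ) : periodize n w i = w i := by
  rw [abs_le] at h
  rw [periodize, Int.emod_eq_of_lt (by omega) (by push_cast; omega), add_sub_cancel_right]

theorem translate_periodize (n : ℕ) (w : ℤ → ℝ) :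
    translate (2 * n + 1 : ℕ) (periodize n w) = periodize n w := by
  ext i
  rw [translate, periodize, periodize, add_right_comm, Int.add_emod_right]

/-- The copies of the origin are the multiples of the period `2 n + 1`, and a site of the cell `[-n,
n]` is at least as close to the origin itself as to any of them. -/
theorem periodize_site {n : ℕ} {i : ℤ} (h : (i + n) % (2 * n + 1 : ℕ) - n = 0) {j : ℤ}
    (hj : |j| ≤ n) : |j| ≤ |i - j| := by
  have h1 := Int.emod_add_mul_ediv (i + n) (2 * n + 1 : ℕ)
  have h2 : i = (2 * n + 1 : ℕ) * ((i + n) / (2 * n + 1 : ℕ)) := by omega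
  set q := (i + n) / ((2 * n + 1 : ℕ) : ℤ)
  rcases lt_trichotomy q 0 with hq | hq | hq
  · have : i ≤ -(2 * n + 1 : ℕ) := by rw [h2]; nlinarith
    push_cast at this
    have h3 := neg_le_abs (i - j)
    have h4 := neg_le_abs j
    have h5 := le_abs_self j
    rcases abs_choice j with h6 | h6 <;> omega
  · simp [h2, hq]
  · have : (2 * n + 1 : ℕ) ≤ i := by rw [h2]; nlinarith
    push_cast at this
    have h3 := le_abs_self (i - j)
    have h4 := neg_le_abs j
    have h5 := le_abs_self j
    rcases abs_choice j with h6 | h6 <;> omega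

theorem tendsto_periodize (w : ℤ → ℝ) : Tendsto (fun n => periodize n w) atTop (𝓝 w) := by
  rw [tendsto_pi_nhds]
  intro i
  refine tendsto_const_nhds.congr' ?_
  filter_upwards [eventually_ge_atTop i.natAbs] with n hn
  rw [periodize_of_abs_le (by rw [abs_le]; omega)]

theorem periodize_update_eq {n : ℕ} {w : ℤ → ℝ} {x y : ℝ} {j : ℤ} (hj : |j| ≤ n) {i : ℤ}
    (h : |i - j| < |j|) :
    periodize n (Function.update w 0 x) i = periodize n (Function.update w 0 y) i := by
  by_cases h0 : (i + n) % (2 * n + 1 : ℕ) - n = 0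
  · exact absurd (periodize_site h0 hj) (not_le.2 h)
  · rw [periodize, periodize, Function.update_of_ne h0, Function.update_of_ne h0]

/-- Dominated convergence for series. By `periodize_update_eq` all changed sites are at distance at
least `|j|` from `j`, so `β |j|` is a majorant for every period. -/
theorem QuasiLocal.tendsto_sum_periodize {f : (ℤ → ℝ) → ℝ} {β : ℕ → ℝ} (hf : QuasiLocal f β)
    (w : ℤ → ℝ) (x y : ℝ) :
    Tendsto (fun n : ℕ => ∑ j ∈ Finset.Icc (-(n : ℤ)) n,
      (f (translate j (periodize n (Function.update w 0 y))) -
        f (translate j (periodize n (Function.update w 0 x))))) atTop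
      (𝓝 (∑' j : ℤ, (f (translate j (Function.update w 0 y)) -
        f (translate j (Function.update w 0 x))))) := by
  have hsum : ∀ n : ℕ, ∑ j ∈ Finset.Icc (-(n : ℤ)) n,
      (f (translate j (periodize n (Function.update w 0 y))) -
        f (translate j (periodize n (Function.update w 0 x)))) =
      ∑' j : ℤ, if j ∈ Finset.Icc (-(n : ℤ)) n then
        (f (translate j (periodize n (Function.update w 0 y))) -
        f (translate j (periodize n (Function.update w 0 x)))) else 0 := fun n => by
    rw [tsum_eq_sum (s := Finset.Icc (-(n : ℤ)) n) fun j hj => if_neg hj]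
    exact Finset.sum_congr rfl fun j hj => (if_pos hj).symm
  simp_rw [hsum]
  refine tendsto_tsum_of_dominated_convergence hf.summable_natAbs (fun j => ?_)
    (Eventually.of_forall fun n j => ?_)
  · have hlim : ∀ z, Tendsto (fun n : ℕ => f (translate j (periodize n z))) atTop
        (𝓝 (f (translate j z))) := fun z => by
      rw [tendsto_iff_norm_sub_tendsto_zero]
      have h0 : Tendsto (fun n : ℕ => β (n - j.natAbs)) atTop (𝓝 0) :=
        hf.summable.tendsto_atTop_zero.comp (tendsto_sub_atTop_nat _)
      refine squeeze_zero (fun _ => norm_nonneg _) (fun n => ?_) h0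
      refine hf.abs_sub_translate_le fun i hi => periodize_of_abs_le ?_ z
      rw [abs_lt] at hi
      rw [abs_le]
      omega
    refine ((hlim _).sub (hlim _)).congr' ?_
    filter_upwards [eventually_ge_atTop j.natAbs] with n hn
    rw [if_pos (by rw [Finset.mem_Icc]; omega)]
  · split_ifs with hj
    · refine hf.abs_sub_translate_le fun i hi => ?_
      rw [Finset.mem_Icc, ← abs_le] at hj
      rw [Int.natCast_natAbs] at hi
      exact periodize_update_eq hj hi
    · rw [norm_zero]
      exact hf.nonneg _

/-- The diagonal entry `f_{00}(H)` as a function of the potential, truncated at the level `B`. -/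
def originEntry (B : ℝ) (f : ℝ → ℝ) (w : ℤ → ℝ) : ℝ := diagEntry f (clamp B w) 0

theorem originEntry_translate {B : ℝ} {f : ℝ → ℝ} (hf : Continuous f) {w : ℤ → ℝ}
    (hw : ∀ j, |w j| ≤ B) (j : ℤ) : originEntry B f (translate j w) = diagEntry f w j := by
  rw [originEntry, clamp_of_abs_le (w := translate j w) fun i => hw _, diagEntry_translate hw hf,
    zero_add]

theorem continuous_originEntry {B : ℝ} (hB : 0 ≤ B) {f : ℝ → ℝ} (hf : Continuous f) :
    Continuous (originEntry B f) := continuous_diagEntry_clamp hB hf 0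

theorem exists_abs_le_of_continuous {f : ℝ → ℝ} (hf : Continuous f) (R : ℝ) :
    ∃ c, 0 ≤ c ∧ ∀ x, |x| ≤ R → |f x| ≤ c := by
  obtain ⟨c, hc⟩ := (isCompact_Icc (a := -R) (b := R)).exists_bound_of_continuousOn hf.continuousOn
  exact ⟨max c 0, le_max_right _ _, fun x hx => (hc x (abs_le.1 hx)).trans (le_max_left _ _)⟩

theorem bddMeas_originEntry {B : ℝ} (hB : 0 ≤ B) {f : ℝ → ℝ} (hf : Continuous f) :
    BddMeas (originEntry B f) := by
  obtain ⟨c, hc0, hc⟩ := exists_abs_le_of_continuous hf (2 + B)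
  exact ⟨(continuous_originEntry hB hf).measurable, c,
    fun w => abs_diagEntry_le (abs_clamp_le hB w) hc0 hc 0⟩

theorem exists_quasiLocal_originEntry {B : ℝ} (hB : 0 ≤ B) {f : ℝ → ℝ} (hf : Continuous f)
    {β : ℕ → ℝ} (hβ : PolyRate (2 + B) f β) (hs : Summable β) :
    ∃ β', QuasiLocal (originEntry B f) β' := by
  obtain ⟨c, hc⟩ := (bddMeas_originEntry hB hf).bdd
  -- Agreement for `|i| < m + 1` is agreement for `|i| ≤ m`, as degree `m` requires; this shifts the
  -- rate by one, and the empty condition at `m = 0` is met by the trivial bound.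
  refine ⟨fun m => Nat.casesOn m (2 * c) fun m => 2 * β m, bddMeas_originEntry hB hf,
    (summable_nat_add_iff 1).1 (hs.mul_left 2), fun m w w' h => ?_⟩
  cases m with
  | zero =>
    refine (abs_sub _ _).trans ((add_le_add (hc w) (hc w')).trans ?_)
    exact (two_mul c).ge
  | succ m =>
    refine hβ.abs_diagEntry_sub_le (abs_clamp_le hB w) (abs_clamp_le hB w') hf fun i hi => ?_
    rw [clamp, clamp, h i (by push_cast; rw [sub_zero] at hi; omega)]

theorem abs_update_le {w : ℤ → ℝ} {B x : ℝ} (hw : ∀ j, |w j| ≤ B) (hx : |x| ≤ B) (j : ℤ) :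
    |Function.update w 0 x j| ≤ B := by
  rcases eq_or_ne j 0 with rfl | hj
  · rwa [Function.update_self]
  · rw [Function.update_of_ne hj]
    exact hw j

theorem sum_translate_periodize_eq_sum_range {B : ℝ} {f : ℝ → ℝ} (hf : Continuous f) {w : ℤ → ℝ}
    (hw : ∀ j, |w j| ≤ B) (n : ℕ) :
    ∑ j ∈ Finset.Icc (-(n : ℤ)) n, originEntry B f (translate j (periodize n w)) =
      ∑ j ∈ Finset.range (2 * n + 1), diagEntry f (translate (-n) (periodize n w)) j := by
  have hp : ∀ j, |periodize n w j| ≤ B := fun j => hw _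
  rw [← sum_range_sub_eq_sum_Icc]
  refine Finset.sum_congr rfl fun j _ => ?_
  rw [originEntry_translate hf hp, diagEntry_translate hp hf, sub_eq_add_neg]

/-- The total change of the diagonal of `f(H)` under a change of the potential at one site. -/
theorem tsum_originEntry_update_sub {B : ℝ} {f f' : ℝ → ℝ} (hf' : Continuous f')
    (hff : ∀ x, HasDerivAt f (f' x) x) {β : ℕ → ℝ} (hβ : QuasiLocal (originEntry B f) β)
    {w : ℤ → ℝ} (hw : ∀ j, |w j| ≤ B) {x y : ℝ} (hx : |x| ≤ B) (hy : |y| ≤ B) :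
    ∑' j : ℤ, (originEntry B f (translate j (Function.update w 0 y)) -
        originEntry B f (translate j (Function.update w 0 x))) =
      (y - x) * ∫ u in (0 : ℝ)..1, diagEntry f' (Function.update w 0 (x + u * (y - x))) 0 := by
  have hB : 0 ≤ B := (abs_nonneg _).trans hx
  have hf : Continuous f := continuous_iff_continuousAt.2 fun x => (hff x).continuousAt
  refine tendsto_nhds_unique (hβ.tendsto_sum_periodize w x y) ?_
  have hcell : ∀ n : ℕ, ∑ j ∈ Finset.Icc (-(n : ℤ)) n,
      (originEntry B f (translate j (periodize n (Function.update w 0 y))) -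
        originEntry B f (translate j (periodize n (Function.update w 0 x)))) =
      ∫ u in (0 : ℝ)..1, (y - x) *
        diagEntry f' (periodize n (Function.update w 0 (x + u * (y - x)))) 0 := by
    intro n
    have hper : ∀ z, translate (2 * n + 1 : ℕ) (translate (-n) (periodize n z)) =
        translate (-n) (periodize n z) := fun z => by
      rw [translate_translate, add_comm, ← translate_translate, translate_periodize]
    rw [Finset.sum_sub_distrib, sum_translate_periodize_eq_sum_range hf (abs_update_le hw hy),
      sum_translate_periodize_eq_sum_range hf (abs_update_le hw hx), ← Finset.sum_sub_distrib,
      sum_diagEntry_sub_eq_integral (w := translate (-n) (periodize n (Function.update w 0 x)))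
        (v := translate (-n) (periodize n (Function.update w 0 y))) (Nat.succ_pos (2 * n))
        (fun j => abs_update_le hw hx _) (fun j => abs_update_le hw hy _) (hper _) (hper _) hf' hff]
    refine intervalIntegral.integral_congr fun u hu => ?_
    rw [Set.uIcc_of_le zero_le_one] at hu
    -- The cell `[-n, n]` is moved to `[0, 2n]`, so the only site of it where the potentials differ
    -- is `n`.
    rw [Finset.sum_eq_single n]
    · have hz : ∀ z, translate (-n) (periodize n (Function.update w 0 z)) n = z := fun z => by
        rw [translate, add_neg_cancel, periodize_of_abs_le (by simp), Function.update_self]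
      -- Interpolating between the two periodic potentials is the same as periodizing the
      -- interpolation at one site.
      have hline : (fun i => translate (-n) (periodize n (Function.update w 0 x)) i +
          u * (translate (-n) (periodize n (Function.update w 0 y)) i -
            translate (-n) (periodize n (Function.update w 0 x)) i)) =
          translate (-n) (periodize n (Function.update w 0 (x + u * (y - x)))) := by
        ext i
        simp only [translate, periodize]
        generalize (i + -(n : ℤ) + n) % ((2 * n + 1 : ℕ) : ℤ) - n = k
        rcases eq_or_ne k 0 with rfl | hk
        · simp only [Function.update_self]
        · simp only [Function.update_of_ne hk, sub_self, mul_zero, add_zero]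
      rw [hline, hz, hz, diagEntry_translate (B := B) (w := periodize n (Function.update w 0
        (x + u * (y - x)))) (fun j => abs_update_le hw
        (abs_lineMap_le hx hy hu) _) hf', add_neg_cancel]
    · intro j hj hjn
      have hj' := Finset.mem_range.1 hj
      have hne : (j : ℤ) + -n ≠ 0 := by omega
      have hle : |(j : ℤ) + -n| ≤ n := by rw [abs_le]; omega
      rw [translate, translate, periodize_of_abs_le hle, periodize_of_abs_le hle,
        Function.update_of_ne hne, Function.update_of_ne hne, sub_self, zero_mul]
    · intro h
      exact absurd (Finset.mem_range.2 (by omega)) h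
  simp_rw [hcell]
  rw [← intervalIntegral.integral_const_mul]
  obtain ⟨c, hc0, hc⟩ := exists_abs_le_of_continuous hf' (2 + B)
  have hbd : ∀ u ∈ Set.Ioc (0 : ℝ) 1, ∀ j, |Function.update w 0 (x + u * (y - x)) j| ≤ B :=
    fun u hu => abs_update_le hw (abs_lineMap_le hx hy ⟨hu.1.le, hu.2⟩)
  have hpbd : ∀ n, ∀ u ∈ Set.Ioc (0 : ℝ) 1, ∀ j,
      |periodize n (Function.update w 0 (x + u * (y - x))) j| ≤ B := fun n u hu j => hbd u hu _
  have hcont : ∀ n, Continuous fun u : ℝ =>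
      (y - x) * originEntry B f' (periodize n (Function.update w 0 (x + u * (y - x)))) := fun n => by
    refine continuous_const.mul ((continuous_originEntry hB hf').comp ?_)
    unfold periodize
    refine continuous_pi fun i => ?_
    have hu : Continuous fun u : ℝ => Function.update w 0 (x + u * (y - x)) :=
      continuous_const.update 0 (by fun_prop)
    exact (continuous_apply ((i + n) % ((2 * n + 1 : ℕ) : ℤ) - n)).comp hu
  -- The period goes to infinity under the integral, by strong continuity in the potential.
  refine intervalIntegral.tendsto_integral_filter_of_dominated_convergence
    (fun _ => |y - x| * c) (Eventually.of_forall fun n => ?_)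
    (Eventually.of_forall fun n => ae_of_all _ fun u hu => ?_) (by simp)
    (ae_of_all _ fun u hu => ?_)
  · refine (hcont n).aestronglyMeasurable.restrict.congr ?_
    refine (ae_restrict_iff' measurableSet_uIoc).2 (ae_of_all _ fun u hu => ?_)
    rw [Set.uIoc_of_le zero_le_one] at hu
    simp only [originEntry, clamp_of_abs_le (hpbd n u hu)]
  · rw [Set.uIoc_of_le zero_le_one] at hu
    rw [norm_mul]
    exact mul_le_mul_of_nonneg_left (abs_diagEntry_le (fun j => hbd u hu _) hc0 hc 0)
      (abs_nonneg _)
  · rw [Set.uIoc_of_le zero_le_one] at hu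
    refine Tendsto.const_mul _ ?_
    have h := ((continuous_originEntry hB hf').tendsto _).comp
      (tendsto_periodize (Function.update w 0 (x + u * (y - x))))
    rw [originEntry, clamp_of_abs_le (hbd u hu)] at h
    refine h.congr fun n => ?_
    rw [Function.comp_apply, originEntry, clamp_of_abs_le (hpbd n u hu)]

theorem totalChange_originEntry {B : ℝ} {f f' : ℝ → ℝ} (hf' : Continuous f')
    (hff : ∀ x, HasDerivAt f (f' x) x) {β : ℕ → ℝ} (hβ : QuasiLocal (originEntry B f) β)
    {w : ℤ → ℝ} (hw : ∀ j, |w j| ≤ B) : totalChange (originEntry B f) w =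
      w 0 * ∫ u in (0 : ℝ)..1, diagEntry f' (Function.update w 0 (u * w 0)) 0 := by
  have hB : 0 ≤ B := (abs_nonneg _).trans (hw 0)
  have h := tsum_originEntry_update_sub hf' hff hβ hw (x := 0) (by simpa) (hw 0)
  simpa [totalChange, eraseZero] using h

theorem siteVar_eq_totalChange {Ω : Type*} [MeasurableSpace Ω] {V : ℤ → Ω → ℝ} {B : ℝ}
    (hV : ∀ j ω, |V j ω| ≤ B) {f f' : ℝ → ℝ} (hf' : Continuous f')
    (hff : ∀ x, HasDerivAt f (f' x) x) {β : ℕ → ℝ} (hβ : QuasiLocal (originEntry B f) β) :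
    siteVar V f = fun ω => totalChange (originEntry B f) (pot V ω) := by
  ext ω
  rw [totalChange_originEntry hf' hff hβ (w := pot V ω) (fun j => hV j ω), siteVar,
    funext fun x => (hff x).deriv]
  rfl


/-! ### Functions of the restriction and restriction of functions -/

theorem re_inner_cfc_nonneg {A : L2Z →L[ℂ] L2Z} {f : ℝ → ℝ} (hf : ∀ t ∈ spectrum ℝ A, 0 ≤ f t)
    (x : L2Z) : 0 ≤ (inner ℂ x (cfc f A x)).re := by
  have h : 0 ≤ cfc f A := cfc_nonneg hf
  exact ((ContinuousLinearMap.nonneg_iff_isPositive _).1 h).re_inner_nonneg_right x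

theorem inner_apply_apply_self {A : L2Z →L[ℂ] L2Z} (hA : IsSelfAdjoint A) (x : L2Z) :
    inner ℂ x (A (A x)) = ((‖A x‖ ^ 2 : ℝ) : ℂ) := by
  have h := (ContinuousLinearMap.isSelfAdjoint_iff_isSymmetric.1 hA) x (A x)
  refine h.symm.trans ?_
  simp only [ContinuousLinearMap.coe_coe, inner_self_eq_norm_sq_to_K]
  norm_cast

theorem re_inner_quadratic_add_nonneg {A : L2Z →L[ℂ] L2Z} (hA : IsSelfAdjoint A) {φ : ℝ → ℝ}
    (hφ : Continuous φ) {c₀ c₁ c₂ s : ℝ}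
    (h : ∀ t ∈ spectrum ℝ A, 0 ≤ c₀ + c₁ * t + c₂ * t ^ 2 + s * φ t) (x : L2Z) :
    0 ≤ c₀ * ‖x‖ ^ 2 + c₁ * (inner ℂ x (A x)).re + c₂ * ‖A x‖ ^ 2 +
      s * (inner ℂ x (cfc φ A x)).re := by
  set q : Polynomial ℝ := Polynomial.C c₀ + Polynomial.C c₁ * Polynomial.X +
    Polynomial.C c₂ * Polynomial.X ^ 2 with hq
  have h1 := re_inner_cfc_nonneg (A := A) (f := fun t => q.eval t + s * φ t)
    (fun t ht => by simpa [hq] using h t ht) x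
  rw [cfc_add A q.eval (fun t => s * φ t) q.continuous.continuousOn
    (hφ.const_mul s).continuousOn, cfc_const_mul s φ A hφ.continuousOn, cfc_polynomial q A hA] at h1
  have h2 : Polynomial.aeval A q x = c₀ • x + c₁ • A x + c₂ • A (A x) := by
    simp [hq, Algebra.algebraMap_eq_smul_one, pow_two]
  have h4 : inner ℂ x x = ((‖x‖ ^ 2 : ℝ) : ℂ) := by
    rw [inner_self_eq_norm_sq_to_K]
    norm_cast
  rw [_root_.add_apply, _root_.smul_apply, h2, inner_add_right, inner_add_right, inner_add_right,
    inner_smul_right_eq_smul, inner_smul_right_eq_smul, inner_smul_right_eq_smul,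
    inner_smul_right_eq_smul, inner_apply_apply_self hA, h4] at h1
  simpa only [Complex.add_re, Complex.smul_re, Complex.ofReal_re, smul_eq_mul] using h1

/-- The spectral measure of the unit vector `x` has mean `l`, so the linear term drops out and `(t -
l)²` integrates to `‖A x‖² - l²`. The two signs of the bound are two positive functions of `A`. -/
theorem abs_re_inner_cfc_sub_le {A : L2Z →L[ℂ] L2Z} (hA : IsSelfAdjoint A) {φ : ℝ → ℝ}
    (hφ : Continuous φ) {x : L2Z} (hx : ‖x‖ = 1) {l d κ K : ℝ} (hl : (inner ℂ x (A x)).re = l)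
    (h : ∀ t ∈ spectrum ℝ A, |φ t - φ l - d * (t - l)| ≤ κ + K * (t - l) ^ 2) :
    |(inner ℂ x (cfc φ A x)).re - φ l| ≤ κ + K * (‖A x‖ ^ 2 - l ^ 2) := by
  -- The coefficients of `κ + K (t - l)² - (φ t - φ l - d (t - l))`; the next application has the
  -- other sign.
  have h1 := re_inner_quadratic_add_nonneg hA hφ (c₀ := κ + K * l ^ 2 + φ l - d * l)
    (c₁ := -(2 * K * l) + d) (c₂ := K) (s := -1)
    (fun t ht => by linarith [(abs_le.1 (h t ht)).2]) x
  have h2 := re_inner_quadratic_add_nonneg hA hφ (c₀ := κ + K * l ^ 2 - φ l + d * l)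
    (c₁ := -(2 * K * l) - d) (c₂ := K) (s := 1)
    (fun t ht => by linarith [(abs_le.1 (h t ht)).1]) x
  rw [hx, hl] at h1 h2
  rw [abs_le]
  constructor <;> nlinarith

/-- The vector of `ℓ²(ℤ)` supported in `[-M, M]` with the given coordinates there. -/
def boxVec (M : ℕ) (v : Finset.Icc (-(M : ℤ)) M → ℂ) : L2Z := ∑ j, v j • basisVec j

theorem inner_boxVec (M : ℕ) (v : Finset.Icc (-(M : ℤ)) M → ℂ) (T : L2Z →L[ℂ] L2Z) :
    inner ℂ (boxVec M v) (T (boxVec M v)) =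
      ∑ j : Finset.Icc (-(M : ℤ)) M, ∑ k : Finset.Icc (-(M : ℤ)) M,
        (starRingEnd ℂ) (v j) * entry T j k * v k := by
  rw [boxVec, map_sum, sum_inner]
  refine Finset.sum_congr rfl fun j _ => ?_
  rw [inner_sum]
  refine Finset.sum_congr rfl fun k _ => ?_
  rw [inner_smul_left, map_smul, inner_smul_right, ← entry_eq_inner]
  ring

theorem inner_boxVec_col (M : ℕ)
    (U : Matrix (Finset.Icc (-(M : ℤ)) M) (Finset.Icc (-(M : ℤ)) M) ℂ) (T : L2Z →L[ℂ] L2Z)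
    (i : Finset.Icc (-(M : ℤ)) M) :
    inner ℂ (boxVec M fun j => U j i) (T (boxVec M fun j => U j i)) =
      (star U * restriction T M * U) i i := by
  rw [inner_boxVec, Matrix.mul_apply]
  simp_rw [Matrix.mul_apply, Finset.sum_mul]
  rw [Finset.sum_comm]
  rfl

theorem isHermitian_restriction {A : L2Z →L[ℂ] L2Z} (hA : IsSelfAdjoint A) (M : ℕ) :
    (restriction A M).IsHermitian := by
  ext j k
  exact entry_conj hA k j

theorem restriction_one (M : ℕ) : restriction 1 M = 1 := by
  ext j k
  rw [restriction, Matrix.of_apply, Matrix.one_apply]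
  simp only [entry, one_apply_eq_self, coord_basisVec, Subtype.ext_iff]

theorem trace_restriction (T : L2Z →L[ℂ] L2Z) (M : ℕ) :
    (restriction T M).trace = ∑ j ∈ Finset.Icc (-(M : ℤ)) M, entry T j j := by
  rw [Matrix.trace, ← Finset.sum_coe_sort _ fun j => entry T j j]
  rfl

section

variable {A : L2Z →L[ℂ] L2Z} (hA : IsSelfAdjoint A) (M : ℕ)

include hA

theorem star_eigenvectorUnitary_mul_mul :
    star ((isHermitian_restriction hA M).eigenvectorUnitary : Matrix _ _ ℂ) * restriction A M *
      ((isHermitian_restriction hA M).eigenvectorUnitary : Matrix _ _ ℂ) =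
      Matrix.diagonal fun i => ((isHermitian_restriction hA M).eigenvalues i : ℂ) := by
  have := (isHermitian_restriction hA M).conjStarAlgAut_star_eigenvectorUnitary
  rwa [Unitary.conjStarAlgAut_star_apply] at this

omit hA in
theorem norm_boxVec_col {U : Matrix (Finset.Icc (-(M : ℤ)) M) (Finset.Icc (-(M : ℤ)) M) ℂ}
    (hU : star U * U = 1) (i : Finset.Icc (-(M : ℤ)) M) : ‖boxVec M fun j => U j i‖ = 1 := by
  have h1 := inner_boxVec_col M U 1 i
  rw [restriction_one, mul_one, hU, Matrix.one_apply_eq, one_apply_eq_self,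
    inner_self_eq_norm_sq_to_K] at h1
  have h2 : ‖boxVec M fun j => U j i‖ ^ 2 = 1 := Complex.ofReal_injective (by push_cast; exact h1)
  exact (pow_eq_one_iff_of_nonneg (norm_nonneg _) two_ne_zero).1 h2

theorem abs_eigenvalues_restriction_le (i : Finset.Icc (-(M : ℤ)) M) :
    |(isHermitian_restriction hA M).eigenvalues i| ≤ ‖A‖ := by
  have hH := isHermitian_restriction hA M
  have hn := norm_boxVec_col M (Unitary.coe_star_mul_self hH.eigenvectorUnitary) i
  have h1 := inner_boxVec_col M hH.eigenvectorUnitary A i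
  rw [star_eigenvectorUnitary_mul_mul hA, Matrix.diagonal_apply_eq] at h1
  have h2 := congrArg norm h1
  rw [Complex.norm_real, Real.norm_eq_abs] at h2
  rw [← h2]
  refine (norm_inner_le_norm _ _).trans ?_
  have := A.le_opNorm (boxVec M fun j => (hH.eigenvectorUnitary : Matrix _ _ ℂ) j i)
  rw [hn, mul_one] at this
  rwa [hn, one_mul]

theorem re_trace_cfc_restriction (φ : ℝ → ℝ) : (Matrix.trace (cfc φ (restriction A M))).re =
    ∑ i, φ ((isHermitian_restriction hA M).eigenvalues i) := by
  have hH := isHermitian_restriction hA M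
  rw [hH.cfc_eq, Matrix.IsHermitian.cfc, Unitary.conjStarAlgAut_apply, Matrix.trace_mul_cycle,
    Unitary.coe_star_mul_self, one_mul, Matrix.trace_diagonal, Complex.re_sum]
  exact Finset.sum_congr rfl fun i _ => Complex.ofReal_re _

/-- The trace of `φ(A_Λ)` against the trace of `φ(A)` over `Λ`. -/
theorem abs_trace_cfc_restriction_sub_le {φ φ' : ℝ → ℝ} (hφ : Continuous φ) {κ K : ℝ}
    (h : ∀ l t, |l| ≤ ‖A‖ → |t| ≤ ‖A‖ → |φ t - φ l - φ' l * (t - l)| ≤ κ + K * (t - l) ^ 2) :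
    |(Matrix.trace (cfc φ (restriction A M))).re -
        ∑ j ∈ Finset.Icc (-(M : ℤ)) M, (entry (cfc φ A) j j).re| ≤
      (2 * M + 1) * κ + K * (∑ j ∈ Finset.Icc (-(M : ℤ)) M, (entry (A * A) j j).re -
        ∑ j ∈ Finset.Icc (-(M : ℤ)) M, ∑ k ∈ Finset.Icc (-(M : ℤ)) M, ‖entry A j k‖ ^ 2) := by
  have hH := isHermitian_restriction hA M
  set U : Matrix (Finset.Icc (-(M : ℤ)) M) (Finset.Icc (-(M : ℤ)) M) ℂ :=
    ↑hH.eigenvectorUnitary with hU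
  have hUU : star U * U = 1 := Unitary.coe_star_mul_self hH.eigenvectorUnitary
  have hUU' : U * star U = 1 := Unitary.coe_mul_star_self hH.eigenvectorUnitary
  set l := hH.eigenvalues with hl
  have hD : star U * restriction A M * U = Matrix.diagonal fun i => (l i : ℂ) :=
    star_eigenvectorUnitary_mul_mul hA M
  -- The eigenvectors of the restriction, extended by zero. The quadratic form of `A` at `x i` is
  -- the eigenvalue `l i`, while `φ(A)` sees the whole operator.
  set x : Finset.Icc (-(M : ℤ)) M → L2Z := fun i => boxVec M fun j => U j i with hx
  have hinner : ∀ T i, inner ℂ (x i) (T (x i)) = (star U * restriction T M * U) i i :=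
    fun T i => inner_boxVec_col M U T i
  have htr : ∀ T : L2Z →L[ℂ] L2Z, ∑ i, inner ℂ (x i) (T (x i)) =
      ∑ j ∈ Finset.Icc (-(M : ℤ)) M, entry T j j := fun T => by
    rw [← trace_restriction]
    simp_rw [hinner]
    change Matrix.trace (star U * restriction T M * U) = _
    rw [Matrix.trace_mul_cycle, hUU', one_mul]
  have hnorm : ∀ i, ‖x i‖ = 1 := norm_boxVec_col M hUU
  have hlx : ∀ i, (inner ℂ (x i) (A (x i))).re = l i := fun i => by
    rw [hinner, hD, Matrix.diagonal_apply_eq, Complex.ofReal_re]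
  have hlA : ∀ i, |l i| ≤ ‖A‖ := abs_eigenvalues_restriction_le hA M
  have hcfc := re_trace_cfc_restriction hA M φ
  have hsq : ∑ i, ‖A (x i)‖ ^ 2 = ∑ j ∈ Finset.Icc (-(M : ℤ)) M, (entry (A * A) j j).re := by
    rw [← Complex.re_sum, ← htr, Complex.re_sum]
    refine Finset.sum_congr rfl fun i _ => ?_
    rw [mul_apply_eq_comp, inner_apply_apply_self hA, Complex.ofReal_re]
  -- The Hilbert–Schmidt norm of the restriction. Subtracted from `∑ ‖A x_i‖²`, it leaves the
  -- squared entries leading out of the box.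
  have hlsq : ∑ i, l i ^ 2 = ∑ j ∈ Finset.Icc (-(M : ℤ)) M, ∑ k ∈ Finset.Icc (-(M : ℤ)) M,
      ‖entry A j k‖ ^ 2 := by
    have h1 : Matrix.trace (restriction A M * restriction A M) = ∑ i, (l i : ℂ) ^ 2 := by
      have h2 : Matrix.trace ((star U * restriction A M * U) * (star U * restriction A M * U)) =
          Matrix.trace (restriction A M * restriction A M) := by
        rw [show (star U * restriction A M * U) * (star U * restriction A M * U) =
          star U * (restriction A M * restriction A M) * U by
            rw [mul_assoc, ← mul_assoc U, ← mul_assoc U, hUU', one_mul]; simp only [mul_assoc],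
          Matrix.trace_mul_cycle, hUU', one_mul]
      rw [← h2, hD, Matrix.diagonal_mul_diagonal, Matrix.trace_diagonal]
      exact Finset.sum_congr rfl fun i _ => (pow_two _).symm
    have h3 : Matrix.trace (restriction A M * restriction A M) =
        ∑ j ∈ Finset.Icc (-(M : ℤ)) M, ∑ k ∈ Finset.Icc (-(M : ℤ)) M,
          ((‖entry A j k‖ ^ 2 : ℝ) : ℂ) := by
      rw [Matrix.trace, ← Finset.sum_coe_sort _ fun j => ∑ k ∈ Finset.Icc (-(M : ℤ)) M,
        ((‖entry A j k‖ ^ 2 : ℝ) : ℂ)]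
      refine Finset.sum_congr rfl fun j _ => ?_
      rw [Matrix.diag_apply, Matrix.mul_apply, ← Finset.sum_coe_sort _ fun k =>
        ((‖entry A j k‖ ^ 2 : ℝ) : ℂ)]
      refine Finset.sum_congr rfl fun k _ => ?_
      change entry A j k * entry A k j = _
      rw [← entry_conj hA j k, Complex.mul_conj, Complex.normSq_eq_norm_sq]
    have h4 := h1.symm.trans h3
    exact_mod_cast h4
  have hmain : ∀ i, |(inner ℂ (x i) (cfc φ A (x i))).re - φ (l i)| ≤
      κ + K * (‖A (x i)‖ ^ 2 - l i ^ 2) := fun i =>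
    abs_re_inner_cfc_sub_le hA hφ (hnorm i) (hlx i) fun t ht =>
      h (l i) t (hlA i) (spectrum.norm_le_norm_of_mem ht)
  rw [hcfc, ← Complex.re_sum, ← htr, Complex.re_sum, abs_sub_comm, ← Finset.sum_sub_distrib]
  refine (Finset.abs_sum_le_sum_abs _ _).trans ((Finset.sum_le_sum fun i _ => hmain i).trans ?_)
  rw [Finset.sum_add_distrib, ← Finset.mul_sum, Finset.sum_sub_distrib, hsq, hlsq,
    Finset.sum_const, Finset.card_univ, Fintype.card_coe, Int.card_Icc, nsmul_eq_mul]
  refine (add_le_add_left ?_ _)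
  have : ((M : ℤ) + 1 - -M).toNat = 2 * M + 1 := by omega
  rw [this]
  push_cast
  rfl

end

theorem sum_Icc_sub_natAbs_le {β : ℕ → ℝ} (hβ0 : ∀ m, 0 ≤ β m) (hβ : Summable β) (M : ℕ) :
    ∑ j ∈ Finset.Icc (-(M : ℤ)) M, β (M - j.natAbs) ≤ 2 * ∑' m, β m := by
  have h1 : ∑ j ∈ Finset.Icc (-(M : ℤ)) M, β (j + M).toNat ≤ ∑' m, β m := by
    rw [← sum_range_sub_eq_sum_Icc (fun j => β (j + M).toNat)]
    simp only [sub_add_cancel, Int.toNat_natCast]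
    exact hβ.sum_le_tsum _ fun m _ => hβ0 m
  have h2 : ∑ j ∈ Finset.Icc (-(M : ℤ)) M, β (M - j).toNat ≤ ∑' m, β m := by
    refine le_trans (le_of_eq ?_) h1
    refine Finset.sum_bij (fun j _ => -j) (fun j hj => ?_) (fun i _ j _ h => neg_injective h)
      (fun j hj => ⟨-j, ?_, neg_neg j⟩) fun j _ => ?_
    · rw [Finset.mem_Icc] at *
      omega
    · rw [Finset.mem_Icc] at *
      omega
    · congr 2
      ring
  rw [two_mul]
  refine le_trans ?_ (add_le_add h1 h2)
  rw [← Finset.sum_add_distrib]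
  refine Finset.sum_le_sum fun j hj => ?_
  rw [Finset.mem_Icc] at hj
  rcases le_total 0 j with h | h
  · rw [show M - j.natAbs = (M - j).toNat by omega]
    linarith [hβ0 (j + M).toNat]
  · rw [show M - j.natAbs = (j + M).toNat by omega]
    linarith [hβ0 (M - j).toNat]

theorem summable_natAbs_sub_one {β : ℕ → ℝ} (hβ : Summable β) :
    Summable fun k : ℤ => β (k.natAbs - 1) := by
  refine Summable.of_nat_of_neg ?_ ?_
  · refine (summable_nat_add_iff 1).1 ?_
    simpa [Int.natAbs_add_of_nonneg] using hβ
  · refine (summable_nat_add_iff 1).1 ?_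
    refine hβ.congr fun n => ?_
    rw [Int.natAbs_neg, Int.natAbs_natCast, Nat.add_sub_cancel]

/-- What remains is the sum of `|A_jk|²` over `j` inside and `k` outside the box. One factor is
bounded through the distance from `j` to the boundary, the other through `|k - j|`; both are
summable, so the total stays bounded in `M`. -/
theorem sum_norm_sq_entry_le {A : L2Z →L[ℂ] L2Z} (hA : IsSelfAdjoint A) {β : ℕ → ℝ}
    (hβ0 : ∀ m, 0 ≤ β m) (hβ : Summable β)
    (h : ∀ (m : ℕ) (i a : ℤ), (m : ℤ) < |i - a| → ‖entry A i a‖ ≤ β m) (M : ℕ) :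
    ∑ j ∈ Finset.Icc (-(M : ℤ)) M, (entry (A * A) j j).re -
        ∑ j ∈ Finset.Icc (-(M : ℤ)) M, ∑ k ∈ Finset.Icc (-(M : ℤ)) M, ‖entry A j k‖ ^ 2 ≤
      2 * (∑' m, β m) * ∑' k : ℤ, β (k.natAbs - 1) := by
  set Z := ∑' k : ℤ, β (k.natAbs - 1) with hZ
  have hZ0 : 0 ≤ Z := tsum_nonneg fun _ => hβ0 _
  have hrow : ∀ j ∈ Finset.Icc (-(M : ℤ)) M, (entry (A * A) j j).re -
      ∑ k ∈ Finset.Icc (-(M : ℤ)) M, ‖entry A j k‖ ^ 2 ≤ β (M - j.natAbs) * Z := by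
    intro j hj
    rw [Finset.mem_Icc] at hj
    have hs : HasSum (fun k => ‖entry A j k‖ ^ 2) (entry (A * A) j j).re := by
      have hre : (fun k => ‖entry A j k‖ ^ 2) = fun k => (entry A j k * entry A k j).re := by
        ext k
        rw [← entry_conj hA j k, Complex.mul_conj, Complex.normSq_eq_norm_sq, Complex.ofReal_re]
      rw [hre]
      exact Complex.hasSum_re (hasSum_entry_mul A A j j)
    have hsZ : HasSum (fun k : ℤ => β (M - j.natAbs) * β ((k - j).natAbs - 1))
        (β (M - j.natAbs) * Z) := by
      refine HasSum.mul_left _ ?_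
      exact (Equiv.subRight j).hasSum_iff (f := fun k : ℤ => β (k.natAbs - 1)) |>.2
        (summable_natAbs_sub_one hβ).hasSum
    have hs' : HasSum (fun k => ‖entry A j k‖ ^ 2 -
        if k ∈ Finset.Icc (-(M : ℤ)) M then ‖entry A j k‖ ^ 2 else 0)
        ((entry (A * A) j j).re - ∑ k ∈ Finset.Icc (-(M : ℤ)) M, ‖entry A j k‖ ^ 2) := by
      refine hs.sub ?_
      have := hasSum_sum_of_ne_finset_zero (L := .unconditional ℤ) (s := Finset.Icc (-(M : ℤ)) M)
        (f := fun k => if k ∈ Finset.Icc (-(M : ℤ)) M then ‖entry A j k‖ ^ 2 else 0)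
        fun k hk => if_neg hk
      rwa [Finset.sum_congr rfl fun k hk => if_pos hk] at this
    refine hasSum_le (fun k => ?_) hs' hsZ
    split_ifs with hk
    · rw [sub_self]
      exact mul_nonneg (hβ0 _) (hβ0 _)
    · rw [Finset.mem_Icc] at hk
      rw [sub_zero, pow_two]
      have h1 : ‖entry A j k‖ ≤ β (M - j.natAbs) := h _ _ _ (by
        rw [← Int.natCast_natAbs]
        omega)
      have h2 : ‖entry A j k‖ ≤ β ((k - j).natAbs - 1) := h _ _ _ (by
        rw [← Int.natCast_natAbs]
        omega)
      exact mul_le_mul h1 h2 (norm_nonneg _) (hβ0 _)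
  rw [← Finset.sum_sub_distrib]
  refine (Finset.sum_le_sum hrow).trans ?_
  rw [← Finset.sum_mul]
  exact mul_le_mul_of_nonneg_right (sum_Icc_sub_natAbs_le hβ0 hβ M) hZ0

/-- A `C^1` function has remainder at most `ε |t - l|` for close points, which is split by `ε z ≤ ε
η / 2 + ε z² / (2 η)`. Distant points are absorbed by `C`, which must not depend on `η`. -/
theorem exists_taylor_bound {φ φ' : ℝ → ℝ} (hφ' : Continuous φ')
    (hφ : ∀ x, HasDerivAt φ (φ' x) x) (R : ℝ) {ε : ℝ} (hε : 0 < ε) :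
    ∃ C, 0 ≤ C ∧ ∀ η > 0, ∀ l t, |l| ≤ R → |t| ≤ R →
      |φ t - φ l - φ' l * (t - l)| ≤ ε * η / 2 + (ε / (2 * η) + C) * (t - l) ^ 2 := by
  obtain ⟨L, hL0, hL⟩ := exists_abs_le_of_continuous hφ' R
  have huc := (isCompact_Icc (a := -R) (b := R)).uniformContinuousOn_of_continuous
    hφ'.continuousOn
  obtain ⟨δ, hδ, hδ'⟩ := Metric.uniformContinuousOn_iff.1 huc ε hε
  refine ⟨2 * L / δ, by positivity, fun η hη l t hl ht => ?_⟩
  have hseg : ∀ y ∈ Set.uIcc l t, |y| ≤ R := fun y hy =>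
    abs_le.2 (Set.uIcc_subset_Icc (abs_le.1 hl) (abs_le.1 ht) hy)
  have hmv : ∀ c, (∀ y ∈ Set.uIcc l t, |φ' y - φ' l| ≤ c) →
      |φ t - φ l - φ' l * (t - l)| ≤ c * |t - l| := fun c hc => by
    have := (convex_uIcc l t).norm_image_sub_le_of_norm_hasDerivWithin_le
      (f := fun y => φ y - φ' l * y) (f' := fun y => φ' y - φ' l) (C := c) (x := l) (y := t)
      (fun y _ => ((hφ y).sub (by simpa using (hasDerivAt_id y).const_mul (φ' l))).hasDerivWithinAt)
      hc Set.left_mem_uIcc Set.right_mem_uIcc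
    rw [Real.norm_eq_abs, Real.norm_eq_abs] at this
    convert this using 2
    ring
  have hsq : (t - l) ^ 2 = |t - l| ^ 2 := (sq_abs _).symm
  rw [hsq]
  set z := |t - l| with hz
  have hz0 : 0 ≤ z := abs_nonneg _
  have hamgm : ε * z ≤ ε * η / 2 + ε / (2 * η) * z ^ 2 := by
    have h1 : ε * η / 2 + ε / (2 * η) * z ^ 2 - ε * z = ε / (2 * η) * (η - z) ^ 2 := by
      field_simp
      ring
    have h2 : 0 ≤ ε / (2 * η) * (η - z) ^ 2 := by positivity
    linarith
  rcases lt_or_ge z δ with hzδ | hzδ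
  · have h1 := hmv ε fun y hy => by
      have hyl : dist y l < δ := by
        rw [Real.dist_eq]
        exact (Set.abs_sub_left_of_mem_uIcc hy).trans_lt hzδ
      exact (hδ' y (abs_le.1 (hseg y hy)) l (abs_le.1 hl) hyl).le
    have h3 : 0 ≤ 2 * L / δ * z ^ 2 := by positivity
    linarith [add_mul (ε / (2 * η)) (2 * L / δ) (z ^ 2)]
  · have h1 := hmv (2 * L) fun y hy => (abs_sub _ _).trans (by linarith [hL y (hseg y hy), hL l hl])
    have h2 : 2 * L * z ≤ 2 * L / δ * z ^ 2 := by
      rw [div_mul_eq_mul_div, le_div_iff₀ hδ]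
      nlinarith [mul_nonneg hL0 hz0]
    have h3 : 0 ≤ ε * η / 2 := by positivity
    have h4 : 0 ≤ ε / (2 * η) * z ^ 2 := by positivity
    linarith [add_mul (ε / (2 * η)) (2 * L / δ) (z ^ 2)]

/-- The traces of `φ(a_Λ(H))` and of `(φ ∘ a)(H)` over `Λ` differ by `o(|Λ|^{1/2})`, uniformly in
the potential. -/
theorem exists_abs_traceRestr_sub_le {B : ℝ} (hB : 0 ≤ B) {a φ φ' : ℝ → ℝ} (ha : Continuous a)
    (hφ' : Continuous φ') (hφ : ∀ x, HasDerivAt φ (φ' x) x) {β : ℕ → ℝ}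
    (hβ : Summable β) (haβ : PolyRate (2 + B) a β) {ε : ℝ} (hε : 0 < ε) :
    ∃ K, 0 ≤ K ∧ ∀ w : ℤ → ℝ, (∀ j, |w j| ≤ B) → ∀ M : ℕ,
      |traceRestr φ a w M - ∑ j ∈ Finset.Icc (-(M : ℤ)) M, diagEntry (fun x => φ (a x)) w j| ≤
        ε * √(2 * M + 1) + K := by
  have hφc : Continuous φ := continuous_iff_continuousAt.2 fun x => (hφ x).continuousAt
  have hβ0 : ∀ m, 0 ≤ β m := fun m => by
    obtain ⟨p, -, hp⟩ := haβ m
    exact (abs_nonneg _).trans (hp 0 (by rw [abs_zero]; linarith))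
  obtain ⟨c, hc0, hc⟩ := exists_abs_le_of_continuous ha (2 + B)
  set Q := 2 * (∑' m, β m) * ∑' k : ℤ, β (k.natAbs - 1) with hQ
  have hQ0 : 0 ≤ Q := mul_nonneg (mul_nonneg zero_le_two (tsum_nonneg hβ0))
    (tsum_nonneg fun _ => hβ0 _)
  obtain ⟨C, hC0, hC⟩ := exists_taylor_bound hφ' hφ c (div_pos hε (by linarith : 0 < 1 + Q))
  refine ⟨C * Q, mul_nonneg hC0 hQ0, fun w hw M => ?_⟩
  set s := √(2 * (M : ℝ) + 1) with hs
  have hs0 : 0 < s := Real.sqrt_pos.2 (by positivity)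
  have hss : s * s = 2 * (M : ℝ) + 1 := Real.mul_self_sqrt (by positivity)
  set A := cfc a (schrodinger w) with hA
  have hAs : IsSelfAdjoint A := cfc_predicate a _
  have hAn : ‖A‖ ≤ c := norm_cfc_schrodinger_le hw hc0 hc
  -- The choice `η = |Λ|^{-1/2}` balances the volume term `|Λ| ε η` against the boundary term `ε Q /
  -- η`.
  have h1 := abs_trace_cfc_restriction_sub_le hAs M (φ' := φ') hφc fun l t hl ht =>
    hC s⁻¹ (inv_pos.2 hs0) l t (hl.trans hAn) (ht.trans hAn)
  have h2 := sum_norm_sq_entry_le hAs hβ0 hβ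
    (fun m i k hik => haβ.norm_entry_le hw ha hik) M
  have h3 : cfc φ A = cfc (fun x => φ (a x)) (schrodinger w) :=
    (cfc_comp φ a (schrodinger w) (isSelfAdjoint_schrodinger w) hφc.continuousOn
      ha.continuousOn).symm
  rw [h3] at h1
  refine h1.trans ((add_le_add_right (mul_le_mul_of_nonneg_left h2 (by positivity)) _).trans ?_)
  rw [← hQ, ← hss]
  have h5 : s * s * (ε / (1 + Q) * s⁻¹ / 2) + (ε / (1 + Q) / (2 * s⁻¹) + C) * Q =
      ε * s / 2 + C * Q := by
    have : 1 + Q ≠ 0 := by positivity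
    field_simp
    ring
  rw [h5]
  have : 0 ≤ ε * s := by positivity
  linarith


/-! ### The non-random spectrum -/

section Recurrence

variable {μ : Measure ℝ} [IsProbabilityMeasure μ]

theorem integral_prod_translate {G : (ℤ → ℝ) → ℝ} (hG : BddMeas G) {L : ℕ}
    (hGL : DependsOn G (Set.Ico 0 (L : ℤ))) (K : ℕ) :
    ∫ w, ∏ i ∈ Finset.range K, G (translate (i * L : ℕ) w) ∂(iid μ) =
      (∫ w, G w ∂(iid μ)) ^ K := by
  induction K with
  | zero => simp
  | succ K ih =>
    have hm : ∀ n : ℤ, Measurable fun w => G (translate n w) := fun n =>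
      hG.measurable.comp (measurable_translate n)
    simp_rw [Finset.prod_range_succ]
    rw [integral_mul_of_dependsOn (I := Set.Iio ((K * L : ℕ) : ℤ))
      (Finset.measurable_fun_prod _ fun i _ => hm _) (hm _), ih, integral_translate hG.measurable, pow_succ]
    · intro w w' h
      refine Finset.prod_congr rfl fun i hi => hGL fun j hj => h _ ?_
      have hi' := Finset.mem_range.1 hi
      have : i * L + L ≤ K * L := by nlinarith
      rw [Set.mem_Iio]
      have := hj.2
      push_cast at *
      linarith
    · intro w w' h
      refine hGL fun j hj => h _ ?_
      have := hj.1
      simp only [Set.mem_compl_iff, Set.mem_Iio, not_lt]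
      linarith

/-- Translates by multiples of `L` give independent trials, so missing `E` in `K` of them has
probability `(1 - P(E))^K`. -/
theorem ae_exists_translate_mem {E : Set (ℤ → ℝ)} (hE : MeasurableSet E) {L : ℕ}
    (hEL : ∀ w w' : ℤ → ℝ, (∀ i ∈ Set.Ico 0 (L : ℤ), w i = w' i) → w ∈ E → w' ∈ E)
    (hpos : 0 < iid μ E) : ∀ᵐ w ∂(iid μ), ∃ n : ℤ, translate n w ∈ E := by
  set G : (ℤ → ℝ) → ℝ := Eᶜ.indicator fun _ => 1 with hG
  have hGb : BddMeas G := ⟨measurable_const.indicator hE.compl, 1, fun w => by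
    by_cases h : w ∈ Eᶜ <;> simp [hG, h]⟩
  have hGL : DependsOn G (Set.Ico 0 (L : ℤ)) := fun w w' h => by
    have : w ∈ E ↔ w' ∈ E := ⟨hEL w w' h, hEL w' w fun i hi => (h i hi).symm⟩
    by_cases hw : w ∈ E
    · simp [hG, hw, this.1 hw]
    · simp [hG, hw, mt this.2 hw]
  have hlt : ∫ w, G w ∂(iid μ) < 1 := by
    rw [hG, integral_indicator_const _ hE.compl, smul_eq_mul, mul_one, probReal_compl_eq_one_sub hE]
    have : 0 < (iid μ).real E := ENNReal.toReal_pos hpos.ne' (measure_ne_top _ _)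
    linarith
  have h0 : 0 ≤ ∫ w, G w ∂(iid μ) := integral_nonneg fun w => by
    by_cases h : w ∈ Eᶜ <;> simp [hG, h]
  set N : Set (ℤ → ℝ) := {w | ¬ ∃ n : ℤ, translate n w ∈ E} with hN
  have hNm : MeasurableSet N := by
    have : N = ⋂ n : ℤ, translate n ⁻¹' Eᶜ := by
      ext w
      simp [hN]
    rw [this]
    exact MeasurableSet.iInter fun n => measurable_translate n hE.compl
  have hle : ∀ K : ℕ, (iid μ).real N ≤ (∫ w, G w ∂(iid μ)) ^ K := fun K => by
    rw [← integral_prod_translate hGb hGL, ← integral_indicator_one hNm]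
    have hGt : ∀ w n, 0 ≤ G (translate n w) := fun w n => by
      by_cases h : translate n w ∈ Eᶜ <;> simp [hG, h]
    have hbm : BddMeas fun w => ∏ i ∈ Finset.range K, G (translate (i * L : ℕ) w) := by
      induction K with
      | zero => simpa using BddMeas.const 1
      | succ K ih =>
        simp_rw [Finset.prod_range_succ]
        exact ih.mul (hGb.comp (measurable_translate _))
    refine integral_mono ((integrable_const (1 : ℝ)).indicator hNm) (hbm.integrable _) fun w => ?_
    by_cases hw : w ∈ N
    · rw [Set.indicator_of_mem hw]
      refine le_of_eq (Finset.prod_eq_one fun i _ => ?_).symm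
      have : translate (i * L : ℕ) w ∈ Eᶜ := fun h => hw ⟨_, h⟩
      rw [hG, Set.indicator_of_mem this]
    · rw [Set.indicator_of_notMem hw]
      exact Finset.prod_nonneg fun i _ => hGt w _
  have hzero : (iid μ).real N ≤ 0 :=
    ge_of_tendsto' (tendsto_pow_atTop_nhds_zero_of_lt_one h0 hlt) hle
  have hz : (iid μ).real N = 0 := le_antisymm hzero measureReal_nonneg
  rwa [measureReal_eq_zero_iff] at hz

/-- Almost every configuration comes, after a translation, arbitrarily close to any configuration
with values in the support. -/
theorem ae_exists_translate_mem_nhds (μ : Measure ℝ) [IsProbabilityMeasure μ] :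
    ∀ᵐ w' ∂(iid μ), ∀ w : ℤ → ℝ, (∀ j, w j ∈ μ.support) →
      ∀ U ∈ 𝓝 w, ∃ n : ℤ, translate n w' ∈ U := by
  have hbase : ∀ U ∈ TopologicalSpace.countableBasis (ℤ → ℝ),
      ∀ᵐ w' ∂(iid μ), (∃ w ∈ U, ∀ j, w j ∈ μ.support) → ∃ n : ℤ, translate n w' ∈ U := by
    intro U hU
    by_cases hne : ∃ w ∈ U, ∀ j, w j ∈ μ.support
    swap
    · exact ae_of_all _ fun w' h => absurd h hne
    obtain ⟨w, hwU, hw⟩ := hne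
    obtain ⟨I, u, hu, hIu⟩ := isOpen_pi_iff.1
      ((TopologicalSpace.isBasis_countableBasis _).isOpen hU) w hwU
    obtain ⟨m, hm⟩ : ∃ m : ℕ, ∀ i ∈ I, i.natAbs ≤ m := ⟨I.sup Int.natAbs, fun i hi =>
      Finset.le_sup (f := Int.natAbs) hi⟩
    have hmeas : MeasurableSet ((I : Set ℤ).pi u) :=
      MeasurableSet.pi I.countable_toSet fun i hi => (hu i hi).1.measurableSet
    have hpos : 0 < iid μ ((I : Set ℤ).pi u) := by
      rw [Measure.infinitePi_pi _ fun i hi => (hu i hi).1.measurableSet]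
      exact pos_iff_ne_zero.2 (Finset.prod_ne_zero_iff.2 fun i hi =>
        ((Measure.mem_support_iff_forall _).1 (hw i) _ ((hu i hi).1.mem_nhds (hu i hi).2)).ne')
    -- The translation by `m` moves the window `[-m, m]` to `[0, 2m + 1)`.
    have h := ae_exists_translate_mem (E := translate m ⁻¹' ((I : Set ℤ).pi u))
      (measurable_translate m hmeas) (L := 2 * m + 1) (fun z z' hz hzE i hi => ?_) (by
        rwa [(measurePreserving_translate μ m).measure_preimage hmeas.nullMeasurableSet])
    · filter_upwards [h] with w' hw' _
      obtain ⟨n, hn⟩ := hw'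
      refine ⟨m + n, hIu ?_⟩
      rwa [Set.mem_preimage, translate_translate] at hn
    · have := hm i hi
      rw [translate, ← hz]
      · exact hzE i hi
      · rw [Set.mem_Ico]
        push_cast
        omega
  have hall := (ae_ball_iff (TopologicalSpace.countable_countableBasis (ℤ → ℝ))).2 hbase
  filter_upwards [hall] with w' hw' w hw U hU
  obtain ⟨U', hU', hwU', hU'U⟩ :=
    (TopologicalSpace.isBasis_countableBasis (ℤ → ℝ)).mem_nhds_iff.1 hU
  obtain ⟨n, hn⟩ := hw' U' hU' ⟨w, hwU', hw⟩
  exact ⟨n, hU'U hn⟩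

theorem ae_forall_mem_support (μ : Measure ℝ) [IsProbabilityMeasure μ] :
    ∀ᵐ w ∂(iid μ), ∀ j, w j ∈ μ.support := by
  rw [ae_all_iff]
  intro j
  exact (measurePreserving_eval_infinitePi (fun _ : ℤ => μ) j).quasiMeasurePreserving.ae
    μ.support_mem_ae

end Recurrence

theorem eq_zero_of_entry_eq_zero {A : L2Z →L[ℂ] L2Z} (hA : IsSelfAdjoint A)
    (h : ∀ j k, entry A j k = 0) : A = 0 := by
  have hb : ∀ k, A (basisVec k) = 0 := fun k => ext_coord fun j => h j k
  refine ContinuousLinearMap.ext fun u => ext_coord fun j => ?_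
  have h1 := (ContinuousLinearMap.isSelfAdjoint_iff_isSymmetric.1 hA) (basisVec j) u
  simp only [ContinuousLinearMap.coe_coe, hb, inner_zero_left] at h1
  rw [← inner_basisVec_left, ← h1]
  rfl

theorem eqOn_zero_of_cfc_eq_zero {A : L2Z →L[ℂ] L2Z} (hA : IsSelfAdjoint A) {f : ℝ → ℝ}
    (hf : Continuous f) (h : cfc f A = 0) : ∀ x ∈ spectrum ℝ A, f x = 0 := by
  intro x hx
  have h1 := cfc_map_spectrum f A hA hf.continuousOn
  rw [h, spectrum.zero_eq] at h1
  have h2 : f x ∈ f '' spectrum ℝ A := ⟨x, hx, rfl⟩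
  rwa [← h1] at h2

/-- Let `f` be the distance to the spectrum of `H_{w'}`. Then `f` vanishes on `H_{w'}` and on all
its translates, hence, by strong continuity of the entries, on `H_w`. -/
theorem spectrum_subset_of_translate_mem_nhds {w w' : ℤ → ℝ} {B : ℝ} (hw : ∀ j, |w j| ≤ B)
    (hw' : ∀ j, |w' j| ≤ B) (h : ∀ U ∈ 𝓝 w, ∃ n : ℤ, translate n w' ∈ U) :
    spectrum ℝ (schrodinger w) ⊆ spectrum ℝ (schrodinger w') := by
  have hB : 0 ≤ B := (abs_nonneg _).trans (hw 0)
  intro x hx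
  by_contra hx'
  set s := spectrum ℝ (schrodinger w') with hs
  have hsc : IsClosed s := spectrum.isClosed _
  have hsn : s.Nonempty := ContinuousFunctionalCalculus.spectrum_nonempty (R := ℝ) _
    (isSelfAdjoint_schrodinger w')
  have hfc : Continuous fun y => Metric.infDist y s := Metric.continuous_infDist_pt s
  have h0 : cfc (fun y => Metric.infDist y s) (schrodinger w') = 0 := by
    rw [cfc_congr (g := fun _ => 0) fun y hy => Metric.infDist_zero_of_mem hy, cfc_const_zero]
  have h1 : cfc (fun y => Metric.infDist y s) (schrodinger w) = 0 := by
    refine eq_zero_of_entry_eq_zero (cfc_predicate _ _) fun j k => ?_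
    have hc := continuous_entry_cfc_clamp hB hfc j k
    by_contra hne
    have hU := hc.continuousAt.eventually_ne (x := w) (y := 0) (by rwa [clamp_of_abs_le hw])
    obtain ⟨n, hn⟩ := h _ hU
    refine hn ?_
    rw [clamp_of_abs_le (w := translate n w') fun i => hw' _, entry_cfc_translate hw' hfc, h0]
    rfl
  have h2 := eqOn_zero_of_cfc_eq_zero (isSelfAdjoint_schrodinger w) hfc h1 x hx
  exact hx' ((hsc.mem_iff_infDist_zero hsn).2 h2)

section Random

variable {Ω : Type*} [MeasurableSpace Ω] {P : Measure Ω} {V : ℤ → Ω → ℝ}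
  {μ : Measure ℝ} {B : ℝ}

theorem ae_spectrum_subset [IsProbabilityMeasure μ] (hV : ∀ j, Measurable (V j))
    (hmap : P.map (pot V) = iid μ)
    (hB : ∀ j ω, |V j ω| ≤ B) (hS : μ.support ⊆ Set.Icc (-B) B) :
    ∀ᵐ ω ∂P, ∀ w : ℤ → ℝ, (∀ j, w j ∈ μ.support) →
      spectrum ℝ (schrodinger w) ⊆ spectrum ℝ (schrodinger (pot V ω)) := by
  have h := ae_exists_translate_mem_nhds μ
  rw [← hmap] at h
  filter_upwards [ae_of_ae_map (measurable_pot hV).aemeasurable h] with ω hω w hw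
  exact spectrum_subset_of_translate_mem_nhds (fun j => abs_le.2 (hS (hw j))) (fun j => hB j ω)
    (hω w hw)

theorem ae_pot_mem_support [IsProbabilityMeasure μ] (hV : ∀ j, Measurable (V j))
    (hmap : P.map (pot V) = iid μ) :
    ∀ᵐ ω ∂P, ∀ j, pot V ω j ∈ μ.support := by
  have h := ae_forall_mem_support μ
  rw [← hmap] at h
  exact ae_of_ae_map (measurable_pot hV).aemeasurable h

theorem spectrum_subset_detSpectrum [IsProbabilityMeasure μ] (hV : ∀ j, Measurable (V j))
    (hmap : P.map (pot V) = iid μ)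
    (hB : ∀ j ω, |V j ω| ≤ B) (hS : μ.support ⊆ Set.Icc (-B) B) {w : ℤ → ℝ}
    (hw : ∀ j, w j ∈ μ.support) : spectrum ℝ (schrodinger w) ⊆ detSpectrum P V := fun x hx => by
  filter_upwards [ae_spectrum_subset hV hmap hB hS] with ω hω
  exact hω w hw hx

/-- Almost every realization takes values in the support and approaches every other such realization
after translations, so two typical spectra contain each other. -/
theorem ae_spectrum_eq_detSpectrum [IsProbabilityMeasure P] [IsProbabilityMeasure μ]
    (hV : ∀ j, Measurable (V j)) (hmap : P.map (pot V) = iid μ)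
    (hB : ∀ j ω, |V j ω| ≤ B) (hS : μ.support ⊆ Set.Icc (-B) B) :
    ∀ᵐ ω ∂P, spectrum ℝ (schrodinger (pot V ω)) = detSpectrum P V := by
  filter_upwards [ae_spectrum_subset hV hmap hB hS, ae_pot_mem_support hV hmap] with ω hω hωS
  refine (spectrum_subset_detSpectrum hV hmap hB hS hωS).antisymm fun x hx => ?_
  obtain ⟨ω', hω', hxω'⟩ := ((ae_pot_mem_support hV hmap).and hx).exists
  exact hω _ hω' hxω'

theorem support_subset_Icc (hV : ∀ j, Measurable (V j)) (hmap : P.map (V 0) = μ)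
    (hB : ∀ j ω, |V j ω| ≤ B) : μ.support ⊆ Set.Icc (-B) B := by
  refine Measure.support_subset_of_isClosed isClosed_Icc ?_
  rw [← hmap, mem_ae_map_iff (hV 0).aemeasurable measurableSet_Icc]
  exact Filter.univ_mem' fun ω => abs_le.1 (hB 0 ω)

end Random


/-! ### The integrated density of states -/

section SpectralMeasure

variable {A : L2Z →L[ℂ] L2Z} {x : L2Z}

theorem integral_spectralMeasure_compactlySupported (f : C_c(ℝ, ℝ)) :
    ∫ t, f t ∂(spectralMeasure A x) = (inner ℂ x (cfc (f : ℝ → ℝ) A x)).re :=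
  RealRMK.integral_rieszMeasure (spectralFunctional A x) f

/-- A bump that equals `1` on a compact set off the spectrum and `0` on the spectrum gives the zero
operator. -/
theorem spectralMeasure_compl_spectrum (A : L2Z →L[ℂ] L2Z) (x : L2Z) :
    spectralMeasure A x (spectrum ℝ A)ᶜ = 0 := by
  have ho : IsOpen (spectrum ℝ A)ᶜ := (spectrum.isClosed A).isOpen_compl
  refine measure_null_of_locally_null _ fun t ht => ?_
  obtain ⟨K, hK, hKt, hKs⟩ := local_compact_nhds (ho.mem_nhds ht)
  refine ⟨K, mem_nhdsWithin_of_mem_nhds hK, ?_⟩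
  obtain ⟨f, hf1, hf0, hfc, hfI⟩ := exists_continuous_one_zero_of_isCompact hKs
    (spectrum.isClosed A) (Set.subset_compl_iff_disjoint_right.1 hKt)
  have h := RealRMK.rieszMeasure_le_of_eq_one (spectralFunctional A x) (f := ⟨f, hfc⟩)
    (fun t => (hfI t).1) hKs hf1
  have h0 : spectralFunctional A x ⟨f, hfc⟩ = 0 := by
    change (inner ℂ x (cfc (f : ℝ → ℝ) A x)).re = 0
    rw [cfc_congr (g := fun _ => 0) hf0, cfc_const_zero]
    simp
  rw [h0, ENNReal.ofReal_zero] at h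
  exact le_antisymm h bot_le

theorem ae_mem_spectrum (A : L2Z →L[ℂ] L2Z) (x : L2Z) :
    ∀ᵐ t ∂(spectralMeasure A x), t ∈ spectrum ℝ A := spectralMeasure_compl_spectrum A x

/-- A cut-off equal to `1` on the compact spectrum frees the test function from compact support. -/
theorem integral_spectralMeasure {f : ℝ → ℝ} (hf : Continuous f) :
    ∫ t, f t ∂(spectralMeasure A x) = (inner ℂ x (cfc f A x)).re := by
  obtain ⟨χ, hχ1, -, hχc, -⟩ := exists_continuous_one_zero_of_isCompact
    (spectrum.isCompact (𝕜 := ℝ) A) isClosed_empty (Set.disjoint_empty _)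
  have heq : Set.EqOn f (fun t => χ t * f t) (spectrum ℝ A) := fun t ht => by
    simp only [hχ1 ht, Pi.one_apply, one_mul]
  set g : C_c(ℝ, ℝ) := ⟨⟨fun t => χ t * f t, χ.continuous.mul hf⟩, hχc.mul_right⟩ with hg
  have h := integral_spectralMeasure_compactlySupported (A := A) (x := x) g
  have h1 : ∫ t, f t ∂(spectralMeasure A x) = ∫ t, g t ∂(spectralMeasure A x) :=
    integral_congr_ae ((ae_mem_spectrum A x).mono fun t ht => heq ht)
  rw [h1, h, cfc_congr heq]
  rfl

theorem isProbabilityMeasure_spectralMeasure (hA : IsSelfAdjoint A) (hx : ‖x‖ = 1) :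
    IsProbabilityMeasure (spectralMeasure A x) := by
  have h := integral_spectralMeasure (A := A) (x := x) (f := fun _ => 1) continuous_const
  rw [cfc_const_one ℝ A hA, one_apply_eq_self, inner_self_eq_norm_sq_to_K, hx, integral_const,
    smul_eq_mul, mul_one] at h
  have h1 : (spectralMeasure A x).real Set.univ = 1 := by simpa using h
  exact ⟨(ENNReal.toReal_eq_one_iff _).1 h1⟩

end SpectralMeasure

section Random

variable {Ω : Type*} [MeasurableSpace Ω] {P : Measure Ω} {V : ℤ → Ω → ℝ} {B : ℝ}

theorem isProbabilityMeasure_spectralMeasure_schrodinger (w : ℤ → ℝ) :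
    IsProbabilityMeasure (spectralMeasure (schrodinger w) (basisVec 0)) :=
  isProbabilityMeasure_spectralMeasure (isSelfAdjoint_schrodinger w) (norm_basisVec 0)

theorem integral_spectralMeasure_schrodinger {f : ℝ → ℝ} (hf : Continuous f) (w : ℤ → ℝ) :
    ∫ t, f t ∂(spectralMeasure (schrodinger w) (basisVec 0)) = diagEntry f w 0 := by
  rw [integral_spectralMeasure hf, diagEntry, entry_eq_inner]

theorem measurable_diagEntry_pot (hV : ∀ j, Measurable (V j)) (hB : ∀ j ω, |V j ω| ≤ B)
    {f : ℝ → ℝ} (hf : Continuous f) (j : ℤ) : Measurable fun ω => diagEntry f (pot V ω) j := by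
  rcases isEmpty_or_nonempty Ω with _ | ⟨⟨ω₀⟩⟩
  · exact measurable_of_empty _
  have hB0 : 0 ≤ B := (abs_nonneg _).trans (hB 0 ω₀)
  have h := (continuous_diagEntry_clamp hB0 hf j).measurable.comp (measurable_pot hV)
  have heq : (fun ω => diagEntry f (pot V ω) j) =
      (fun w => diagEntry f (clamp B w) j) ∘ pot V := by
    ext ω
    rw [Function.comp_apply, clamp_of_abs_le (w := pot V ω) fun j => hB j ω]
  rwa [heq]

/-- Closed sets form a generating π-system, and their masses are limits of integrals of continuous
functions, that is, of diagonal entries. -/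
theorem measurable_spectralMeasure (hV : ∀ j, Measurable (V j)) (hB : ∀ j ω, |V j ω| ≤ B) :
    Measurable fun ω => spectralMeasure (schrodinger (pot V ω)) (basisVec 0) := by
  have : ∀ ω, IsProbabilityMeasure (spectralMeasure (schrodinger (pot V ω)) (basisVec 0)) :=
    fun ω => isProbabilityMeasure_spectralMeasure_schrodinger _
  refine Measurable.measure_of_isPiSystem_of_isProbabilityMeasure (S := {s | IsClosed s})
    (by rw [← borel_eq_generateFrom_isClosed]; exact BorelSpace.measurable_eq) isPiSystem_isClosed
    fun F hF => ?_
  have hδ : ∀ n : ℕ, (0 : ℝ) < 1 / (n + 1) := fun n => Nat.one_div_pos_of_nat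
  refine measurable_of_tendsto_metrizable (fun n => ?_) (tendsto_pi_nhds.2 fun ω =>
    tendsto_lintegral_thickenedIndicator_of_isClosed _ hF hδ tendsto_one_div_add_atTop_nhds_zero_nat)
  simp_rw [fun ω => lintegral_coe_eq_integral _ (integrable_thickenedIndicator
    (μ := spectralMeasure (schrodinger (pot V ω)) (basisVec 0)) F (hδ n))]
  have hc : Continuous fun t : ℝ => ((thickenedIndicator (hδ n) F t : NNReal) : ℝ) :=
    NNReal.continuous_coe.comp (thickenedIndicator (hδ n) F).continuous
  simp_rw [integral_spectralMeasure_schrodinger hc]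
  exact (measurable_diagEntry_pot hV hB hc 0).ennreal_ofReal

/-- The integral of `f` over the non-random spectrum with respect to the integrated density of
states is the expectation of `f_{00}(H)`. -/
theorem setIntegral_idsMeasure [IsProbabilityMeasure P] {μ : Measure ℝ} [IsProbabilityMeasure μ]
    (hV : ∀ j, Measurable (V j)) (hB : ∀ j ω, |V j ω| ≤ B)
    (hmap : P.map (pot V) = iid μ) (hS : μ.support ⊆ Set.Icc (-B) B)
    {f : ℝ → ℝ} (hf : Continuous f) (hfb : ∃ C, ∀ t, |f t| ≤ C) :
    ∫ t in detSpectrum P V, f t ∂(idsMeasure P V) = ∫ ω, diagEntry f (pot V ω) 0 ∂P := by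
  have hae := ae_spectrum_eq_detSpectrum hV hmap hB hS
  have hclosed : IsClosed (detSpectrum P V) := by
    obtain ⟨ω, hω⟩ := hae.exists
    rw [← hω]
    exact spectrum.isClosed _
  let κ : Kernel Ω ℝ := ⟨_, measurable_spectralMeasure hV hB⟩
  have hκ : IsMarkovKernel κ := ⟨fun ω => isProbabilityMeasure_spectralMeasure_schrodinger _⟩
  have hN : idsMeasure P V = κ ∘ₘ P := rfl
  have hnull : (idsMeasure P V) (detSpectrum P V)ᶜ = 0 := by
    rw [hN, Measure.bind_apply hclosed.isOpen_compl.measurableSet κ.measurable.aemeasurable,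
      lintegral_eq_zero_iff (κ.measurable_coe hclosed.isOpen_compl.measurableSet)]
    filter_upwards [hae] with ω hω
    rw [← hω]
    exact spectralMeasure_compl_spectrum _ _
  have hae' : ∀ᵐ t ∂(idsMeasure P V), t ∈ detSpectrum P V := hnull
  have hN' : idsMeasure P V = (κ ∘ₖ Kernel.const Unit P) () := by
    rw [Kernel.comp_apply, Kernel.const_apply, hN]
  rw [Measure.restrict_eq_self_of_ae_mem hae', hN', Kernel.integral_comp, Kernel.const_apply]
  · exact integral_congr_ae (ae_of_all _ fun ω => integral_spectralMeasure_schrodinger hf _)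
  · obtain ⟨C, hC⟩ := hfb
    exact Integrable.of_bound hf.aestronglyMeasurable C (ae_of_all _ hC)

end Random


/-! ### Measurability of the trace of the restriction -/

theorem abs_traceRestr_sub_traceRestr_le {w : ℤ → ℝ} {B : ℝ} (hw : ∀ j, |w j| ≤ B) {a : ℝ → ℝ}
    {c : ℝ} (hc0 : 0 ≤ c) (hc : ∀ x, |x| ≤ 2 + B → |a x| ≤ c) {φ ψ : ℝ → ℝ} {ε : ℝ}
    (h : ∀ x, |x| ≤ c → |φ x - ψ x| ≤ ε) (M : ℕ) :
    |traceRestr φ a w M - traceRestr ψ a w M| ≤ (2 * M + 1) * ε := by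
  have hA : IsSelfAdjoint (cfc a (schrodinger w)) := cfc_predicate a _
  rw [traceRestr, traceRestr, re_trace_cfc_restriction hA, re_trace_cfc_restriction hA,
    ← Finset.sum_sub_distrib]
  refine (Finset.abs_sum_le_sum_abs _ _).trans ((Finset.sum_le_sum fun i _ => h _
    ((abs_eigenvalues_restriction_le hA M i).trans (norm_cfc_schrodinger_le hw hc0 hc))).trans ?_)
  rw [Finset.sum_const, Finset.card_univ, Fintype.card_coe, Int.card_Icc, nsmul_eq_mul,
    show ((M : ℤ) + 1 - -M).toNat = 2 * M + 1 by omega]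
  push_cast
  rfl

theorem continuous_traceRestr_polynomial {B : ℝ} (hB : 0 ≤ B) {a : ℝ → ℝ} (ha : Continuous a)
    (p : Polynomial ℝ) (M : ℕ) : Continuous fun w => traceRestr p.eval a (clamp B w) M := by
  have hr : Continuous fun w => restriction (cfc a (schrodinger (clamp B w))) M :=
    continuous_matrix fun j k => continuous_entry_cfc_clamp hB ha j k
  have hp : ∀ w, cfc p.eval (restriction (cfc a (schrodinger (clamp B w))) M) =
      Polynomial.aeval (restriction (cfc a (schrodinger (clamp B w))) M) p := fun w =>
    cfc_polynomial p _ (isHermitian_restriction (cfc_predicate a _) M)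
  simp_rw [traceRestr, hp, Polynomial.aeval_eq_sum_range]
  refine Complex.continuous_re.comp (Continuous.matrix_trace ?_)
  exact continuous_finsetSum _ fun k _ => 
    (continuous_const_smul (p.coeff k)).comp ((continuous_pow k).comp hr)

theorem continuous_traceRestr {B : ℝ} (hB : 0 ≤ B) {a φ : ℝ → ℝ} (ha : Continuous a)
    (hφ : Continuous φ) (M : ℕ) : Continuous fun w => traceRestr φ a (clamp B w) M := by
  obtain ⟨c, hc0, hc⟩ := exists_abs_le_of_continuous ha (2 + B)
  refine continuous_of_uniform_approx_of_continuous fun s hs => ?_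
  obtain ⟨ε, hε, hεs⟩ := Metric.mem_uniformity_dist.1 hs
  have hc' : 0 < ε / (2 * (2 * M + 1)) := by positivity
  obtain ⟨p, hp⟩ := exists_polynomial_near hφ c hc'
  refine ⟨_, continuous_traceRestr_polynomial hB ha p M, fun w => hεs ?_⟩
  refine (abs_traceRestr_sub_traceRestr_le (abs_clamp_le hB w) hc0 hc hp M).trans_lt ?_
  have : (2 * (M : ℝ) + 1) * (ε / (2 * (2 * M + 1))) = ε / 2 := by field_simp
  rw [this]
  linarith


/-! ### Monotonicity of the trace per period -/

theorem diagEntry_nonneg {f : ℝ → ℝ} (hf : ∀ x, 0 ≤ f x) (w : ℤ → ℝ) (j : ℤ) :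
    0 ≤ diagEntry f w j := by
  rw [diagEntry, entry_eq_inner]
  exact re_inner_cfc_nonneg (fun x _ => hf x) _

/-- The mean over `[x, x + h]` has the derivative `(g (x + h) - g x) / h ≥ 0`. It brings merely
Lipschitz functions into the reach of the derivative formula for the trace. -/
theorem exists_steklov {g : ℝ → ℝ} (hg : Monotone g) {L : ℝ}
    (hL : ∀ x y, |g x - g y| ≤ L * |x - y|) {h : ℝ} (hh : 0 < h) :
    ∃ G G' : ℝ → ℝ, Continuous G' ∧ (∀ x, HasDerivAt G (G' x) x) ∧ (∀ x, 0 ≤ G' x) ∧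
      ∀ x, |G x - g x| ≤ L * h := by
  have hL0 : 0 ≤ L := by simpa using (abs_nonneg _).trans (hL 0 1)
  have hc : Continuous g := (LipschitzWith.of_dist_le_mul (K := ⟨L, hL0⟩) hL).continuous
  set I : ℝ → ℝ := fun x => ∫ t in (0 : ℝ)..x, g t with hI
  have hId : ∀ x, HasDerivAt I (g x) x := fun x =>
    intervalIntegral.integral_hasDerivAt_right (hc.intervalIntegrable _ _)
      hc.aestronglyMeasurable.stronglyMeasurableAtFilter hc.continuousAt
  refine ⟨fun x => h⁻¹ * (I (x + h) - I x), fun x => h⁻¹ * (g (x + h) - g x), by fun_prop,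
    fun x => (((hId (x + h)).comp_add_const x h).sub (hId x)).const_mul _, fun x => ?_, fun x => ?_⟩
  · exact mul_nonneg (inv_nonneg.2 hh.le) (sub_nonneg.2 (hg (by linarith)))
  · have h1 : I (x + h) - I x - h * g x = ∫ t in x..(x + h), (g t - g x) := by
      rw [intervalIntegral.integral_sub (hc.intervalIntegrable _ _) (by simp),
        intervalIntegral.integral_const, hI,
        intervalIntegral.integral_interval_sub_left (hc.intervalIntegrable _ _)
          (hc.intervalIntegrable _ _)]
      simp
    have h2 : |I (x + h) - I x - h * g x| ≤ L * h * h := by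
      rw [h1, ← Real.norm_eq_abs]
      have := intervalIntegral.norm_integral_le_of_norm_le_const (a := x) (b := x + h)
        (f := fun t => g t - g x) (C := L * h) fun t ht => by
          rw [Set.uIoc_of_le (by linarith)] at ht
          refine (hL t x).trans (mul_le_mul_of_nonneg_left ?_ hL0)
          rw [abs_of_nonneg (by linarith [ht.1])]
          linarith [ht.2]
      rwa [add_sub_cancel_left, abs_of_pos hh] at this
    have h3 : h⁻¹ * (I (x + h) - I x) - g x = h⁻¹ * (I (x + h) - I x - h * g x) := by
      field_simp
    rw [h3, abs_mul, abs_of_pos (inv_pos.2 hh), inv_mul_le_iff₀ hh]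
    linarith

/-- The trace per period is monotone in the potential, for increasing functions. -/
theorem sum_diagEntry_le_of_monotone {N : ℕ} (hN : 0 < N) {w v : ℤ → ℝ} {B : ℝ}
    (hw : ∀ j, |w j| ≤ B) (hv : ∀ j, |v j| ≤ B) (hpw : translate N w = w) (hpv : translate N v = v)
    (hwv : ∀ j, w j ≤ v j) {g : ℝ → ℝ} (hg : Monotone g) {L : ℝ}
    (hL : ∀ x y, |g x - g y| ≤ L * |x - y|) :
    ∑ j ∈ Finset.range N, diagEntry g w j ≤ ∑ j ∈ Finset.range N, diagEntry g v j := by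
  have hL0 : 0 ≤ L := by simpa using (abs_nonneg _).trans (hL 0 1)
  have hc : Continuous g := (LipschitzWith.of_dist_le_mul (K := ⟨L, hL0⟩) hL).continuous
  have key : ∀ h > 0, ∑ j ∈ Finset.range N, diagEntry g w j ≤
      ∑ j ∈ Finset.range N, diagEntry g v j + N * (2 * (L * h)) := by
    intro h hh
    obtain ⟨G, G', hG'c, hG, hG'0, hGg⟩ := exists_steklov hg hL hh
    have hGc : Continuous G := continuous_iff_continuousAt.2 fun x => (hG x).continuousAt
    have h1 := sum_diagEntry_sub_eq_integral hN hw hv hpw hpv hG'c hG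
    have h2 : 0 ≤ ∑ j ∈ Finset.range N, (diagEntry G v j - diagEntry G w j) := by
      rw [h1]
      refine intervalIntegral.integral_nonneg zero_le_one fun u _ => ?_
      exact Finset.sum_nonneg fun j _ => mul_nonneg (sub_nonneg.2 (hwv j))
        (diagEntry_nonneg hG'0 _ _)
    have h3 : ∑ j ∈ Finset.range N, (diagEntry G v j - diagEntry G w j) ≤
        ∑ j ∈ Finset.range N, (diagEntry g v j - diagEntry g w j + 2 * (L * h)) := by
      refine Finset.sum_le_sum fun j _ => ?_
      have a1 := abs_le.1 (abs_diagEntry_sub_diagEntry_le hv hGc hc (by positivity)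
        (fun x _ => hGg x) j)
      have a2 := abs_le.1 (abs_diagEntry_sub_diagEntry_le hw hGc hc (by positivity)
        (fun x _ => hGg x) j)
      linarith
    replace h3 := h2.trans h3
    rw [Finset.sum_add_distrib, Finset.sum_sub_distrib, Finset.sum_const, Finset.card_range,
      nsmul_eq_mul] at h3
    linarith
  refine le_of_forall_pos_le_add fun ε hε => ?_
  have h := key (ε / (N * (2 * L) + 1)) (by positivity)
  refine h.trans (add_le_add_right ?_ _)
  rw [show (N : ℝ) * (2 * (L * (ε / (N * (2 * L) + 1)))) = ε * ((N * (2 * L)) / (N * (2 * L) + 1))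
    by ring]
  refine mul_le_of_le_one_right hε.le ?_
  rw [div_le_one (by positivity)]
  linarith

/-- A Lipschitz function that increases on a set extends to an increasing Lipschitz function. -/
theorem exists_monotone_lipschitz_extension {γ : ℝ → ℝ} {s : Set ℝ} (hs : s.Nonempty)
    (hγ : MonotoneOn γ s) {L : ℝ} (hL : ∀ x y, |γ x - γ y| ≤ L * |x - y|)
    (hb : ∃ C, ∀ x, |γ x| ≤ C) :
    ∃ g : ℝ → ℝ, Monotone g ∧ (∀ x y, |g x - g y| ≤ L * |x - y|) ∧ Set.EqOn g γ s := by
  have hL0 : 0 ≤ L := by simpa using (abs_nonneg _).trans (hL 0 1)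
  have : Nonempty s := hs.to_subtype
  obtain ⟨C, hC⟩ := hb
  -- McShane's extension as a supremum, with a penalty only for points to the right of `x`; this
  -- makes it increasing in `x`, and monotonicity on `s` takes care of the points to the left.
  set F : ℝ → s → ℝ := fun x y => γ y - L * max (y - x) 0 with hF
  have hbdd : ∀ x, BddAbove (Set.range (F x)) := fun x => ⟨C, by
    rintro _ ⟨y, rfl⟩
    have h1 := (abs_le.1 (hC y)).2
    have h2 : 0 ≤ L * max ((y : ℝ) - x) 0 := mul_nonneg hL0 (le_max_right _ _)
    simp only [hF]
    linarith⟩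
  have hle : ∀ x z, ⨆ y, F x y ≤ (⨆ y, F z y) + L * |x - z| := fun x z => by
    refine ciSup_le fun y => ?_
    have h1 := le_ciSup (hbdd z) y
    have h2 : max ((y : ℝ) - z) 0 ≤ max ((y : ℝ) - x) 0 + |x - z| := by
      refine max_le ?_ (add_nonneg (le_max_right _ _) (abs_nonneg _))
      have := le_max_left ((y : ℝ) - x) 0
      have := le_abs_self (x - z)
      linarith
    have h3 := mul_le_mul_of_nonneg_left h2 hL0
    simp only [hF] at *
    linarith
  refine ⟨fun x => ⨆ y, F x y, fun x z hxz => ?_, fun x z => ?_, fun x hx => ?_⟩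
  · refine ciSup_mono (hbdd z) fun y => ?_
    have : max ((y : ℝ) - z) 0 ≤ max ((y : ℝ) - x) 0 := max_le_max (by linarith) le_rfl
    have := mul_le_mul_of_nonneg_left this hL0
    simp only [hF]
    linarith
  · have h1 := hle x z
    have h2 := hle z x
    rw [abs_sub_comm z x] at h2
    rw [abs_le]
    constructor <;> linarith
  · refine le_antisymm (ciSup_le fun y => ?_) ?_
    · simp only [hF]
      rcases le_total (y : ℝ) x with h | h
      · rw [max_eq_right (by linarith), mul_zero, sub_zero]
        exact hγ y.2 hx h
      · rw [max_eq_left (by linarith)]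
        have := (abs_le.1 (hL y x)).2
        rw [abs_of_nonneg (by linarith)] at this
        linarith
    · refine le_trans (le_of_eq ?_) (le_ciSup (hbdd x) ⟨x, hx⟩)
      simp [hF]

/-! ### Constant potentials -/

theorem cfc_add_const_schrodinger {w : ℤ → ℝ} {B : ℝ} (hw : ∀ j, |w j| ≤ B) (m : ℝ) :
    cfc (fun x => x + m) (schrodinger w) = schrodinger fun j => w j + m := by
  have hb : ∀ j, |w j + m| ≤ B + |m| := fun j => (abs_add_le _ _).trans (by linarith [hw j])
  rw [cfc_add (schrodinger w) (fun x => x) (fun _ => m) continuousOn_id continuousOn_const,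
    cfc_id' ℝ _ (isSelfAdjoint_schrodinger w), cfc_const m _ (isSelfAdjoint_schrodinger w)]
  refine ContinuousLinearMap.ext fun u => ext_coord fun j => ?_
  rw [coord_schrodinger hb, Algebra.algebraMap_eq_smul_one, _root_.add_apply, _root_.smul_apply,
    one_apply_eq_self, coord_add, coord_real_smul, coord_schrodinger hw]
  push_cast
  ring

theorem spectrum_schrodinger_add_const {w : ℤ → ℝ} {B : ℝ} (hw : ∀ j, |w j| ≤ B) (m : ℝ) :
    spectrum ℝ (schrodinger fun j => w j + m) =
      (fun x => x + m) '' spectrum ℝ (schrodinger w) := by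
  rw [← cfc_add_const_schrodinger hw]
  exact cfc_map_spectrum (fun x => x + m) _ (isSelfAdjoint_schrodinger w)
    (by fun_prop)

theorem diagEntry_add_const {w : ℤ → ℝ} {B : ℝ} (hw : ∀ j, |w j| ≤ B) {f : ℝ → ℝ}
    (hf : Continuous f) (m : ℝ) (j : ℤ) :
    diagEntry f (fun j => w j + m) j = diagEntry (fun x => f (x + m)) w j := by
  rw [diagEntry, diagEntry, ← cfc_add_const_schrodinger hw, cfc_comp' f (fun x => x + m)
    (schrodinger w) hf.continuousOn (by fun_prop) (isSelfAdjoint_schrodinger w)]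

/-- The plane wave of quasi-momentum `k` cut off at `[-n, n]`. -/
def planeWave (k : ℝ) (n : ℕ) : L2Z :=
  ofSummable (fun j => if |j| ≤ n then Complex.exp ((k * j : ℝ) * Complex.I) else 0) <| by
    refine summable_of_ne_finset_zero (s := Finset.Icc (-(n : ℤ)) n) fun j hj => ?_
    rw [Finset.mem_Icc, ← abs_le] at hj
    rw [if_neg hj, norm_zero, zero_pow two_ne_zero]

theorem coord_planeWave (k : ℝ) (n : ℕ) (j : ℤ) : coord (planeWave k n) j =
    if |j| ≤ n then Complex.exp ((k * j : ℝ) * Complex.I) else 0 := rfl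

theorem norm_coord_planeWave_le (k : ℝ) (n : ℕ) (j : ℤ) : ‖coord (planeWave k n) j‖ ≤ 1 := by
  rw [coord_planeWave]
  split_ifs
  · rw [Complex.norm_exp_ofReal_mul_I]
  · simp

theorem norm_sq_planeWave (k : ℝ) (n : ℕ) : ‖planeWave k n‖ ^ 2 = 2 * n + 1 := by
  have hz : ∀ j ∉ Finset.Icc (-(n : ℤ)) n, ‖coord (planeWave k n) j‖ ^ 2 = 0 := fun j hj => by
    rw [Finset.mem_Icc, ← abs_le] at hj
    rw [coord_planeWave, if_neg hj, norm_zero, zero_pow two_ne_zero]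
  have h1 : ∀ j ∈ Finset.Icc (-(n : ℤ)) n, ‖coord (planeWave k n) j‖ ^ 2 = 1 := fun j hj => by
    rw [Finset.mem_Icc, ← abs_le] at hj
    rw [coord_planeWave, if_pos hj, Complex.norm_exp_ofReal_mul_I, one_pow]
  rw [norm_sq_eq, tsum_eq_sum hz, Finset.sum_congr rfl h1, Finset.sum_const, Int.card_Icc,
    nsmul_eq_mul, mul_one, show ((n : ℤ) + 1 - -n).toNat = 2 * n + 1 by omega]
  push_cast
  rfl

/-- The plane wave is an exact eigenfunction except at the four sites next to the two ends of the
box. Each of them contributes at most `4`, and `√(4 · 4²) = 8`. -/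
theorem norm_schrodinger_zero_planeWave_le (k : ℝ) (n : ℕ) :
    ‖schrodinger 0 (planeWave k n) - (-2 * Real.cos k) • planeWave k n‖ ≤ 8 := by
  set u := planeWave k n with hu
  set T := schrodinger 0 u - (-2 * Real.cos k) • u with hT
  have hcoord : ∀ j, coord T j = -coord u (j + 1) - coord u (j - 1) +
      2 * Real.cos k * coord u j := fun j => by
    rw [hT, coord_sub, coord_real_smul, coord_schrodinger (B := 0) (by simp)]
    simp
  set s : Finset ℤ := {-(n : ℤ) - 1, -(n : ℤ), (n : ℤ), (n : ℤ) + 1} with hs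
  have hz : ∀ j ∉ s, ‖coord T j‖ ^ 2 = 0 := fun j hj => by
    simp only [hs, Finset.mem_insert, Finset.mem_singleton, not_or] at hj
    rw [hcoord, hu, coord_planeWave, coord_planeWave, coord_planeWave]
    rcases lt_or_ge |j| n with h | h
    · have h' := abs_lt.1 h
      rw [if_pos (by rw [abs_le]; omega), if_pos (by rw [abs_le]; omega),
        if_pos (by rw [abs_le]; omega)]
      have e1 : Complex.exp ((k * ((j + 1 : ℤ) : ℝ) : ℝ) * Complex.I) =
          Complex.exp ((k * j : ℝ) * Complex.I) * Complex.exp (k * Complex.I) := by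
        rw [← Complex.exp_add]
        congr 1
        push_cast
        ring
      have e2 : Complex.exp ((k * ((j - 1 : ℤ) : ℝ) : ℝ) * Complex.I) =
          Complex.exp ((k * j : ℝ) * Complex.I) * Complex.exp (-k * Complex.I) := by
        rw [← Complex.exp_add]
        congr 1
        push_cast
        ring
      have e3 := Complex.two_cos (k : ℂ)
      rw [e1, e2, Complex.ofReal_cos, e3]
      have : ∀ a b c : ℂ, -(a * b) - a * c + (b + c) * a = 0 := fun a b c => by ring
      rw [this, norm_zero, zero_pow two_ne_zero]
    · have h' := le_abs.1 h
      have h1 : ¬ |j + 1| ≤ n := by rw [abs_le]; omega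
      have h2 : ¬ |j - 1| ≤ n := by rw [abs_le]; omega
      have h3 : ¬ |j| ≤ n := by rw [abs_le]; omega
      rw [if_neg h1, if_neg h2, if_neg h3]
      simp
  have hle : ∀ j, ‖coord T j‖ ≤ 4 := fun j => by
    rw [hcoord]
    have b1 := norm_coord_planeWave_le k n (j + 1)
    have b2 := norm_coord_planeWave_le k n (j - 1)
    have b3 := norm_coord_planeWave_le k n j
    have b4 : ‖(2 * Real.cos k : ℂ)‖ ≤ 2 := by
      rw [norm_mul, Complex.norm_real, Complex.norm_two, Real.norm_eq_abs]
      linarith [Real.abs_cos_le_one k]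
    refine (norm_add_le _ _).trans ?_
    have b5 := norm_sub_le (-coord u (j + 1)) (coord u (j - 1))
    rw [norm_neg] at b5
    rw [norm_mul]
    have b6 := mul_le_mul b4 b3 (norm_nonneg _) zero_le_two
    linarith
  have hsq : ‖T‖ ^ 2 ≤ 8 ^ 2 := by
    rw [norm_sq_eq, tsum_eq_sum hz]
    refine (Finset.sum_le_card_nsmul s _ (4 ^ 2) fun j _ =>
      pow_le_pow_left₀ (norm_nonneg _) (hle j) 2).trans ?_
    have hcard : (s.card : ℝ) ≤ 4 := by exact_mod_cast Finset.card_le_four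
    rw [nsmul_eq_mul]
    nlinarith
  exact le_of_sq_le_sq hsq (by norm_num)

/-- Weyl's criterion: the norms `√(2n + 1)` of the cut-off plane waves grow while their defects stay
bounded, which excludes a bounded resolvent at `-2 cos k`. -/
theorem Icc_subset_spectrum_schrodinger_zero :
    Set.Icc (-2 : ℝ) 2 ⊆ spectrum ℝ (schrodinger 0) := by
  intro x hx
  obtain ⟨k, rfl⟩ : ∃ k, x = -2 * Real.cos k := ⟨Real.arccos (-x / 2), by
    rw [Real.cos_arccos (by linarith [hx.2]) (by linarith [hx.1])]
    ring⟩
  rw [spectrum.mem_iff]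
  intro hunit
  obtain ⟨T, hT⟩ := hunit
  set S : L2Z →L[ℂ] L2Z := ↑T⁻¹ with hS
  have hST : ∀ u, S (schrodinger 0 u - (-2 * Real.cos k) • u) = -u := fun u => by
    have h1 : S * (algebraMap ℝ _ (-2 * Real.cos k) - schrodinger 0) = 1 := by
      rw [← hT]
      exact T.inv_mul
    have h2 := congrArg (fun A : L2Z →L[ℂ] L2Z => A u) h1
    simp only [mul_apply_eq_comp, one_apply_eq_self, _root_.sub_apply,
      Algebra.algebraMap_eq_smul_one, _root_.smul_apply] at h2
    rw [← neg_sub, map_neg, h2]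
  have hbound : ∀ n : ℕ, (2 * n + 1 : ℝ) ≤ (‖S‖ * 8) ^ 2 := fun n => by
    rw [← norm_sq_planeWave k n, ← norm_neg, ← hST]
    refine pow_le_pow_left₀ (norm_nonneg _) ((S.le_opNorm _).trans ?_) 2
    exact mul_le_mul_of_nonneg_left (norm_schrodinger_zero_planeWave_le k n) (norm_nonneg _)
  obtain ⟨n, hn⟩ := exists_nat_gt ((‖S‖ * 8) ^ 2)
  have := hbound n
  have hn0 : (0 : ℝ) ≤ n := n.cast_nonneg
  linarith

theorem diagEntry_congr {w : ℤ → ℝ} {f g : ℝ → ℝ}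
    (h : Set.EqOn f g (spectrum ℝ (schrodinger w))) (j : ℤ) :
    diagEntry f w j = diagEntry g w j := by
  rw [diagEntry, diagEntry, cfc_congr h]

/-- Write `f(H) = G²` with `G = √f(H)`; the diagonal entries are `‖G δ_k‖²`. -/
theorem eq_zero_of_diagEntry_eq_zero {w : ℤ → ℝ} {f : ℝ → ℝ} (hf : Continuous f)
    (hf0 : ∀ x, 0 ≤ f x) (h : ∀ j, diagEntry f w j = 0) :
    ∀ x ∈ spectrum ℝ (schrodinger w), f x = 0 := by
  have hA := isSelfAdjoint_schrodinger w
  have hg : Continuous fun x => √(f x) := hf.sqrt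
  set G := cfc (fun x => √(f x)) (schrodinger w) with hG
  have hGs : IsSelfAdjoint G := cfc_predicate _ _
  have hGG : cfc f (schrodinger w) = G * G := by
    rw [hG, ← cfc_mul _ _ _ hg.continuousOn hg.continuousOn]
    exact cfc_congr fun x _ => (Real.mul_self_sqrt (hf0 x)).symm
  have hG0 : G = 0 := eq_zero_of_entry_eq_zero hGs fun j k => by
    have h1 := h k
    rw [diagEntry, entry_eq_inner, hGG, mul_apply_eq_comp, inner_apply_apply_self hGs,
      Complex.ofReal_re] at h1
    have h2 : G (basisVec k) = 0 := norm_eq_zero.1 (pow_eq_zero_iff two_ne_zero |>.1 h1)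
    rw [entry, h2]
    rfl
  refine eqOn_zero_of_cfc_eq_zero hA hf ?_
  rw [hGG, hG0, zero_mul]

/-- An increasing function whose diagonal entries at two constant potentials agree is constant on
the interval spanned by the two spectra. -/
theorem eqOn_const_of_diagEntry_const_eq {g : ℝ → ℝ} (hg : Monotone g) (hgc : Continuous g)
    {b c : ℝ} (hbc : b < c) (h : diagEntry g (fun _ => b) 0 = diagEntry g (fun _ => c) 0) :
    ∀ x ∈ Set.Icc (b - 2) (c + 2), g x = g (b - 2) := by
  set d : ℝ → ℝ := fun x => g (x + c) - g (x + b) with hd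
  have hdc : Continuous d := by fun_prop
  have hd0 : ∀ x, 0 ≤ d x := fun x => sub_nonneg.2 (hg (by linarith))
  have hz : ∀ j, |(0 : ℤ → ℝ) j| ≤ 0 := fun j => by simp
  have hshift : ∀ (m : ℝ) (j : ℤ), diagEntry g (fun _ => m) j =
      diagEntry (fun x => g (x + m)) 0 j := fun m j => by
    rw [← diagEntry_add_const hz hgc]
    simp
  have hdiag : ∀ j, diagEntry d 0 j = 0 := fun j => by
    have h1 : diagEntry d 0 0 = 0 := by
      have : diagEntry d 0 0 = diagEntry (fun x => g (x + c)) 0 0 -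
          diagEntry (fun x => g (x + b)) 0 0 := by
        rw [diagEntry, diagEntry, diagEntry, ← Complex.sub_re, ← entry_sub,
          ← cfc_sub (fun x => g (x + c)) (fun x => g (x + b)) (schrodinger 0)
            (by fun_prop) (by fun_prop)]
      rw [this, ← hshift, ← hshift, h, sub_self]
    have h2 := diagEntry_translate hz hdc j 0
    rw [zero_add] at h2
    rw [← h2, ← h1]
    rfl
  -- The nonnegative function `d` of the free operator has zero diagonal, hence vanishes on its
  -- spectrum `[-2, 2]`.
  have hzero : ∀ x ∈ Set.Icc (-2 : ℝ) 2, g (x + c) = g (x + b) := fun x hx =>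
    sub_eq_zero.1 (eq_zero_of_diagEntry_eq_zero hdc hd0 hdiag x
      (Icc_subset_spectrum_schrodinger_zero hx))
  -- Above `c - 2` the identity moves the argument down by `c - b`; up to `c - 2` the value is
  -- squeezed between the equal values at `b - 2` and `c - 2`.
  have hstep : ∀ n : ℕ, ∀ x ∈ Set.Icc (b - 2) (c + 2), x ≤ b - 2 + n * (c - b) →
      g x = g (b - 2) := by
    intro n
    induction n with
    | zero =>
      intro x hx hxn
      rw [show x = b - 2 by
        refine le_antisymm ?_ hx.1
        simpa using hxn]
    | succ n ih =>
      intro x hx hxn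
      push_cast at hxn
      rcases le_or_gt x (c - 2) with hxc | hxc
      · have h1 := hzero (-2) ⟨le_rfl, by norm_num⟩
        rw [neg_add_eq_sub, neg_add_eq_sub] at h1
        exact le_antisymm ((hg hxc).trans h1.le) (hg hx.1)
      · have h1 := hzero (x - c) ⟨by linarith, by linarith [hx.2]⟩
        rw [sub_add_cancel] at h1
        rw [h1]
        exact ih _ ⟨by linarith, by linarith [hx.2]⟩ (by linarith)
  intro x hx
  obtain ⟨n, hn⟩ := exists_nat_gt ((x - (b - 2)) / (c - b))
  refine hstep n x hx ?_
  rw [div_lt_iff₀ (by linarith)] at hn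
  linarith


/-! ### Positivity of the limiting variance -/

section

variable {f : (ℤ → ℝ) → ℝ} {β : ℕ → ℝ}

theorem QuasiLocal.continuous_totalChange (hf : QuasiLocal f β) (hc : Continuous f) :
    Continuous (totalChange f) := by
  have he : Continuous eraseZero := continuous_id.update 0 continuous_const
  refine continuous_tsum (fun j => ?_) hf.summable_natAbs fun j w => ?_
  · exact (hc.comp (continuous_translate j)).sub (hc.comp ((continuous_translate j).comp he))
  · exact hf.abs_sub_translate_le_natAbs j fun i hi => (Function.update_of_ne hi _ _).symm

theorem QuasiLocal.totalChange_update_sub_update (hf : QuasiLocal f β) (w : ℤ → ℝ) (x y : ℝ) :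
    totalChange f (Function.update w 0 y) - totalChange f (Function.update w 0 x) =
      ∑' j : ℤ, (f (translate j (Function.update w 0 y)) -
        f (translate j (Function.update w 0 x))) := by
  rw [totalChange, totalChange, ← (hf.summable_sub_eraseZero _).tsum_sub
    (hf.summable_sub_eraseZero _)]
  refine tsum_congr fun j => ?_
  rw [eraseZero, eraseZero, Function.update_idem, Function.update_idem, sub_sub_sub_cancel_right]

theorem splice_singleton (w w' : ℤ → ℝ) : splice {0} w' w = Function.update w 0 (w' 0) := by
  ext i
  rcases eq_or_ne i 0 with rfl | hi
  · rw [splice_of_mem (Set.mem_singleton 0), Function.update_self]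
  · rw [splice_of_notMem (by simpa using hi), Function.update_of_ne hi]

variable {μ : Measure ℝ} [IsProbabilityMeasure μ]

theorem iid_pos_of_mem_nhds {w : ℤ → ℝ} (hw : ∀ j, w j ∈ μ.support) {U : Set (ℤ → ℝ)}
    (hU : U ∈ 𝓝 w) : 0 < iid μ U := by
  obtain ⟨U', hU'U, hU'o, hwU'⟩ := mem_nhds_iff.1 hU
  obtain ⟨I, u, hu, hIu⟩ := isOpen_pi_iff.1 hU'o w hwU'
  refine lt_of_lt_of_le ?_ (measure_mono (hIu.trans hU'U))
  rw [Measure.infinitePi_pi _ fun i hi => (hu i hi).1.measurableSet]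
  exact pos_iff_ne_zero.2 (Finset.prod_ne_zero_iff.2 fun i hi =>
    ((Measure.mem_support_iff_forall _).1 (hw i) _ ((hu i hi).1.mem_nhds (hu i hi).2)).ne')

/-- The average at level `0` keeps the correlation of `A` with the site `0`, the one at level `1` is
independent of that site; if they agree, the correlation is zero. -/
theorem integral_mul_eq_of_integral_sq_eq_zero {A h : (ℤ → ℝ) → ℝ} (hA : BddMeas A)
    (hh : BddMeas h) (hd : DependsOn h {0})
    (h0 : ∫ w, (pastMean μ 0 A w - pastMean μ 1 A w) ^ 2 ∂(iid μ) = 0) :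
    ∫ w, A w * h w ∂(iid μ) = (∫ w, A w ∂(iid μ)) * ∫ w, h w ∂(iid μ) := by
  have hb := (bddMeas_pastMean (μ := μ) hA 0).sub (bddMeas_pastMean (μ := μ) hA 1)
  have hsq : Integrable (fun w => (pastMean μ 0 A w - pastMean μ 1 A w) ^ 2) (iid μ) := by
    simp_rw [pow_two]
    exact (hb.mul hb).integrable _
  have hae := (integral_eq_zero_iff_of_nonneg (fun w => sq_nonneg _) hsq).1 h0
  have hae' : ∀ᵐ w ∂(iid μ), pastMean μ 0 A w = pastMean μ 1 A w := by
    filter_upwards [hae] with w hw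
    exact sub_eq_zero.1 (pow_eq_zero_iff two_ne_zero |>.1 hw)
  have hd0 : DependsOn h (Set.Ici 0) := fun w w' hww => hd fun i hi => hww i (by
    rw [Set.mem_singleton_iff.1 hi]
    exact Set.self_mem_Ici)
  rw [← integral_pastMean_mul hA hh hd0]
  rw [integral_congr_ae (g := fun w => pastMean μ 1 A w * h w) (by
    filter_upwards [hae'] with w hw
    rw [hw])]
  rw [← integral_pastMean (μ := μ) hA 1]
  refine integral_mul_of_dependsOn (I := Set.Ici 1) (bddMeas_pastMean hA 1).measurable
    hh.measurable (dependsOn_pastMean A 1) fun w w' hww => hd fun i hi => hww i ?_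
  rw [Set.mem_singleton_iff.1 hi]
  simp

/-- Chebyshev's symmetrization: with an independent copy of the site `0`, the covariance is written
through increments, whose signs can be compared. -/
theorem integral_sub_mul_sub_splice {A h : (ℤ → ℝ) → ℝ} (hA : BddMeas A)
    (hh : BddMeas h) (hd : DependsOn h {0}) :
    ∫ p, (h p.1 - h p.2) * (A p.1 - A (splice {0} p.2 p.1)) ∂((iid μ).prod (iid μ)) =
      2 * (∫ w, A w * h w ∂(iid μ) - (∫ w, A w ∂(iid μ)) * ∫ w, h w ∂(iid μ)) := by
  have hsw : Measurable fun p : (ℤ → ℝ) × (ℤ → ℝ) => splice {0} p.2 p.1 :=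
    (measurable_splice {0}).comp measurable_swap
  have hA1 : BddMeas fun p : (ℤ → ℝ) × (ℤ → ℝ) => A p.1 := hA.comp measurable_fst
  have hA2 : BddMeas fun p : (ℤ → ℝ) × (ℤ → ℝ) => A (splice {0} p.2 p.1) := hA.comp hsw
  have hh1 : BddMeas fun p : (ℤ → ℝ) × (ℤ → ℝ) => h p.1 := hh.comp measurable_fst
  have hh2 : BddMeas fun p : (ℤ → ℝ) × (ℤ → ℝ) => h p.2 := hh.comp measurable_snd
  have i1 := (hA1.mul hh1).integrable ((iid μ).prod (iid μ))
  have i2 := (hh1.mul hA2).integrable ((iid μ).prod (iid μ))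
  have i3 := (hA1.mul hh2).integrable ((iid μ).prod (iid μ))
  have i4 := (hA2.mul hh2).integrable ((iid μ).prod (iid μ))
  have t1 : ∫ p : (ℤ → ℝ) × (ℤ → ℝ), A p.1 * h p.1 ∂((iid μ).prod (iid μ)) =
      ∫ w, A w * h w ∂(iid μ) := by
    rw [integral_prod _ i1]
    simp
  have t3 : ∫ p : (ℤ → ℝ) × (ℤ → ℝ), A p.1 * h p.2 ∂((iid μ).prod (iid μ)) =
      (∫ w, A w ∂(iid μ)) * ∫ w, h w ∂(iid μ) := integral_prod_mul A h
  have t4 : ∫ p : (ℤ → ℝ) × (ℤ → ℝ), A (splice {0} p.2 p.1) * h p.2 ∂((iid μ).prod (iid μ)) =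
      ∫ w, A w * h w ∂(iid μ) := by
    have e : ∀ p : (ℤ → ℝ) × (ℤ → ℝ), A (splice {0} p.2 p.1) * h p.2 =
        (fun q : (ℤ → ℝ) × (ℤ → ℝ) => A (splice {0} q.1 q.2) * h (splice {0} q.1 q.2)) p.swap :=
      fun p => by
        simp only [Prod.fst_swap, Prod.snd_swap]
        rw [hd (x := splice {0} p.2 p.1) (y := p.2) fun i hi => splice_of_mem hi _ _]
    rw [integral_congr_ae (ae_of_all _ e)]
    refine (integral_prod_swap (μ := iid μ) (ν := iid μ)
      fun q : (ℤ → ℝ) × (ℤ → ℝ) => A (splice {0} q.1 q.2) * h (splice {0} q.1 q.2)).trans ?_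
    exact integral_splice (F := fun w => A w * h w) (hA.mul hh).measurable {0}
  have t2 : ∫ p : (ℤ → ℝ) × (ℤ → ℝ), h p.1 * A (splice {0} p.2 p.1) ∂((iid μ).prod (iid μ)) =
      (∫ w, A w ∂(iid μ)) * ∫ w, h w ∂(iid μ) := by
    rw [integral_prod_symm _ i2]
    have hin : ∀ w' : ℤ → ℝ, ∫ w, h w * A (splice {0} w' w) ∂(iid μ) =
        (∫ w, h w ∂(iid μ)) * ∫ w, A (splice {0} w' w) ∂(iid μ) := fun w' => by
      refine integral_mul_of_dependsOn (I := {0}) hh.measurable ?_ hd fun w v hwv => ?_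
      · exact hA.measurable.comp ((measurable_splice {0}).comp measurable_prodMk_left)
      · have : splice {0} w' w = splice {0} w' v := by
          ext i
          by_cases hi : i ∈ ({0} : Set ℤ)
          · rw [splice_of_mem hi, splice_of_mem hi]
          · rw [splice_of_notMem hi, splice_of_notMem hi, hwv i hi]
        rw [this]
    simp_rw [hin]
    rw [integral_const_mul, ← integral_splice hA.measurable {0},
      integral_prod _ ((hA.comp (measurable_splice {0})).integrable _), mul_comm]
  have e : ∀ p : (ℤ → ℝ) × (ℤ → ℝ), (h p.1 - h p.2) * (A p.1 - A (splice {0} p.2 p.1)) =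
      A p.1 * h p.1 - h p.1 * A (splice {0} p.2 p.1) -
        (A p.1 * h p.2 - A (splice {0} p.2 p.1) * h p.2) := fun p => by ring
  simp_rw [e]
  have i12 : Integrable (fun p : (ℤ → ℝ) × (ℤ → ℝ) => A p.1 * h p.1 -
      h p.1 * A (splice {0} p.2 p.1)) ((iid μ).prod (iid μ)) := i1.sub i2
  have i34 : Integrable (fun p : (ℤ → ℝ) × (ℤ → ℝ) => A p.1 * h p.2 -
      A (splice {0} p.2 p.1) * h p.2) ((iid μ).prod (iid μ)) := i3.sub i4
  rw [integral_sub i12 i34, integral_sub i1 i2, integral_sub i3 i4, t1, t2, t3, t4]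
  ring

end

section

variable {μ : Measure ℝ} {B : ℝ} {γ : ℝ → ℝ} {β : ℕ → ℝ} {s : Set ℝ}

/-- Raising one value of the potential raises the total trace. -/
theorem tsum_originEntry_update_sub_nonneg (hγc : Continuous γ)
    (hβ : QuasiLocal (originEntry B γ) β) (hS : μ.support ⊆ Set.Icc (-B) B)
    (hs : ∀ w : ℤ → ℝ, (∀ j, w j ∈ μ.support) → spectrum ℝ (schrodinger w) ⊆ s)
    {g : ℝ → ℝ} (hg : Monotone g) {L : ℝ} (hL : ∀ x y, |g x - g y| ≤ L * |x - y|)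
    (hgγ : Set.EqOn g γ s) {w : ℤ → ℝ} (hw : ∀ j, w j ∈ μ.support) {x y : ℝ}
    (hx : x ∈ μ.support) (hy : y ∈ μ.support) (hxy : x ≤ y) :
    0 ≤ ∑' j : ℤ, (originEntry B γ (translate j (Function.update w 0 y)) -
      originEntry B γ (translate j (Function.update w 0 x))) := by
  refine ge_of_tendsto' (hβ.tendsto_sum_periodize w x y) fun n => ?_
  have hupd : ∀ z ∈ μ.support, ∀ j, Function.update w 0 z j ∈ μ.support := fun z hz j => by
    rcases eq_or_ne j 0 with rfl | hj
    · rwa [Function.update_self]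
    · rw [Function.update_of_ne hj]
      exact hw j
  have hbd : ∀ z ∈ μ.support, ∀ j, |Function.update w 0 z j| ≤ B := fun z hz j =>
    abs_le.2 (hS (hupd z hz j))
  -- The periodized potentials keep values in the support, so their spectra lie in `s`, where `γ`
  -- may be replaced by its increasing extension.
  have hcell : ∀ z ∈ μ.support, ∑ j ∈ Finset.Icc (-(n : ℤ)) n,
      originEntry B γ (translate j (periodize n (Function.update w 0 z))) =
      ∑ j ∈ Finset.range (2 * n + 1),
        diagEntry g (translate (-n) (periodize n (Function.update w 0 z))) j := fun z hz => by
    rw [sum_translate_periodize_eq_sum_range hγc (hbd z hz)]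
    refine Finset.sum_congr rfl fun j _ => diagEntry_congr (fun t ht => ?_) _
    exact (hgγ (hs _ (fun i => hupd z hz _) ht)).symm
  have hper : ∀ z, translate (2 * n + 1 : ℕ) (translate (-n) (periodize n z)) =
      translate (-n) (periodize n z) := fun z => by
    rw [translate_translate, add_comm, ← translate_translate, translate_periodize]
  rw [Finset.sum_sub_distrib, hcell y hy, hcell x hx, sub_nonneg]
  refine sum_diagEntry_le_of_monotone (w := translate (-n) (periodize n (Function.update w 0 x)))
    (v := translate (-n) (periodize n (Function.update w 0 y))) (Nat.succ_pos (2 * n))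
    (fun j => hbd x hx _)
    (fun j => hbd y hy _) (hper _) (hper _) (fun j => ?_) hg hL
  simp only [translate, periodize]
  generalize (j + -(n : ℤ) + n) % ((2 * n + 1 : ℕ) : ℤ) - n = k
  rcases eq_or_ne k 0 with rfl | hk
  · rwa [Function.update_self, Function.update_self]
  · rw [Function.update_of_ne hk, Function.update_of_ne hk]

variable [IsProbabilityMeasure μ]

/-- If the limiting variance vanishes, the total trace does not change with one value of the
potential. -/
theorem tsum_originEntry_update_sub_eq_zero (hB : 0 ≤ B) (hγc : Continuous γ)
    (hβ : QuasiLocal (originEntry B γ) β) (hS : μ.support ⊆ Set.Icc (-B) B)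
    (hs : ∀ w : ℤ → ℝ, (∀ j, w j ∈ μ.support) → spectrum ℝ (schrodinger w) ⊆ s)
    {g : ℝ → ℝ} (hg : Monotone g) {L : ℝ} (hL : ∀ x y, |g x - g y| ≤ L * |x - y|)
    (hgγ : Set.EqOn g γ s)
    (h0 : ∫ w, (pastMean μ 0 (totalChange (originEntry B γ)) w -
      pastMean μ 1 (totalChange (originEntry B γ)) w) ^ 2 ∂(iid μ) = 0)
    {w : ℤ → ℝ} (hw : ∀ j, w j ∈ μ.support) {v : ℝ} (hv : v ∈ μ.support) (hvw : v < w 0) :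
    ∑' j : ℤ, (originEntry B γ (translate j w) -
      originEntry B γ (translate j (Function.update w 0 v))) = 0 := by
  set A := totalChange (originEntry B γ) with hA
  set h : (ℤ → ℝ) → ℝ := fun w => clamp B w 0 with hh
  have hAb : BddMeas A := hβ.bddMeas_totalChange
  have hAc : Continuous A := hβ.continuous_totalChange (continuous_originEntry hB hγc)
  have hhc : Continuous h := (continuous_apply 0).comp (continuous_clamp B)
  have hhb : BddMeas h := ⟨hhc.measurable, B, fun w => abs_clamp_le hB w 0⟩
  have hhd : DependsOn h {0} := fun w w' hww => by
    simp only [hh, clamp, hww 0 (Set.mem_singleton 0)]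
  have hhS : ∀ z : ℤ → ℝ, z 0 ∈ μ.support → h z = z 0 := fun z hz => by
    have := hS hz
    simp only [hh, clamp]
    rw [min_eq_right this.2, max_eq_right this.1]
  -- The increments of `V_0` and of the total change have the same sign, so `F ≥ 0` almost surely,
  -- while its integral vanishes. Continuity turns "almost surely zero" into zero at every pair of
  -- configurations in the support.
  set F : (ℤ → ℝ) × (ℤ → ℝ) → ℝ := fun p =>
    (h p.1 - h p.2) * (A p.1 - A (splice {0} p.2 p.1)) with hF
  have hFint : ∫ p, F p ∂((iid μ).prod (iid μ)) = 0 := by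
    rw [hF, integral_sub_mul_sub_splice hAb hhb hhd,
      integral_mul_eq_of_integral_sq_eq_zero hAb hhb hhd h0]
    ring
  have hdiff : ∀ (z : ℤ → ℝ) (x y : ℝ), A (Function.update z 0 y) - A (Function.update z 0 x) =
      ∑' j : ℤ, (originEntry B γ (translate j (Function.update z 0 y)) -
        originEntry B γ (translate j (Function.update z 0 x))) :=
    fun z x y => hβ.totalChange_update_sub_update z x y
  have hFnn : ∀ᵐ p ∂((iid μ).prod (iid μ)), 0 ≤ F p := by
    have h1 : ∀ᵐ p ∂((iid μ).prod (iid μ)), ∀ j, p.1 j ∈ μ.support :=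
      Measure.quasiMeasurePreserving_fst.ae (ae_forall_mem_support μ)
    have h2 : ∀ᵐ p ∂((iid μ).prod (iid μ)), ∀ j, p.2 j ∈ μ.support :=
      Measure.quasiMeasurePreserving_snd.ae (ae_forall_mem_support μ)
    filter_upwards [h1, h2] with p hp1 hp2
    have e := hdiff p.1 (p.2 0) (p.1 0)
    rw [Function.update_eq_self] at e
    simp only [hF]
    rw [hhS _ (hp1 0), hhS _ (hp2 0), splice_singleton, e]
    rcases le_total (p.1 0) (p.2 0) with hle | hle
    · refine mul_nonneg_of_nonpos_of_nonpos (sub_nonpos.2 hle) ?_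
      have := tsum_originEntry_update_sub_nonneg hγc hβ hS hs hg hL hgγ hp1 (hp1 0) (hp2 0) hle
      rw [← hdiff, Function.update_eq_self] at this
      rw [← e]
      linarith
    · refine mul_nonneg (sub_nonneg.2 hle) ?_
      have := tsum_originEntry_update_sub_nonneg hγc hβ hS hs hg hL hgγ hp1 (hp2 0) (hp1 0) hle
      rwa [Function.update_eq_self] at this
  have hspl : Continuous fun p : (ℤ → ℝ) × (ℤ → ℝ) => splice {0} p.2 p.1 := by
    simp_rw [splice_singleton]
    exact continuous_fst.update 0 ((continuous_apply 0).comp continuous_snd)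
  have hFc : Continuous F := by
    refine Continuous.mul ?_ ?_
    · exact (hhc.comp continuous_fst).sub (hhc.comp continuous_snd)
    · exact (hAc.comp continuous_fst).sub (hAc.comp hspl)
  have hFb : Integrable F ((iid μ).prod (iid μ)) :=
    (((hhb.comp measurable_fst).sub (hhb.comp measurable_snd)).mul
      ((hAb.comp measurable_fst).sub (hAb.comp
        ((measurable_splice {0}).comp measurable_swap)))).integrable _
  have hF0 := (integral_eq_zero_iff_of_nonneg_ae hFnn hFb).1 hFint
  have hpt : F (w, fun _ => v) = 0 := by
    by_contra hne
    have hU : {p | F p ≠ 0} ∈ 𝓝 (w, fun _ : ℤ => v) := hFc.continuousAt.eventually_ne hne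
    obtain ⟨U₁, hU₁, U₂, hU₂, hUU⟩ := mem_nhds_prod_iff.1 hU
    have hpos : 0 < ((iid μ).prod (iid μ)) (U₁ ×ˢ U₂) := by
      rw [Measure.prod_prod]
      exact ENNReal.mul_pos (iid_pos_of_mem_nhds hw hU₁).ne'
        (iid_pos_of_mem_nhds (fun _ => hv) hU₂).ne'
    exact hpos.ne' (measure_mono_null hUU hF0)
  have e := hdiff w v (w 0)
  rw [Function.update_eq_self] at e
  rw [← e]
  simp only [hF] at hpt
  rw [hhS w (hw 0), hhS (fun _ => v) hv, splice_singleton] at hpt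
  exact (mul_eq_zero.1 hpt).resolve_left (sub_pos.2 hvw).ne'

theorem hasSum_int_telescope {g : ℤ → ℝ} {a b s : ℝ} (hs : HasSum (fun j => g j - g (j - 1)) s)
    (ha : Tendsto (fun n : ℕ => g n) atTop (𝓝 a))
    (hb : Tendsto (fun n : ℕ => g (-(n : ℤ))) atTop (𝓝 b)) : s = a - b := by
  have hsum : ∀ n : ℕ, ∑ j ∈ Finset.Icc (-(n : ℤ)) n, (g j - g (j - 1)) =
      g n - g (-((n + 1 : ℕ) : ℤ)) := fun n => by
    rw [← sum_range_sub_eq_sum_Icc]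
    have h := Finset.sum_range_sub (fun j : ℕ => g ((j : ℤ) - (n + 1))) (2 * n + 1)
    have e : ∀ j : ℕ, g (((j + 1 : ℕ) : ℤ) - (n + 1)) - g ((j : ℤ) - (n + 1)) =
        g ((j : ℤ) - n) - g ((j : ℤ) - n - 1) := fun j => by
      congr 2 <;> push_cast <;> ring
    simp_rw [e] at h
    rw [h]
    congr 2
    push_cast
    ring
  have h1 : Tendsto (fun n : ℕ => ∑ j ∈ Finset.Icc (-(n : ℤ)) n, (g j - g (j - 1))) atTop (𝓝 s) :=
    hs.comp Finset.tendsto_Icc_neg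
  refine tendsto_nhds_unique h1 ?_
  simp_rw [hsum]
  exact ha.sub ((tendsto_add_atTop_iff_nat 1).2 hb)

/-- If the limiting variance vanishes, the diagonal entries at the constant potentials with values
in the support agree. -/
theorem diagEntry_const_eq (hB : 0 ≤ B) (hγc : Continuous γ)
    (hβ : QuasiLocal (originEntry B γ) β) (hS : μ.support ⊆ Set.Icc (-B) B)
    (hs : ∀ w : ℤ → ℝ, (∀ j, w j ∈ μ.support) → spectrum ℝ (schrodinger w) ⊆ s)
    {g : ℝ → ℝ} (hg : Monotone g) {L : ℝ} (hL : ∀ x y, |g x - g y| ≤ L * |x - y|)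
    (hgγ : Set.EqOn g γ s)
    (h0 : ∫ w, (pastMean μ 0 (totalChange (originEntry B γ)) w -
      pastMean μ 1 (totalChange (originEntry B γ)) w) ^ 2 ∂(iid μ) = 0)
    {b c : ℝ} (hb : b ∈ μ.support) (hc : c ∈ μ.support) (hbc : b < c) :
    diagEntry γ (fun _ => b) 0 = diagEntry γ (fun _ => c) 0 := by
  -- A domain wall. Putting `b` at the origin moves the wall by one site, so the total change is a
  -- telescoping sum with ends at the two constant potentials.
  set w : ℤ → ℝ := fun i => if i < 0 then b else c with hw
  have hwS : ∀ j, w j ∈ μ.support := fun j => by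
    simp only [hw]
    split_ifs
    · exact hb
    · exact hc
  have hw0 : w 0 = c := if_neg (lt_irrefl 0)
  have hupd : Function.update w 0 b = translate (-1) w := by
    ext i
    simp only [translate, hw]
    rcases lt_trichotomy i 0 with hi | rfl | hi
    · rw [Function.update_of_ne hi.ne, if_pos hi, if_pos (by omega)]
    · rw [Function.update_self, if_pos (by omega)]
    · rw [Function.update_of_ne hi.ne', if_neg (by omega), if_neg (by omega)]
  have hz := tsum_originEntry_update_sub_eq_zero hB hγc hβ hS hs hg hL hgγ h0 hwS hb
    (hw0.symm ▸ hbc)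
  rw [hupd] at hz
  simp_rw [translate_translate] at hz
  have hcont := continuous_originEntry hB hγc
  have hsum : Summable fun j : ℤ => originEntry B γ (translate j w) -
      originEntry B γ (translate (j - 1) w) := by
    refine Summable.of_norm_bounded hβ.summable_natAbs fun j => ?_
    rw [sub_eq_add_neg j, ← translate_translate, ← hupd]
    exact hβ.abs_sub_translate_le_natAbs j fun i hi => (Function.update_of_ne hi _ _).symm
  have hz' : HasSum (fun j : ℤ => originEntry B γ (translate j w) -
      originEntry B γ (translate (j - 1) w)) 0 := by
    have := hsum.hasSum
    simp_rw [sub_eq_add_neg] at hz this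
    rwa [hz] at this
  have htop : Tendsto (fun n : ℕ => originEntry B γ (translate n w)) atTop
      (𝓝 (originEntry B γ fun _ => c)) := by
    refine (hcont.tendsto _).comp (tendsto_pi_nhds.2 fun i => tendsto_const_nhds.congr' ?_)
    filter_upwards [eventually_ge_atTop i.natAbs] with n hn
    exact (if_neg (by omega)).symm
  have hbot : Tendsto (fun n : ℕ => originEntry B γ (translate (-(n : ℤ)) w)) atTop
      (𝓝 (originEntry B γ fun _ => b)) := by
    refine (hcont.tendsto _).comp (tendsto_pi_nhds.2 fun i => tendsto_const_nhds.congr' ?_)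
    filter_upwards [eventually_gt_atTop i.natAbs] with n hn
    exact (if_pos (by omega)).symm
  have := hasSum_int_telescope hz' htop hbot
  have hcl : ∀ z ∈ μ.support, originEntry B γ (fun _ => z) = diagEntry γ (fun _ => z) 0 :=
    fun z hz => by
      rw [originEntry, clamp_of_abs_le fun _ => abs_le.2 (hS hz)]
  rw [hcl b hb, hcl c hc] at this
  linarith

end


/-- The norm bound after subtracting the midpoint of the values; bounding without centering would
lose the exact interval. -/
theorem spectrum_schrodinger_subset_Icc {w : ℤ → ℝ} {b c : ℝ} (hw : ∀ j, w j ∈ Set.Icc b c) :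
    spectrum ℝ (schrodinger w) ⊆ Set.Icc (b - 2) (c + 2) := by
  have hb : ∀ j, |w j - (b + c) / 2| ≤ (c - b) / 2 := fun j => by
    have := hw j
    rw [abs_le]
    constructor <;> linarith [this.1, this.2]
  have h := spectrum_schrodinger_add_const hb ((b + c) / 2)
  simp only [sub_add_cancel] at h
  intro x hx
  rw [h] at hx
  obtain ⟨y, hy, rfl⟩ := hx
  have := abs_le.1 (spectrum_schrodinger_subset hb hy)
  constructor <;> linarith [this.1, this.2]

section

variable {μ : Measure ℝ} [IsProbabilityMeasure μ] {B L : ℝ} {γ : ℝ → ℝ} {β : ℕ → ℝ} {s : Set ℝ}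

/-- With the smallest and the largest values of the support as the two constants, the interval on
which the increasing extension would be constant covers the whole spectrum. -/
theorem integral_sq_pos_of_monotoneOn (hB : 0 ≤ B) (hβ : QuasiLocal (originEntry B γ) β)
    (hL : ∀ x y, |γ x - γ y| ≤ L * |x - y|) (hγb : ∃ C, ∀ x, |γ x| ≤ C)
    (hS : μ.support ⊆ Set.Icc (-B) B) (hnt : μ.support.Nontrivial)
    (hs : ∀ w : ℤ → ℝ, (∀ j, w j ∈ μ.support) → spectrum ℝ (schrodinger w) ⊆ s)
    (hs' : ∃ w : ℤ → ℝ, (∀ j, w j ∈ μ.support) ∧ s ⊆ spectrum ℝ (schrodinger w))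
    (hmono : MonotoneOn γ s) (hne : ∃ x ∈ s, ∃ y ∈ s, γ x ≠ γ y) :
    0 < ∫ w, (pastMean μ 0 (totalChange (originEntry B γ)) w -
      pastMean μ 1 (totalChange (originEntry B γ)) w) ^ 2 ∂(iid μ) := by
  refine lt_of_le_of_ne (integral_nonneg fun w => sq_nonneg _) fun h0 => ?_
  have hL0 : 0 ≤ L := by simpa using (abs_nonneg _).trans (hL 0 1)
  have hc : Continuous γ := (LipschitzWith.of_dist_le_mul (K := ⟨L, hL0⟩) hL).continuous
  obtain ⟨x, hx, y, hy, hxy⟩ := hne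
  obtain ⟨g, hg, hgL, hgγ⟩ := exists_monotone_lipschitz_extension ⟨x, hx⟩ hmono hL hγb
  have hgc : Continuous g := (LipschitzWith.of_dist_le_mul (K := ⟨L, hL0⟩) hgL).continuous
  have hK : IsCompact μ.support :=
    isCompact_Icc.of_isClosed_subset Measure.isClosed_support hS
  have hbm := hK.sInf_mem hnt.nonempty
  have hcm := hK.sSup_mem hnt.nonempty
  have hI : ∀ z ∈ μ.support, z ∈ Set.Icc (sInf μ.support) (sSup μ.support) := fun z hz =>
    ⟨csInf_le hK.bddBelow hz, le_csSup hK.bddAbove hz⟩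
  have hbc : sInf μ.support < sSup μ.support := by
    obtain ⟨z, hz, z', hz', hzz⟩ := hnt
    rcases lt_or_gt_of_ne hzz with h | h
    · exact (hI z hz).1.trans_lt (h.trans_le (hI z' hz').2)
    · exact (hI z' hz').1.trans_lt (h.trans_le (hI z hz).2)
  have heq := diagEntry_const_eq hB hc hβ hS hs hg hgL hgγ h0.symm hbm hcm hbc
  rw [← diagEntry_congr (hgγ.mono (hs _ fun _ => hbm)),
    ← diagEntry_congr (hgγ.mono (hs _ fun _ => hcm))] at heq
  have hconst := eqOn_const_of_diagEntry_const_eq hg hgc hbc heq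
  obtain ⟨w₀, hw₀, hsw⟩ := hs'
  have hsub : s ⊆ Set.Icc (sInf μ.support - 2) (sSup μ.support + 2) :=
    hsw.trans (spectrum_schrodinger_subset_Icc fun j => hI _ (hw₀ j))
  refine hxy ?_
  rw [← hgγ hx, ← hgγ hy, hconst x (hsub hx), hconst y (hsub hy)]

theorem originEntry_neg (B : ℝ) (γ : ℝ → ℝ) (w : ℤ → ℝ) :
    originEntry B (fun x => -γ x) w = -originEntry B γ w := by
  rw [originEntry, originEntry, diagEntry, diagEntry, cfc_neg]
  rfl

theorem QuasiLocal.neg {f : (ℤ → ℝ) → ℝ} (hf : QuasiLocal f β) : QuasiLocal (fun w => -f w) β := by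
  refine ⟨⟨hf.bddMeas.measurable.neg, ?_⟩, hf.summable, fun m w w' h => ?_⟩
  · obtain ⟨C, hC⟩ := hf.bddMeas.bdd
    exact ⟨C, fun w => by rw [abs_neg]; exact hC w⟩
  · rw [← neg_sub', abs_neg]
    exact hf.abs_sub_le m w w' h

theorem totalChange_neg (f : (ℤ → ℝ) → ℝ) (w : ℤ → ℝ) :
    totalChange (fun w => -f w) w = -totalChange f w := by
  rw [totalChange, totalChange, ← tsum_neg]
  exact tsum_congr fun j => by ring

theorem pastMean_neg (k : ℤ) (f : (ℤ → ℝ) → ℝ) (w : ℤ → ℝ) :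
    pastMean μ k (fun w => -f w) w = -pastMean μ k f w := integral_neg _

/-- The limiting variance is positive for functions that are monotone and not constant on the
spectrum. -/
theorem integral_sq_pos (hB : 0 ≤ B) (hβ : QuasiLocal (originEntry B γ) β)
    (hL : ∀ x y, |γ x - γ y| ≤ L * |x - y|) (hγb : ∃ C, ∀ x, |γ x| ≤ C)
    (hS : μ.support ⊆ Set.Icc (-B) B) (hnt : μ.support.Nontrivial)
    (hs : ∀ w : ℤ → ℝ, (∀ j, w j ∈ μ.support) → spectrum ℝ (schrodinger w) ⊆ s)
    (hs' : ∃ w : ℤ → ℝ, (∀ j, w j ∈ μ.support) ∧ s ⊆ spectrum ℝ (schrodinger w))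
    (hmono : MonotoneOn γ s ∨ AntitoneOn γ s) (hne : ∃ x ∈ s, ∃ y ∈ s, γ x ≠ γ y) :
    0 < ∫ w, (pastMean μ 0 (totalChange (originEntry B γ)) w -
      pastMean μ 1 (totalChange (originEntry B γ)) w) ^ 2 ∂(iid μ) := by
  rcases hmono with hmono | hanti
  · exact integral_sq_pos_of_monotoneOn hB hβ hL hγb hS hnt hs hs' hmono hne
  have hneg : originEntry B (fun x => -γ x) = fun w => -originEntry B γ w :=
    funext (originEntry_neg B γ)
  obtain ⟨C, hC⟩ := hγb
  obtain ⟨x, hx, y, hy, hxy⟩ := hne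
  have h := integral_sq_pos_of_monotoneOn (μ := μ) (γ := fun x => -γ x) (L := L) hB
    (hneg ▸ hβ.neg) (fun x y => by rw [← neg_sub', abs_neg]; exact hL x y)
    ⟨C, fun x => by rw [abs_neg]; exact hC x⟩ hS hnt hs hs' hanti.neg
    ⟨x, hx, y, hy, fun h => hxy (neg_injective h)⟩
  rw [hneg, funext (totalChange_neg _)] at h
  refine h.trans_eq (integral_congr_ae (ae_of_all _ fun w => ?_))
  simp only [pastMean_neg]
  ring

theorem support_nontrivial (hμ : ¬ ∃ c : ℝ, ∀ᵐ x ∂μ, x = c) : μ.support.Nontrivial := by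
  by_contra h
  rw [Set.not_nontrivial_iff] at h
  obtain ⟨c, hc⟩ := Measure.nonempty_support (IsProbabilityMeasure.ne_zero μ)
  refine hμ ⟨c, ?_⟩
  filter_upwards [μ.support_mem_ae] with x hx
  exact h hx hc

end


/-! ### Transfer of limits along uniformly close sequences -/

section

variable {X : Type*} [MeasurableSpace X] {P : Measure X} [IsProbabilityMeasure P]
  {Y Z : ℕ → X → ℝ}

theorem tendsto_integral_sq_of_close (hY : ∀ n, Measurable (Y n)) (hZ : ∀ n, BddMeas (Z n))
    (h : ∀ ε > 0, ∀ᶠ n in atTop, ∀ᵐ x ∂P, |Y n x - Z n x| ≤ ε) {s : ℝ}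
    (hs : Tendsto (fun n => ∫ x, Z n x ^ 2 ∂P) atTop (𝓝 s)) :
    Tendsto (fun n => ∫ x, Y n x ^ 2 ∂P) atTop (𝓝 s) := by
  have hZi : ∀ n, Integrable (fun x => Z n x ^ 2) P := fun n => by
    simp_rw [pow_two]
    exact ((hZ n).mul (hZ n)).integrable P
  have hd : Tendsto (fun n => ∫ x, Y n x ^ 2 ∂P - ∫ x, Z n x ^ 2 ∂P) atTop (𝓝 0) := by
    rw [Metric.tendsto_nhds]
    intro η hη
    have hs0 : 0 < |s| + 4 := by positivity
    -- For `ε ≤ 1` the difference of the squares is at most `ε (Z² + 2)`, whose integral is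
    -- eventually below `ε (|s| + 3)`.
    set ε := min 1 (η / (|s| + 4)) with hε
    have hε0 : 0 < ε := lt_min one_pos (by positivity)
    have hεη : ε * (|s| + 4) ≤ η := by
      rw [← le_div_iff₀ hs0]
      exact min_le_right _ _
    have hε1 : ε ≤ 1 := min_le_left _ _
    have hs1 : ∀ᶠ n in atTop, ∫ x, Z n x ^ 2 ∂P < |s| + 1 :=
      hs.eventually_lt_const ((le_abs_self s).trans_lt (lt_add_one _))
    filter_upwards [h ε hε0, hs1] with n hn hn1
    have hpt : ∀ᵐ x ∂P, |Y n x ^ 2 - Z n x ^ 2| ≤ ε * (Z n x ^ 2 + 2) := by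
      filter_upwards [hn] with x hx
      have e : Y n x ^ 2 - Z n x ^ 2 = (Y n x - Z n x) * ((Y n x - Z n x) + 2 * Z n x) := by ring
      rw [e, abs_mul]
      refine mul_le_mul hx ?_ (abs_nonneg _) hε0.le
      refine (abs_add_le _ _).trans ?_
      rw [abs_mul, abs_two]
      nlinarith [sq_nonneg (|Z n x| - 1), sq_abs (Z n x)]
    have hbi : Integrable (fun x => ε * (Z n x ^ 2 + 2)) P :=
      ((hZi n).add (integrable_const 2)).const_mul ε
    have hdi : Integrable (fun x => Y n x ^ 2 - Z n x ^ 2) P :=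
      hbi.mono' (((hY n).pow_const 2).sub ((hZ n).measurable.pow_const 2)).aestronglyMeasurable hpt
    have hYi : Integrable (fun x => Y n x ^ 2) P := by
      refine (hdi.add (hZi n)).congr (ae_of_all _ fun x => ?_)
      simp
    rw [dist_zero_right, ← integral_sub hYi (hZi n)]
    refine (norm_integral_le_of_norm_le hbi hpt).trans_lt ?_
    rw [integral_const_mul, integral_add (hZi n) (integrable_const 2), integral_const]
    simp only [probReal_univ, one_smul]
    nlinarith
  simpa using hd.add hs

theorem tendsto_integral_exp_of_close (hY : ∀ n, Measurable (Y n)) (hZ : ∀ n, Measurable (Z n))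
    (h : ∀ ε > 0, ∀ᶠ n in atTop, ∀ᵐ x ∂P, |Y n x - Z n x| ≤ ε) {t : ℝ} {c : ℂ}
    (hs : Tendsto (fun n => ∫ x, Complex.exp ((t * Z n x : ℝ) * Complex.I) ∂P) atTop (𝓝 c)) :
    Tendsto (fun n => ∫ x, Complex.exp ((t * Y n x : ℝ) * Complex.I) ∂P) atTop (𝓝 c) := by
  have hd : Tendsto (fun n => ∫ x, Complex.exp ((t * Y n x : ℝ) * Complex.I) ∂P -
      ∫ x, Complex.exp ((t * Z n x : ℝ) * Complex.I) ∂P) atTop (𝓝 0) := by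
    rw [Metric.tendsto_nhds]
    intro η hη
    have hε0 : 0 < η / (|t| + 1) := by positivity
    filter_upwards [h _ hε0] with n hn
    rw [dist_zero_right, ← integral_sub (integrable_exp_mul_I ((hY n).const_mul t))
      (integrable_exp_mul_I ((hZ n).const_mul t))]
    have hb : ∀ᵐ x ∂P, ‖Complex.exp ((t * Y n x : ℝ) * Complex.I) -
        Complex.exp ((t * Z n x : ℝ) * Complex.I)‖ ≤ |t| * (η / (|t| + 1)) := by
      filter_upwards [hn] with x hx
      refine (norm_exp_ofReal_mul_I_sub_le _ _).trans ?_
      rw [← mul_sub, abs_mul]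
      exact mul_le_mul_of_nonneg_left hx (abs_nonneg t)
    have := norm_integral_le_of_norm_le_const hb
    rw [probReal_univ, mul_one] at this
    refine this.trans_lt ?_
    rw [mul_div_assoc', div_lt_iff₀ (by positivity)]
    nlinarith [abs_nonneg t]
  simpa using hd.add hs

/-- Convergence of the characteristic functions to that of a centered Gaussian law gives the
convergence of the probabilities of intervals. -/
theorem tendsto_measureReal_ordConnected (hY : ∀ n, Measurable (Y n)) {s : ℝ} (hs0 : 0 < s)
    (h : ∀ t : ℝ, Tendsto (fun n => ∫ x, Complex.exp ((t * Y n x : ℝ) * Complex.I) ∂P) atTop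
      (𝓝 (Complex.exp (-(t ^ 2 * s / 2 : ℝ))))) {Δ : Set ℝ} (hΔ : Δ.OrdConnected) :
    Tendsto (fun n => P.real {x | (√s)⁻¹ * Y n x ∈ Δ}) atTop (𝓝 ((gaussianReal 0 1).real Δ)) := by
  have hm : ∀ n, Measurable fun x => (√s)⁻¹ * Y n x := fun n => (hY n).const_mul _
  let ν : ℕ → ProbabilityMeasure ℝ := fun n =>
    ⟨P.map fun x => (√s)⁻¹ * Y n x, Measure.isProbabilityMeasure_map (hm n).aemeasurable⟩
  let ν₀ : ProbabilityMeasure ℝ := ⟨gaussianReal 0 1, inferInstance⟩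
  have hν : Tendsto ν atTop (𝓝 ν₀) := by
    refine ProbabilityMeasure.tendsto_iff_tendsto_charFun.2 fun t => ?_
    have hlim : charFun (ν₀ : Measure ℝ) t =
        Complex.exp (-(((t * (√s)⁻¹) ^ 2 * s / 2 : ℝ) : ℂ)) := by
      change charFun (gaussianReal 0 1) t = _
      have hts : (t * (√s)⁻¹) ^ 2 * s / 2 = t ^ 2 / 2 := by
        rw [mul_pow, inv_pow, Real.sq_sqrt hs0.le, inv_mul_cancel_right₀ hs0.ne']
      rw [charFun_gaussianReal, hts]
      congr 1
      push_cast
      simp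
    rw [hlim]
    refine (h (t * (√s)⁻¹)).congr fun n => ?_
    change _ = charFun (P.map fun x => (√s)⁻¹ * Y n x) t
    rw [charFun_apply_real, integral_map (hm n).aemeasurable (by fun_prop)]
    refine integral_congr_ae (ae_of_all _ fun x => ?_)
    dsimp only
    push_cast
    congr 1
    ring
  -- An interval is convex, so its boundary is a null set for the Gaussian law, and weak convergence
  -- applies to it.
  have hfr : (ν₀ : Measure ℝ) (frontier Δ) = 0 :=
    gaussianReal_absolutelyContinuous 0 one_ne_zero
      (hΔ.convex.addHaar_frontier volume)
  have hlim := ProbabilityMeasure.tendsto_measure_of_null_frontier_of_tendsto' hν hfr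
  have hlim' := (ENNReal.tendsto_toReal (measure_ne_top _ Δ)).comp hlim
  refine hlim'.congr fun n => ?_
  change (Measure.map (fun x => (√s)⁻¹ * Y n x) P Δ).toReal = _
  rw [Measure.map_apply (hm n) hΔ.measurableSet]
  rfl

end

/-! ### Regularity of functions with a Fourier moment -/

theorem HasFourierMoment.exists_abs_le {θ : ℝ} {f : ℝ → ℝ} (hf : HasFourierMoment θ f) :
    ∃ C, ∀ x, |f x| ≤ C := by
  obtain ⟨g, -, -, hg⟩ := hf
  refine ⟨∫ t, ‖g t‖, fun x => ?_⟩
  rw [← Real.norm_eq_abs, ← Complex.norm_real, hg]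
  refine (norm_integral_le_integral_norm _).trans (le_of_eq ?_)
  refine integral_congr_ae (ae_of_all _ fun t => ?_)
  dsimp only
  rw [norm_mul, norm_exp_I_mul, mul_one]

theorem abs_sub_le_of_hasDerivAt {f f' : ℝ → ℝ} {C : ℝ} (hff : ∀ x, HasDerivAt f (f' x) x)
    (hC : ∀ x, |f' x| ≤ C) (x y : ℝ) : |f x - f y| ≤ C * |x - y| :=
  convex_univ.norm_image_sub_le_of_norm_hasDerivWithin_le
    (fun z _ => (hff z).hasDerivWithinAt) (fun z _ => hC z) (Set.mem_univ y) (Set.mem_univ x)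

theorem HasFourierMoment.exists_polyRate {θ : ℝ} (hθ : 1 < θ) {f : ℝ → ℝ}
    (hf : HasFourierMoment θ f) {R : ℝ} (hR : 0 < R) : ∃ β, PolyRate R f β ∧ Summable β := by
  obtain ⟨C, -, hC⟩ := hf.exists_polynomial (by linarith) hR
  refine ⟨fun m => C * ((m : ℝ) + 1) ^ (-θ), hC, Summable.mul_left _ ?_⟩
  have h := (summable_nat_add_iff 1).2 (Real.summable_nat_rpow.2 (by linarith : -θ < -1))
  simpa using h

/-! ### The fluctuations -/

section Fluct

variable {Ω : Type*} [MeasurableSpace Ω] {P : Measure Ω} {V : ℤ → Ω → ℝ} {μ : Measure ℝ} {B : ℝ}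
  {γ : ℝ → ℝ}

theorem integral_pot (hV : ∀ j, Measurable (V j)) (hmap : P.map (pot V) = iid μ)
    {E : Type*} [NormedAddCommGroup E] [NormedSpace ℝ E] {F : (ℤ → ℝ) → E}
    (hF : AEStronglyMeasurable F (iid μ)) :
    ∫ ω, F (pot V ω) ∂P = ∫ w, F w ∂(iid μ) := by
  rw [← hmap] at hF ⊢
  exact (integral_map (measurable_pot hV).aemeasurable hF).symm

theorem measurable_fluct {a φ : ℝ → ℝ} (hV : ∀ j, Measurable (V j)) (hB0 : 0 ≤ B)
    (hB : ∀ j ω, |V j ω| ≤ B) (ha : Continuous a) (hφ : Continuous φ) (M : ℕ) :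
    Measurable (fluct P V φ a γ M) := by
  have h := (continuous_traceRestr hB0 ha hφ M).measurable.comp (measurable_pot hV)
  have heq : (fun ω => traceRestr φ a (pot V ω) M) =
      (fun w => traceRestr φ a (clamp B w) M) ∘ pot V := by
    ext ω
    rw [Function.comp_apply, clamp_of_abs_le (w := pot V ω) fun j => hB j ω]
  unfold fluct
  rw [← heq] at h
  exact (h.sub_const _).const_mul _

theorem covEntry_eq_covariance (hV : ∀ j, Measurable (V j)) (hB : ∀ j ω, |V j ω| ≤ B)
    (hmap : P.map (pot V) = iid μ) (hγc : Continuous γ) {β : ℕ → ℝ}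
    (hβ : QuasiLocal (originEntry B γ) β) (l : ℤ) :
    covEntry P V γ l =
      cov[originEntry B γ, fun w => originEntry B γ (translate l w); iid μ] := by
  have hw : ∀ ω j, |pot V ω j| ≤ B := fun ω j => hB j ω
  have hm : ∀ j : ℤ, Measurable fun w => originEntry B γ (translate j w) := fun j =>
    (hβ.bddMeas_translate j).measurable
  have hc : ∀ j ω, centeredEntry P V γ j ω = originEntry B γ (translate j (pot V ω)) -
      ∫ w, originEntry B γ (translate j w) ∂(iid μ) := fun j ω => by
    rw [centeredEntry, originEntry_translate hγc (hw ω),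
      ← integral_pot hV hmap (hm j).aestronglyMeasurable]
    simp_rw [fun ω => originEntry_translate hγc (hw ω) j]
  have h0 : ∀ w, translate 0 w = w := fun w => by
    ext i
    rw [translate, add_zero]
  rw [covEntry, covariance]
  simp_rw [hc]
  rw [integral_pot hV hmap (F := fun w => (originEntry B γ (translate 0 w) -
      ∫ w, originEntry B γ (translate 0 w) ∂(iid μ)) * (originEntry B γ (translate l w) -
      ∫ w, originEntry B γ (translate l w) ∂(iid μ)))]
  · simp_rw [h0]
  · exact (((hm 0).sub_const _).mul ((hm l).sub_const _)).aestronglyMeasurable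

/-- The normalized and centered sum of `γ_{jj}(H)` over `[-M, M]` as a function of the potential. -/
def boxFluct (μ : Measure ℝ) (f : (ℤ → ℝ) → ℝ) (M : ℕ) (w : ℤ → ℝ) : ℝ :=
  (√((2 * M + 1 : ℕ) : ℝ))⁻¹ * (birkhoff f (2 * M + 1) (translate (-M) w) -
    ∫ w', birkhoff f (2 * M + 1) w' ∂(iid μ))

theorem bddMeas_boxFluct {f : (ℤ → ℝ) → ℝ} {β : ℕ → ℝ} (hf : QuasiLocal f β) (M : ℕ) :
    BddMeas (boxFluct μ f M) :=
  (BddMeas.const _).mul (((hf.bddMeas_birkhoff _).comp (measurable_translate _)).sub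
    (BddMeas.const _))

variable [IsProbabilityMeasure μ]

theorem birkhoff_translate_originEntry (hγ : Continuous γ) {w : ℤ → ℝ} (hw : ∀ j, |w j| ≤ B)
    (M : ℕ) : birkhoff (originEntry B γ) (2 * M + 1) (translate (-M) w) =
      ∑ j ∈ Finset.Icc (-(M : ℤ)) M, diagEntry γ w j := by
  rw [birkhoff, ← sum_range_sub_eq_sum_Icc]
  refine Finset.sum_congr rfl fun j _ => ?_
  rw [translate_translate, originEntry_translate hγ hw, sub_eq_add_neg]

theorem integral_birkhoff {f : (ℤ → ℝ) → ℝ} {β : ℕ → ℝ} (hf : QuasiLocal f β) (n : ℕ) :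
    ∫ w, birkhoff f n w ∂(iid μ) = n * ∫ w, f w ∂(iid μ) := by
  unfold birkhoff
  rw [integral_finsetSum _ fun (j : ℕ) _ => (hf.bddMeas_translate (j : ℤ)).integrable _]
  simp_rw [integral_translate hf.bddMeas.measurable]
  simp

theorem tendsto_integral_sq_boxFluct {f : (ℤ → ℝ) → ℝ} {β : ℕ → ℝ} (hf : QuasiLocal f β) {s : ℝ}
    (hs : HasSum (fun n : ℤ => cov[f, fun w => f (translate n w); iid μ]) s) :
    Tendsto (fun M => ∫ w, boxFluct μ f M w ^ 2 ∂(iid μ)) atTop (𝓝 s) := by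
  have hsub : Tendsto (fun M : ℕ => 2 * M + 1) atTop atTop :=
    tendsto_atTop_mono (fun M => by rw [id]; omega) tendsto_id
  refine ((hf.tendsto_variance_birkhoff hs).comp hsub).congr fun M => ?_
  have hb := hf.bddMeas_birkhoff (2 * M + 1)
  rw [Function.comp_apply, variance_eq_integral hb.measurable.aemeasurable]
  have hm : Measurable fun w => (birkhoff f (2 * M + 1) w -
      ∫ w', birkhoff f (2 * M + 1) w' ∂(iid μ)) ^ 2 := (hb.measurable.sub_const _).pow_const 2
  rw [← integral_translate (μ := μ) hm (-M), ← integral_const_mul]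
  refine integral_congr_ae (ae_of_all _ fun w => ?_)
  dsimp only
  rw [boxFluct, mul_pow, inv_pow, Real.sq_sqrt (Nat.cast_nonneg _)]

theorem tendsto_integral_exp_boxFluct {f : (ℤ → ℝ) → ℝ} {β : ℕ → ℝ} (hf : QuasiLocal f β) {s : ℝ}
    (hs0 : 0 < s) (hs : HasSum (fun n : ℤ => cov[f, fun w => f (translate n w); iid μ]) s) (t : ℝ) :
    Tendsto (fun M => ∫ w, Complex.exp ((t * boxFluct μ f M w : ℝ) * Complex.I) ∂(iid μ)) atTop
      (𝓝 (Complex.exp (-(t ^ 2 * s / 2 : ℝ)))) := by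
  have hsub : Tendsto (fun M : ℕ => 2 * M + 1) atTop atTop :=
    tendsto_atTop_mono (fun M => by rw [id]; omega) tendsto_id
  refine ((hf.tendsto_charFun_birkhoff hs0 hs t).comp hsub).congr fun M => ?_
  have hb := hf.bddMeas_birkhoff (2 * M + 1)
  have hm : Measurable fun w => Complex.exp ((t * ((√((2 * M + 1 : ℕ) : ℝ))⁻¹ *
      (birkhoff f (2 * M + 1) w - ∫ w', birkhoff f (2 * M + 1) w' ∂(iid μ))) : ℝ) *
        Complex.I) := by
    have := hb.measurable
    fun_prop
  exact (integral_translate (μ := μ) hm (-M)).symm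

variable [IsProbabilityMeasure P]

/-- The fluctuation is uniformly close to the normalized sum of the diagonal entries. -/
theorem eventually_abs_fluct_sub_le {a φ φ' : ℝ → ℝ} (hV : ∀ j, Measurable (V j)) (hB0 : 0 ≤ B)
    (hB : ∀ j ω, |V j ω| ≤ B) (hmap : P.map (pot V) = iid μ) (hS : μ.support ⊆ Set.Icc (-B) B)
    (hγc : Continuous γ) (hγb : ∃ C, ∀ t, |γ t| ≤ C) (ha : Continuous a) (hφ' : Continuous φ')
    (hφ : ∀ x, HasDerivAt φ (φ' x) x) {β β' : ℕ → ℝ} (hβ : Summable β)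
    (haβ : PolyRate (2 + B) a β) (hβ' : QuasiLocal (originEntry B γ) β')
    (hγ : ∀ x ∈ detSpectrum P V, γ x = φ (a x)) {ε : ℝ} (hε : 0 < ε) :
    ∀ᶠ M in atTop, ∀ᵐ ω ∂P,
      |fluct P V φ a γ M ω - boxFluct μ (originEntry B γ) M (pot V ω)| ≤ ε := by
  obtain ⟨K, hK0, hK⟩ := exists_abs_traceRestr_sub_le hB0 ha hφ' hφ hβ haβ (half_pos hε)
  have hlim : Tendsto (fun M : ℕ => √(2 * (M : ℝ) + 1)) atTop atTop := by
    refine Real.tendsto_sqrt_atTop.comp ?_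
    exact tendsto_atTop_add_const_right _ _
      (tendsto_natCast_atTop_atTop.const_mul_atTop zero_lt_two)
  filter_upwards [hlim.eventually_ge_atTop (K / (ε / 2))] with M hM
  filter_upwards [ae_spectrum_eq_detSpectrum hV hmap hB hS] with ω hω
  set r := √(2 * (M : ℝ) + 1) with hr
  have hr0 : 0 < r := Real.sqrt_pos.2 (by positivity)
  have hw : ∀ j, |pot V ω j| ≤ B := fun j => hB j ω
  have h1 := hK (pot V ω) hw M
  have h2 : ∀ j, diagEntry (fun x => φ (a x)) (pot V ω) j = diagEntry γ (pot V ω) j := fun j =>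
    diagEntry_congr (fun x hx => (hγ x (hω ▸ hx)).symm) j
  simp_rw [h2] at h1
  have h3 : ∫ w, originEntry B γ w ∂(iid μ) = ∫ ω, diagEntry γ (pot V ω) 0 ∂P := by
    rw [← integral_pot hV hmap hβ'.bddMeas.measurable.aestronglyMeasurable]
    refine integral_congr_ae (ae_of_all _ fun ω => ?_)
    dsimp only
    rw [originEntry, clamp_of_abs_le (w := pot V ω) fun j => hB j ω]
  have hcast : ((2 * M + 1 : ℕ) : ℝ) = 2 * (M : ℝ) + 1 := by push_cast; rfl
  rw [fluct, boxFluct, setIntegral_idsMeasure hV hB hmap hS hγc hγb,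
    birkhoff_translate_originEntry hγc hw, integral_birkhoff hβ', h3, hcast, ← mul_sub, abs_mul,
    sub_sub_sub_cancel_right, abs_of_pos (inv_pos.2 hr0), inv_mul_le_iff₀ hr0]
  refine h1.trans ?_
  rw [div_le_iff₀ (half_pos hε)] at hM
  linarith

theorem integral_sq_condExp_siteVar (hV : ∀ j, Measurable (V j)) (hmap : P.map (pot V) = iid μ)
    {A : (ℤ → ℝ) → ℝ} (hA : BddMeas A) :
    ∫ ω, ((P[fun ω => A (pot V ω) | sigmaFrom V 0]) ω -
      (P[fun ω => A (pot V ω) | sigmaFrom V 1]) ω) ^ 2 ∂P =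
      ∫ w, (pastMean μ 0 A w - pastMean μ 1 A w) ^ 2 ∂(iid μ) := by
  rw [← integral_pot hV hmap (F := fun w => (pastMean μ 0 A w - pastMean μ 1 A w) ^ 2)]
  · refine integral_congr_ae ?_
    filter_upwards [condExp_sigmaFrom hV hmap hA 0, condExp_sigmaFrom hV hmap hA 1] with ω h0 h1
    rw [h0, h1]
  · exact (((bddMeas_pastMean hA 0).measurable.sub
      (bddMeas_pastMean hA 1).measurable).pow_const 2).aestronglyMeasurable

/-- By the tower property the conditional mean in the variance is `E{X | m₁}`, and the outer
expectation removes the conditioning. -/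
theorem integral_condVar_condExp {Ω : Type*} {m₀ m₁ mΩ : MeasurableSpace Ω} {P : Measure Ω}
    [IsProbabilityMeasure P] {X : Ω → ℝ} (h₁₀ : m₁ ≤ m₀) (h₀ : m₀ ≤ mΩ) :
    ∫ ω, (Var[P[X | m₀]; P | m₁]) ω ∂P = ∫ ω, ((P[X | m₀]) ω - (P[X | m₁]) ω) ^ 2 ∂P := by
  rw [condVar, integral_condExp (h₁₀.trans h₀)]
  refine integral_congr_ae ?_
  filter_upwards [condExp_condExp_of_le (f := X) (μ := P) h₁₀ h₀] with ω hω
  simp only [Pi.pow_apply, Pi.sub_apply]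
  rw [hω]

end Fluct

end AndersonCLT

end

/-! ### The central limit theorem for the restricted traces. -/

open AndersonCLT in
/-- The functions `a, φ, γ : ℝ → ℝ` are the extensions to the whole axis; only `γ = φ ∘ a` on the
spectrum `σ(H)` is required of them besides the Fourier condition. -/
theorem theorem1 {Ω : Type*} [MeasurableSpace Ω] (P : Measure Ω) [IsProbabilityMeasure P]
    (V : ℤ → Ω → ℝ) (hVmeas : ∀ j, Measurable (V j)) (hVindep : iIndepFun V P)
    (hVident : ∀ j, IdentDistrib (V j) (V 0) P P)
    (Vbar : ℝ) (hVbdd : ∀ j ω, |V j ω| ≤ Vbar)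
    (a φ γ : ℝ → ℝ) (hγ : ∀ x ∈ detSpectrum P V, γ x = φ (a x))
    (θ : ℝ) (hθ : 1 < θ) (haF : HasFourierMoment θ a) (hφF : HasFourierMoment θ φ)
    (hγF : HasFourierMoment θ γ) :
    ∃ σsq : ℝ,
      Tendsto (fun M : ℕ => ∫ ω, fluct P V φ a γ M ω ^ 2 ∂P) atTop (𝓝 σsq) ∧
      HasSum (covEntry P V γ) σsq ∧
      σsq = ∫ ω, ((P[siteVar V γ | sigmaFrom V 0]) ω - (P[siteVar V γ | sigmaFrom V 1]) ω) ^ 2 ∂P ∧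
      σsq = ∫ ω, (Var[P[siteVar V γ | sigmaFrom V 0]; P | sigmaFrom V 1]) ω ∂P ∧
      ((¬ ∃ c : ℝ, ∀ᵐ ω ∂P, V 0 ω = c) →
        (MonotoneOn γ (detSpectrum P V) ∨ AntitoneOn γ (detSpectrum P V)) →
        (∃ x ∈ detSpectrum P V, ∃ y ∈ detSpectrum P V, γ x ≠ γ y) →
          0 < σsq ∧
          ∀ Δ : Set ℝ, Δ.OrdConnected →
            Tendsto (fun M : ℕ => P.real {ω | (√σsq)⁻¹ * fluct P V φ a γ M ω ∈ Δ}) atTop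
              (𝓝 ((gaussianReal 0 1).real Δ))) := by
  have hprob : IsProbabilityMeasure (P.map (V 0)) :=
    Measure.isProbabilityMeasure_map (hVmeas 0).aemeasurable
  have hmap := map_pot hVmeas hVindep hVident
  have hS := support_subset_Icc (P := P) hVmeas rfl hVbdd
  set μ := P.map (V 0) with hμ
  have hB0 : 0 ≤ Vbar := by
    obtain ⟨ω⟩ := P.nonempty_of_neZero
    exact (abs_nonneg _).trans (hVbdd 0 ω)
  have hR : 0 < 2 + Vbar := by linarith
  obtain ⟨γ', hγ', ⟨L, hL⟩, hγd⟩ := hγF.exists_hasDerivAt hθ.le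
  obtain ⟨φ', hφ', -, hφd⟩ := hφF.exists_hasDerivAt hθ.le
  obtain ⟨a', -, -, had⟩ := haF.exists_hasDerivAt hθ.le
  have hγc : Continuous γ := continuous_iff_continuousAt.2 fun x => (hγd x).continuousAt
  have hφc : Continuous φ := continuous_iff_continuousAt.2 fun x => (hφd x).continuousAt
  have hac : Continuous a := continuous_iff_continuousAt.2 fun x => (had x).continuousAt
  obtain ⟨βγ, hβγ, hβγs⟩ := hγF.exists_polyRate hθ hR
  obtain ⟨βa, hβa, hβas⟩ := haF.exists_polyRate hθ hR
  obtain ⟨β, hβ⟩ := exists_quasiLocal_originEntry hB0 hγc hβγ hβγs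
  have hs := hβ.hasSum_covariance (μ := μ)
  have hY := measurable_fluct (P := P) (γ := γ) hVmeas hB0 hVbdd hac hφc
  have hZ : ∀ M, BddMeas fun ω => boxFluct μ (originEntry Vbar γ) M (pot V ω) := fun M =>
    (bddMeas_boxFluct hβ M).comp (measurable_pot hVmeas)
  have hclose : ∀ ε > 0, ∀ᶠ M in atTop, ∀ᵐ ω ∂P,
      |fluct P V φ a γ M ω - boxFluct μ (originEntry Vbar γ) M (pot V ω)| ≤ ε := fun ε hε =>
    eventually_abs_fluct_sub_le hVmeas hB0 hVbdd hmap hS hγc hγF.exists_abs_le hac hφ' hφd hβas hβa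
      hβ hγ hε
  have hA := hβ.bddMeas_totalChange
  have hsq := integral_sq_condExp_siteVar hVmeas hmap hA
  rw [← siteVar_eq_totalChange hVbdd hγ' hγd hβ] at hsq
  -- The limiting variance is given by the second moment of the martingale difference of the total
  -- change under the product law; the other expressions are compared with it.
  refine ⟨_, ?_, ?_, hsq.symm, ?_, fun hnc hmono hne => ?_⟩
  · refine tendsto_integral_sq_of_close hY hZ hclose
      ((tendsto_integral_sq_boxFluct hβ hs).congr fun M => ?_)
    exact (integral_pot hVmeas hmap
      ((bddMeas_boxFluct hβ M).measurable.pow_const 2).aestronglyMeasurable).symm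
  · rwa [funext (covEntry_eq_covariance hVmeas hVbdd hmap hγc hβ)]
  · rw [integral_condVar_condExp (sigmaFrom_anti V zero_le_one) (sigmaFrom_le hVmeas 0), hsq]
  · have hnt : μ.support.Nontrivial := support_nontrivial fun ⟨c, hc⟩ =>
      hnc ⟨c, ae_of_ae_map (hVmeas 0).aemeasurable hc⟩
    -- One typical realization, with values in the support and with the full non-random spectrum,
    -- places that spectrum in the interval used for positivity.
    obtain ⟨ω, hω, hωS⟩ := ((ae_spectrum_eq_detSpectrum hVmeas hmap hVbdd hS).and
      (ae_pot_mem_support hVmeas hmap)).exists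
    have hpos := integral_sq_pos hB0 hβ (abs_sub_le_of_hasDerivAt hγd hL) hγF.exists_abs_le hS hnt
      (fun w hw => spectrum_subset_detSpectrum hVmeas hmap hVbdd hS hw) ⟨_, hωS, hω.ge⟩ hmono hne
    refine ⟨hpos, fun Δ hΔ => tendsto_measureReal_ordConnected hY hpos (fun t => ?_) hΔ⟩
    refine tendsto_integral_exp_of_close hY (fun M => (hZ M).measurable) hclose
      ((tendsto_integral_exp_boxFluct hβ hpos hs t).congr fun M => ?_)
    have hm := (bddMeas_boxFluct (μ := μ) hβ M).measurable
    refine (integral_pot hVmeas hmap (Measurable.aestronglyMeasurable ?_)).symm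
    fun_prop
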